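/- Let $U\subset\mathbb R^n$ be open with coordinates $u^1,\dots,u^n$, and let all functions below be $C^\infty$ on $U$. Let $g=(g_{ij})$ be a flat (pseudo-Riemannian) metric on $U$ with inverse $g^{ij}$, Levi-Civita connection $\nabla$ and Christoffel symbols $\Gamma$, and write $\nabla^i\nabla_jF=g^{is}\nabla_s\nabla_jF$, $F_i=\partial F/\partial u^i$ and $(\nabla F,\nabla G)=g^{ij}F_iG_j$. Consider the Hamiltonian system $u^i_t=v^i_j(u)u^j_x$, $v^i_j=\nabla^i\nabla_jh$, generated by the local operator $J^{ij}=g^{ij}\frac{d}{dx}-g^{is}\Gamma^j_{sk}u^k_x$ and the density $h$. Call $E$ a flux of $F$ along a system $u_s=w(u)u_x$ if $F_iw^i_j=\partial_jE$, i.e. if the one-form $F\,dx+E\,ds$ is closed by virtue of the system. Let $A$ and $M$ be fluxes of $B$ and $N$ along $u_t=vu_x$, with $BM-AN\ne0$ and $\det(M-Nv)\neq 0$ on $U$, and consider the reciprocal transformation $d\tilde x=B\,dx+A\,dt$, $d\tilde t=N\,dx+M\,dt$, which takes the system to $u_{\tilde t}=\tilde v u_{\tilde x}$, $\tilde v=(Bv-A)(M-Nv)^{-1}$.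 Let $$\tilde g_{ij}=\frac{(M\delta^s_i-Nv^s_i)(M\delta^r_j-Nv^r_j)}{(BM-AN)^2}\,g_{sr}.$$ Let $u^i_\tau=(\nabla^i\nabla_jN)u^j_x$ and $u^i_\zeta=(\nabla^i\nabla_jB)u^j_x$ be the Hamiltonian flows with densities $N$ and $B$. Suppose that $P$ is a flux of $B$ along the $\tau$-flow and $S$ a flux of $N$ along the $\zeta$-flow, normalized by $P+S=(\nabla B,\nabla N)$, and put $Q=\frac12(\nabla B,\nabla B)$, $R=\frac12(\nabla N,\nabla N)$. Define the matrices $$\lambda^i_j=B\nabla^i\nabla_jB-Q\delta^i_j+N\tilde v^k_j\nabla^i\nabla_kB-S\tilde v^i_j,\qquad \mu^i_j=B\nabla^i\nabla_jN-P\delta^i_j+N\tilde v^k_j\nabla^i\nabla_kN-R\tilde v^i_j .$$ Then: 1. $\tilde g$ is a metric on $U$. After the extended transformation $d\tilde x=B\,dx+A\,dt+P\,d\tau+Q\,d\zeta$, $d\tilde t=N\,dx+M\,dt+R\,d\tau+S\,d\zeta$, every common solution $u(x,t,\tau,\zeta)$ of the three flows, as a function of $(\tilde x,\tilde t,\tau,\zeta)$,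 satisfies $u_{\tilde t}=\tilde vu_{\tilde x}$, $u_\tau=\mu u_{\tilde x}$, $u_\zeta=\lambda u_{\tilde x}$. The last two flows commute with the first one. 2. The operator $$\tilde J^{ij}=\tilde g^{ij}\tfrac{d}{d\tilde x}-\tilde g^{is}\tilde\Gamma^j_{sk}u^k_{\tilde x}+\lambda^i_ku^k_{\tilde x}\left(\tfrac{d}{d\tilde x}\right)^{-1}u^j_{\tilde x}+u^i_{\tilde x}\left(\tfrac{d}{d\tilde x}\right)^{-1}\lambda^j_ku^k_{\tilde x}+\mu^i_ku^k_{\tilde x}\left(\tfrac{d}{d\tilde x}\right)^{-1}\tilde v^j_nu^n_{\tilde x}+\tilde v^i_nu^n_{\tilde x}\left(\tfrac{d}{d\tilde x}\right)^{-1}\mu^j_ku^k_{\tilde x},$$ where $\tilde\Gamma$ is the Levi-Civita connection of $\tilde g$, is Hamiltonian: with $\left(\frac{d}{dx}\right)^{-1}=\frac12\left(\int_{-\infty}^x-\int_x^{\infty}\right)$, its bracket on the functionals $\int\xi_iu^i\,dx$ ($\xi$ smooth with compact support) is skew-symmetric and satisfies the Jacobi identity at every smooth curve $u:\mathbb R\to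 U$. 3. $\tilde J$ is the transform of $J$. The system $u_{\tilde t}=\tilde vu_{\tilde x}$ is Hamiltonian, $u^i_{\tilde t}=\tilde J^{ij}\,\partial\tilde h/\partial u^j$ with $\tilde h=\frac{hM-\frac12(\nabla h,\nabla h)N}{BM-AN}$. More generally, let $u_s=wu_x$ be the flow generated by $J$ and a density $H$, and let $F$ be a flux of $H$ along $u_t=vu_x$ and $E$, $G$ fluxes of $B$, $N$ along $u_s=wu_x$. Then the transformed flow with matrix $Bw-E+Nw\tilde v-G\tilde v$ (obtained from $d\tilde x=B\,dx+A\,dt+E\,ds$, $d\tilde t=N\,dx+M\,dt+G\,ds$) is generated by $\tilde J$ and the density $\frac{HM-FN}{BM-AN}$. In both statements $\left(\frac{d}{d\tilde x}\right)^{-1}$ of the $\tilde x$-derivative of a flux is that flux, with a suitable constant of integration. 4. The curvature tensor of $\tilde g$, with the sign for which constant curvature $c$ means $R^{ij}_{kl}=c(\delta^i_k\delta^j_l-\delta^i_l\delta^j_k)$, is $$\tilde R^{ij}_{kl}=\lambda^i_k\delta^j_l+\lambda^j_l\delta^i_k-\lambda^j_k\delta^i_l-\lambda^i_l\delta^j_k+\mu^i_k\tilde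 v^j_l+\mu^j_l\tilde v^i_k-\mu^j_k\tilde v^i_l-\mu^i_l\tilde v^j_k .$$ -/

import Mathlib

open scoped ContDiff Matrix

noncomputable section

namespace HydroType

/-- A field of `n × n` matrices in the coordinates `u = (u¹, …, uⁿ)`. It stands for a metric
`g_{ij}(u)` (lower indices) or for an affinor `w^i_j(u)` (row `i`, column `j`). -/
abbrev MatField (n : ℕ) := (Fin n → ℝ) → Matrix (Fin n) (Fin n) ℝ

/-- A function of the coordinates `u¹, …, uⁿ`. -/
abbrev ScalarField (n : ℕ) := (Fin n → ℝ) → ℝ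

/-- The partial derivative `∂f/∂y^k` of a function of the variables `y`. -/
def pd {m : ℕ} {E : Type*} [NormedAddCommGroup E] [NormedSpace ℝ E]
    (k : Fin m) (f : (Fin m → ℝ) → E) (y : Fin m → ℝ) : E :=
  fderiv ℝ f y (Pi.single k 1)

/-! ### Pseudo-Riemannian geometry in a coordinate domain -/

/-- `g` is a smooth (pseudo-Riemannian) metric with components `g_{ij}` on `U`. -/
structure IsMetricOn {n : ℕ} (U : Set (Fin n → ℝ)) (g : MatField n) : Prop where
  smooth : ∀ i j, ContDiffOn ℝ ∞ (fun u => g u i j) U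
  symm : ∀ u ∈ U, (g u).IsSymm
  nondeg : ∀ u ∈ U, (g u).det ≠ 0

/-- The Christoffel symbol `Γ^j_{sk}` of the Levi-Civita connection of `g`. -/
def christoffel {n : ℕ} (g : MatField n) (j s k : Fin n) (u : Fin n → ℝ) : ℝ :=
  (1 / 2) * ∑ l, (g u)⁻¹ j l *
    (pd s (fun y => g y l k) u + pd k (fun y => g y l s) u - pd l (fun y => g y s k) u)

/-- The Riemann tensor `R^i_{skl}`, where `R(∂_k, ∂_l) ∂_s = R^i_{skl} ∂_i`. -/
def riemann {n : ℕ} (g : MatField n) (i s k l : Fin n) (u : Fin n → ℝ) : ℝ :=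
  pd k (christoffel g i l s) u - pd l (christoffel g i k s) u
    + ∑ m, (christoffel g i k m u * christoffel g m l s u
      - christoffel g i l m u * christoffel g m k s u)

/-- The curvature tensor with two upper indices, `R^{ij}_{kl} = g^{js} R^i_{skl}`; for constant
curvature `c` it is `c (δ^i_k δ^j_l - δ^i_l δ^j_k)`. -/
def curvature {n : ℕ} (g : MatField n) (i j k l : Fin n) (u : Fin n → ℝ) : ℝ :=
  ∑ s, (g u)⁻¹ j s * riemann g i s k l u

/-- The metric is flat on `U`. -/
def IsFlatOn {n : ℕ} (U : Set (Fin n → ℝ)) (g : MatField n) : Prop :=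
  ∀ u ∈ U, ∀ i s k l, riemann g i s k l u = 0

/-- The affinor `∇^i ∇_j F = g^{is} (∂_s ∂_j F - Γ^m_{sj} ∂_m F)`. -/
def hess {n : ℕ} (g : MatField n) (F : ScalarField n) : MatField n := fun u =>
  Matrix.of fun i j => ∑ s, (g u)⁻¹ i s *
    (pd s (pd j F) u - ∑ m, christoffel g m s j u * pd m F u)

/-- The scalar product of gradients `(∇F, ∇G) = g^{ij} F_i G_j`. -/
def gradInner {n : ℕ} (g : MatField n) (F G : ScalarField n) : ScalarField n := fun u =>
  ∑ i, ∑ j, (g u)⁻¹ i j * pd i F u * pd j G u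

/-! ### Systems of hydrodynamic type -/

/-- The right-hand side `w^i_j(u) u^j_x` of the system `u_s = w(u) u_x`, at the point `x` of the
curve `u`. -/
def flow {n : ℕ} (w : MatField n) (u : ℝ → Fin n → ℝ) (x : ℝ) : Fin n → ℝ :=
  w (u x) *ᵥ deriv u x

/-- `F` is a conserved density with flux `E` of the system `u_s = w(u) u_x`, that is
`∂_s F(u) = ∂_x E(u)` by virtue of the system: `F_i w^i_j = E_j`. Equivalently the one-form
`F dx + E ds` is closed by virtue of the system. -/
def IsFlux {n : ℕ} (U : Set (Fin n → ℝ)) (w : MatField n) (F E : ScalarField n) : Prop :=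
  ∀ u ∈ U, ∀ j, ∑ i, pd i F u * w u i j = pd j E u

/-- A smooth curve `x ↦ u(x)` with values in `U`. -/
structure IsCurveIn {n : ℕ} (U : Set (Fin n → ℝ)) (u : ℝ → Fin n → ℝ) : Prop where
  smooth : ContDiff ℝ ∞ u
  mem : ∀ x, u x ∈ U

/-- The flows `u_s = v(u) u_x` and `u_r = w(u) u_x` commute: the derivative of the second vector
field along the first one equals the derivative of the first one along the second one. -/
def FlowsCommute {n : ℕ} (U : Set (Fin n → ℝ)) (v w : MatField n) : Prop :=
  ∀ u : ℝ → Fin n → ℝ, IsCurveIn U u → ∀ x : ℝ, ∃ a : Fin n → ℝ,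
    HasDerivAt (fun ε : ℝ => flow w (u + ε • flow v u) x) a 0 ∧
    HasDerivAt (fun ε : ℝ => flow v (u + ε • flow w u) x) a 0

/-! ### Nonlocal operators of hydrodynamic type -/

/-- The operator
`J^{ij} = g^{ij} d/dx - g^{is} Γ^j_{sk} u^k_x + ∑_α a_{(α)k}^i u^k_x (d/dx)⁻¹ b_{(α)l}^j u^l_x`
with `m` nonlocal tails; `metric` has the components `g_{ij}`, `left α = a_{(α)}` and
`right α = b_{(α)}`. -/
structure NonlocalOp (n m : ℕ) where
  metric : MatField n
  left : Fin m → MatField n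
  right : Fin m → MatField n

namespace NonlocalOp

variable {n m : ℕ}

/-- The local part `g^{ij} dξ_j/dx - g^{is} Γ^j_{sk} u^k_x ξ_j`. -/
def localPart (J : NonlocalOp n m) (u ξ : ℝ → Fin n → ℝ) (x : ℝ) : Fin n → ℝ := fun i =>
  ∑ j, ((J.metric (u x))⁻¹ i j * deriv ξ x j
    - ∑ s, ∑ k, (J.metric (u x))⁻¹ i s * christoffel J.metric j s k (u x) * deriv u x k * ξ x j)

/-- The function `b_{(α)l}^j u^l_x ξ_j`, to which `(d/dx)⁻¹` is applied in the tail `α`. -/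
def tailDensity (J : NonlocalOp n m) (u ξ : ℝ → Fin n → ℝ) (α : Fin m) (x : ℝ) : ℝ :=
  flow (J.right α) u x ⬝ᵥ ξ x

/-- The value of `J` on `ξ` when `c α` is used as the antiderivative of `tailDensity α`. -/
def applyWith (J : NonlocalOp n m) (u ξ : ℝ → Fin n → ℝ) (c : Fin m → ℝ → ℝ) (x : ℝ) :
    Fin n → ℝ :=
  J.localPart u ξ x + ∑ α, c α x • flow (J.left α) u x

/-- The skew-symmetric antiderivative `(d/dx)⁻¹ f = ½ (∫_{-∞}^x f - ∫_x^∞ f)`. -/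
def antideriv (f : ℝ → ℝ) (x : ℝ) : ℝ :=
  (1 / 2) * ((∫ y in Set.Iic x, f y) - ∫ y in Set.Ici x, f y)

/-- The value of the operator `J`, at the curve `u`, on a compactly supported covector `ξ`. -/
def apply (J : NonlocalOp n m) (u ξ : ℝ → Fin n → ℝ) : ℝ → Fin n → ℝ :=
  J.applyWith u ξ fun α => antideriv (J.tailDensity u ξ α)

/-- `∫ ξ_i J^{ij} η_j dx`, which is the bracket, at the curve `u`, of the functionals
`∫ ξ_i u^i dx` and `∫ η_j u^j dx`. -/
def bracket (J : NonlocalOp n m) (u ξ η : ℝ → Fin n → ℝ) : ℝ :=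
  ∫ x, ξ x ⬝ᵥ J.apply u η x

/-- A smooth compactly supported covector. -/
structure IsTest (ξ : ℝ → Fin n → ℝ) : Prop where
  smooth : ContDiff ℝ ∞ ξ
  compact : HasCompactSupport ξ

/-- `J` is a Hamiltonian operator: its bracket is skew-symmetric and satisfies the Jacobi identity
`{{ξ, ζ}, η} + {{η, ξ}, ζ} + {{ζ, η}, ξ} = 0` (vanishing of the Schouten bracket), where
`{F, η}` is the derivative of the functional `F` of `u` in the direction of the vector field
`J η`. -/
structure IsHamiltonian (J : NonlocalOp n m) (U : Set (Fin n → ℝ)) : Prop where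
  skew : ∀ u ξ η : ℝ → Fin n → ℝ, IsCurveIn U u → IsTest ξ → IsTest η →
    J.bracket u ξ η = -J.bracket u η ξ
  jacobi : ∀ u ξ η ζ : ℝ → Fin n → ℝ, IsCurveIn U u → IsTest ξ → IsTest η → IsTest ζ →
    ∃ a b c : ℝ,
      HasDerivAt (fun ε : ℝ => J.bracket (u + ε • J.apply u η) ξ ζ) a 0 ∧
      HasDerivAt (fun ε : ℝ => J.bracket (u + ε • J.apply u ζ) η ξ) b 0 ∧
      HasDerivAt (fun ε : ℝ => J.bracket (u + ε • J.apply u ξ) ζ η) c 0 ∧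
      a + b + c = 0

/-- The system `u_s = w(u) u_x` has the form `u^i_s = J^{ij} ∂H/∂u^j`. The antiderivatives of
`b_{(α)l}^j u^l_x ∂H/∂u^j` are the fluxes `φ_α(u)` of the density `H` along the flows
`b_{(α)}`. -/
def Generates (J : NonlocalOp n m) (U : Set (Fin n → ℝ)) (H : ScalarField n)
    (w : MatField n) : Prop :=
  ∃ φ : Fin m → ScalarField n,
    (∀ α, ContDiffOn ℝ ∞ (φ α) U) ∧ (∀ α, IsFlux U (J.right α) H (φ α)) ∧
    ∀ u : ℝ → Fin n → ℝ, IsCurveIn U u → ∀ x : ℝ,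
      flow w u x = J.applyWith u (fun y j => pd j H (u y)) (fun α y => φ α (u y)) x

end NonlocalOp

/-- The local operator `g^{ij} d/dx - g^{is} Γ^j_{sk} u^k_x`. -/
def localOp {n : ℕ} (g : MatField n) : NonlocalOp n 0 where
  metric := g
  left := Fin.elim0
  right := Fin.elim0

/-! ### Reciprocal transformations `dX = B dx + A dt`, `dT = N dx + M dt` -/

/-- The matrix `(B v - A E) (M E - N v)⁻¹` of the transformed system. -/
def newVelocity {n : ℕ} (B A N M : ScalarField n) (v : MatField n) : MatField n := fun u =>
  (B u • v u - A u • 1) * (M u • 1 - N u • v u)⁻¹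

/-- The transformed metric, with the lower components
`(M δ^s_i - N v^s_i) (M δ^r_j - N v^r_j) g_{sr} / (B M - A N)²`. -/
def newMetric {n : ℕ} (B A N M : ScalarField n) (v g : MatField n) : MatField n := fun u =>
  ((B u * M u - A u * N u) ^ 2)⁻¹ •
    ((M u • 1 - N u • v u)ᵀ * g u * (M u • 1 - N u • v u))

/-- The matrix `B w - E + N w ṽ - G ṽ` of the flow `u_s = w u_x` after the transformation
`dX = B dx + A dt + E ds`, `dT = N dx + M dt + G ds`, where `ṽ` is the matrix `vt`. -/
def newFlow {n : ℕ} (B N : ScalarField n) (vt w : MatField n) (E G : ScalarField n) :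
    MatField n := fun u =>
  B u • w u - E u • 1 + N u • (w u * vt u) - G u • vt u

/-- The operator
`g̃^{ij} d/dX - g̃^{is} Γ̃^j_{sk} u^k_X + λ^i_k u^k_X (d/dX)⁻¹ u^j_X + u^i_X (d/dX)⁻¹ λ^j_k u^k_X
+ μ^i_k u^k_X (d/dX)⁻¹ ṽ^j_n u^n_X + ṽ^i_n u^n_X (d/dX)⁻¹ μ^j_k u^k_X`. -/
def fourTailOp {n : ℕ} (gt lam mu vt : MatField n) : NonlocalOp n 4 where
  metric := gt
  left := ![lam, 1, mu, vt]
  right := ![1, lam, vt, mu]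

/-- If `u(x, t, τ, ζ)` solves `u_t = v u_x`, `u_τ = w₁ u_x`, `u_ζ = w₂ u_x`, and if
`dX = B dx + A dt + P dτ + Q dζ`, `dT = N dx + M dt + R dτ + S dζ`, then `u` as a function `ut` of
the new independent variables `(X, T, τ, ζ)` solves `u_T = vt u_X`, `u_τ = mu u_X`,
`u_ζ = lam u_X`. The coordinates `0, 1, 2, 3` are `x, t, τ, ζ` or `X, T, τ, ζ`. -/
def TransformsFlows {n : ℕ} (U : Set (Fin n → ℝ)) (B A P Q N M R S : ScalarField n)
    (v w₁ w₂ vt mu lam : MatField n) : Prop :=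
  ∀ (Ω : Set (Fin 4 → ℝ)) (u ut : (Fin 4 → ℝ) → Fin n → ℝ) (X T : (Fin 4 → ℝ) → ℝ),
    IsOpen Ω → DifferentiableOn ℝ u Ω → DifferentiableOn ℝ X Ω → DifferentiableOn ℝ T Ω →
    (∀ p ∈ Ω, u p ∈ U) →
    (∀ p ∈ Ω, pd 1 u p = v (u p) *ᵥ pd 0 u p ∧ pd 2 u p = w₁ (u p) *ᵥ pd 0 u p ∧
      pd 3 u p = w₂ (u p) *ᵥ pd 0 u p) →
    (∀ p ∈ Ω, pd 0 X p = B (u p) ∧ pd 1 X p = A (u p) ∧ pd 2 X p = P (u p) ∧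
      pd 3 X p = Q (u p)) →
    (∀ p ∈ Ω, pd 0 T p = N (u p) ∧ pd 1 T p = M (u p) ∧ pd 2 T p = R (u p) ∧
      pd 3 T p = S (u p)) →
    (∀ p ∈ Ω, DifferentiableAt ℝ ut ![X p, T p, p 2, p 3] ∧ u p = ut ![X p, T p, p 2, p 3]) →
    ∀ p ∈ Ω, ∀ q, q = ![X p, T p, p 2, p 3] →
      pd 1 ut q = vt (ut q) *ᵥ pd 0 ut q ∧ pd 2 ut q = mu (ut q) *ᵥ pd 0 ut q ∧
        pd 3 ut q = lam (ut q) *ᵥ pd 0 ut q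

end HydroType

end

/-! Put `Δ = BM - AN`, `K = (M - Nv)/Δ` and `L = (Bv - A)/Δ`. Then `BK + NL = 1`, `AK + ML = v` and
`KṼ = L` for the new velocity `Ṽ`; along solutions `u_X = K u_x` and `u_T = L u_x`. The new metric
is `KᵀgK`, so `K` is an isometry onto `g`, and everything about the new metric can be computed in
the frame `K` with the old, flat connection `∇`.

In this frame the new Levi-Civita connection is `∇ + ρ` with the infinitesimal rotation `ρ(X) = ∇B ∧
KX + ∇N ∧ LX` (`RecipData.conn_eq`). It is metric because `ρ` is skew. It is torsion-free because
`K` is a Codazzi tensor for `∇ + ρ`: this follows, together with the same fact for `L`, by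
differentiating the two linear relations above and using the flux identities
(`RecipData.codazzi_frame`). A transformed flow becomes `w - EK - GL` in the frame, again a Codazzi
tensor (`RecipData.codazzi_frameFlow`); Codazzi flows that commute as matrices commute as flows.

Since `∇` is flat, the curvature of `∇ + ρ` consists of the rotations `Hess B X ∧ KY`, `Hess N X ∧
LY`, antisymmetrized, and of terms with the scalar products of `∇B` and `∇N`. The latter are what
`P, Q, R, S` account for, `P` and `S` only through their sum (`RecipData.curv_frame`). This is the
curvature expansion.

The Hamiltonian property follows from a general criterion
(`NonlocalOp.IsCodazziFamily.isHamiltonian`): the tails are commuting self-adjoint Codazzi tensors,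
and the curvature expansion plays the role of the Gauss equation. The derivative of the bracket
along a vector field `V` is, up to a total derivative, the integral of a density containing `V`
without derivatives, and the cyclic sum of these densities vanishes pointwise.

For the generation statements, a conservation law `H dx + F dt` is rewritten as `H̃ dX + F̃ dT`. The
gradient and the Hessian of `H̃` are computed in the frame `K`, and the remaining terms are matched
with the tails (`RecipData.generates_newFlow`). The flow of `h` itself becomes zero; shifting one
flux by the constant `1` then produces `Ṽ`. -/

noncomputable section

namespace HydroType

open Matrix MeasureTheory

/-! ### Differentiation and smoothness of matrix fields -/

section

variable {n : ℕ}

/-- Entrywise derivative of a curve of matrices. -/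
def HasMatDerivAt (A : ℝ → Matrix (Fin n) (Fin n) ℝ) (A' : Matrix (Fin n) (Fin n) ℝ) (t : ℝ) :
    Prop :=
  ∀ i j, HasDerivAt (fun s => A s i j) (A' i j) t

section deriv

variable {A C : ℝ → Matrix (Fin n) (Fin n) ℝ} {A' C' : Matrix (Fin n) (Fin n) ℝ}
  {x y : ℝ → Fin n → ℝ} {x' y' : Fin n → ℝ} {f : ℝ → ℝ} {f' : ℝ} {t : ℝ}

lemma HasMatDerivAt.unique (h : HasMatDerivAt A A' t) (h' : HasMatDerivAt A C' t) : A' = C' := by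
  ext i j
  exact (h i j).unique (h' i j)

lemma HasMatDerivAt.congr (h : HasMatDerivAt A A' t) (e : C =ᶠ[nhds t] A) :
    HasMatDerivAt C A' t := fun i j =>
  (h i j).congr_of_eventuallyEq (e.mono fun s hs => by simp [hs])

lemma HasMatDerivAt.const (A : Matrix (Fin n) (Fin n) ℝ) (t : ℝ) :
    HasMatDerivAt (fun _ => A) 0 t := fun i j => hasDerivAt_const t (A i j)

lemma HasMatDerivAt.add (hA : HasMatDerivAt A A' t) (hC : HasMatDerivAt C C' t) :
    HasMatDerivAt (fun s => A s + C s) (A' + C') t := fun i j => (hA i j).add (hC i j)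

lemma HasMatDerivAt.sub (hA : HasMatDerivAt A A' t) (hC : HasMatDerivAt C C' t) :
    HasMatDerivAt (fun s => A s - C s) (A' - C') t := fun i j => (hA i j).sub (hC i j)

lemma HasMatDerivAt.smul (hf : HasDerivAt f f' t) (hA : HasMatDerivAt A A' t) :
    HasMatDerivAt (fun s => f s • A s) (f' • A t + f t • A') t := fun i j =>
  hf.mul (hA i j)

lemma HasMatDerivAt.mul (hA : HasMatDerivAt A A' t) (hC : HasMatDerivAt C C' t) :
    HasMatDerivAt (fun s => A s * C s) (A' * C t + A t * C') t := by
  intro i j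
  simp only [mul_apply, Matrix.add_apply, ← Finset.sum_add_distrib]
  exact HasDerivAt.fun_sum fun k _ => (hA i k).mul (hC k j)

lemma HasMatDerivAt.mulVec (hA : HasMatDerivAt A A' t) (hx : HasDerivAt x x' t) :
    HasDerivAt (fun s => A s *ᵥ x s) (A' *ᵥ x t + A t *ᵥ x') t := by
  rw [hasDerivAt_pi]
  intro i
  simp only [Matrix.mulVec, dotProduct, Pi.add_apply, ← Finset.sum_add_distrib]
  exact HasDerivAt.fun_sum fun j _ => (hA i j).mul (hasDerivAt_pi.1 hx j)

lemma hasDerivAt_dotProduct (hx : HasDerivAt x x' t) (hy : HasDerivAt y y' t) :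
    HasDerivAt (fun s => x s ⬝ᵥ y s) (x' ⬝ᵥ y t + x t ⬝ᵥ y') t := by
  simp only [dotProduct, ← Finset.sum_add_distrib]
  exact HasDerivAt.fun_sum fun j _ => (hasDerivAt_pi.1 hx j).mul (hasDerivAt_pi.1 hy j)

lemma HasMatDerivAt.transpose (hA : HasMatDerivAt A A' t) :
    HasMatDerivAt (fun s => (A s)ᵀ) A'ᵀ t := fun i j => hA j i

lemma HasMatDerivAt.vecMulVec (hx : HasDerivAt x x' t) (hy : HasDerivAt y y' t) :
    HasMatDerivAt (fun s => vecMulVec (x s) (y s)) (vecMulVec x' (y t) + vecMulVec (x t) y') t :=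
  fun i j => (hasDerivAt_pi.1 hx i).mul (hasDerivAt_pi.1 hy j)

lemma HasMatDerivAt.sum {ι : Type*} {s : Finset ι} {A : ι → ℝ → Matrix (Fin n) (Fin n) ℝ}
    {A' : ι → Matrix (Fin n) (Fin n) ℝ} (h : ∀ a ∈ s, HasMatDerivAt (A a) (A' a) t) :
    HasMatDerivAt (fun r => ∑ a ∈ s, A a r) (∑ a ∈ s, A' a) t := by
  intro i j
  simp only [Matrix.sum_apply]
  exact HasDerivAt.fun_sum fun a ha => h a ha i j

lemma hasDerivAt_line (u X : Fin n → ℝ) : HasDerivAt (fun s : ℝ => u + s • X) X 0 := by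
  simpa using ((hasDerivAt_id (0 : ℝ)).smul_const X).const_add u

end deriv

section smooth

variable {F : Type*} [NormedAddCommGroup F] [NormedSpace ℝ F] {s : Set F} {k : ℕ∞ω}
  {A C : F → Matrix (Fin n) (Fin n) ℝ} {x y : F → Fin n → ℝ} {f : F → ℝ}

/-- Entrywise smoothness of a field of matrices. -/
def MatSmoothOn (k : ℕ∞ω) (A : F → Matrix (Fin n) (Fin n) ℝ) (s : Set F) : Prop :=
  ∀ i j, ContDiffOn ℝ k (fun z => A z i j) s

lemma MatSmoothOn.congr (hA : MatSmoothOn k A s) (h : ∀ z ∈ s, C z = A z) : MatSmoothOn k C s :=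
  fun i j => (hA i j).congr fun z hz => by simp [h z hz]

lemma MatSmoothOn.const (A : Matrix (Fin n) (Fin n) ℝ) : MatSmoothOn k (fun _ : F => A) s :=
  fun _ _ => contDiffOn_const

lemma MatSmoothOn.add (hA : MatSmoothOn k A s) (hC : MatSmoothOn k C s) :
    MatSmoothOn k (fun z => A z + C z) s := fun i j => (hA i j).add (hC i j)

lemma MatSmoothOn.sub (hA : MatSmoothOn k A s) (hC : MatSmoothOn k C s) :
    MatSmoothOn k (fun z => A z - C z) s := fun i j => (hA i j).sub (hC i j)

lemma MatSmoothOn.smul (hf : ContDiffOn ℝ k f s) (hA : MatSmoothOn k A s) :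
    MatSmoothOn k (fun z => f z • A z) s := fun i j => hf.mul (hA i j)

lemma MatSmoothOn.mul (hA : MatSmoothOn k A s) (hC : MatSmoothOn k C s) :
    MatSmoothOn k (fun z => A z * C z) s := by
  intro i j
  simp only [mul_apply]
  exact ContDiffOn.sum fun l _ => (hA i l).mul (hC l j)

lemma MatSmoothOn.sum {ι : Type*} {t : Finset ι} {A : ι → F → Matrix (Fin n) (Fin n) ℝ}
    (h : ∀ a ∈ t, MatSmoothOn k (A a) s) : MatSmoothOn k (fun r => ∑ a ∈ t, A a r) s := by
  intro i j
  simp only [Matrix.sum_apply]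
  exact ContDiffOn.sum fun a ha => h a ha i j

lemma MatSmoothOn.comp {G : Type*} [NormedAddCommGroup G] [NormedSpace ℝ G] {φ : G → F}
    {s' : Set G} (hA : MatSmoothOn k A s) (hφ : ContDiffOn ℝ k φ s') (h : Set.MapsTo φ s' s) :
    MatSmoothOn k (fun z => A (φ z)) s' := fun i j => (hA i j).comp hφ h

lemma MatSmoothOn.mulVec (hA : MatSmoothOn k A s) (hx : ContDiffOn ℝ k x s) :
    ContDiffOn ℝ k (fun z => A z *ᵥ x z) s := by
  rw [contDiffOn_pi]
  intro i
  simp only [Matrix.mulVec, dotProduct]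
  exact ContDiffOn.sum fun j _ => (hA i j).mul (contDiffOn_pi.1 hx j)

lemma ContDiffOn.vec_dotProduct (hx : ContDiffOn ℝ k x s) (hy : ContDiffOn ℝ k y s) :
    ContDiffOn ℝ k (fun z => x z ⬝ᵥ y z) s := by
  simp only [dotProduct]
  exact ContDiffOn.sum fun j _ => (contDiffOn_pi.1 hx j).mul (contDiffOn_pi.1 hy j)

lemma MatSmoothOn.transpose (hA : MatSmoothOn k A s) :
    MatSmoothOn k (fun z => (A z)ᵀ) s := fun i j => hA j i

lemma MatSmoothOn.vecMulVec (hx : ContDiffOn ℝ k x s) (hy : ContDiffOn ℝ k y s) :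
    MatSmoothOn k (fun z => vecMulVec (x z) (y z)) s :=
  fun i j => (contDiffOn_pi.1 hx i).mul (contDiffOn_pi.1 hy j)

lemma MatSmoothOn.det (hA : MatSmoothOn k A s) : ContDiffOn ℝ k (fun z => (A z).det) s := by
  simp only [det_apply]
  exact ContDiffOn.sum fun σ _ => (contDiffOn_prod fun i _ => hA (σ i) i).const_smul _

lemma MatSmoothOn.inv (hA : MatSmoothOn k A s) (h0 : ∀ z ∈ s, (A z).det ≠ 0) :
    MatSmoothOn k (fun z => (A z)⁻¹) s := by
  have h1 : MatSmoothOn k (fun z => (A z).adjugate) s := by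
    intro i j
    simp only [adjugate_apply]
    refine MatSmoothOn.det fun a b => ?_
    by_cases h : a = j
    · subst h; simpa using contDiffOn_const
    · simpa [updateRow_ne h] using hA a b
  have h2 : ∀ z, (A z)⁻¹ = (A z).det⁻¹ • (A z).adjugate := fun z => by
    rw [inv_def, Ring.inverse_eq_inv']
  simp only [h2]
  exact MatSmoothOn.smul (hA.det.inv h0) h1

/-- The directional derivative of a field of matrices. -/
def matDeriv (A : F → Matrix (Fin n) (Fin n) ℝ) (u X : F) : Matrix (Fin n) (Fin n) ℝ :=
  Matrix.of fun i j => fderiv ℝ (fun z => A z i j) u X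

lemma hasDerivAt_comp_field {E : Type*} [NormedAddCommGroup E] [NormedSpace ℝ E]
    {U : Set F} (hU : IsOpen U) {W : F → E} (hW : ContDiffOn ℝ ∞ W U) {c : ℝ → F} {t : ℝ} {X : F}
    (hc : HasDerivAt c X t) (ht : c t ∈ U) :
    HasDerivAt (fun r => W (c r)) (fderiv ℝ W (c t) X) t :=
  (((hW.contDiffAt (hU.mem_nhds ht)).differentiableAt (by simp)).hasFDerivAt).comp_hasDerivAt t hc

lemma MatSmoothOn.hasMatDerivAt {U : Set F} (hU : IsOpen U) (hW : MatSmoothOn ∞ A U)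
    {c : ℝ → F} {t : ℝ} {X : F} (hc : HasDerivAt c X t) (ht : c t ∈ U) :
    HasMatDerivAt (fun r => A (c r)) (matDeriv A (c t) X) t := fun i j =>
  hasDerivAt_comp_field hU (hW i j) hc ht

lemma contDiffOn_fderiv_dir {E : Type*} [NormedAddCommGroup E] [NormedSpace ℝ E]
    {U : Set F} (hU : IsOpen U) {W : F → E} (hW : ContDiffOn ℝ ∞ W U) (X : F) :
    ContDiffOn ℝ ∞ (fun u => fderiv ℝ W u X) U :=
  (hW.fderiv_of_isOpen hU (m := ∞) (by simp)).clm_apply contDiffOn_const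

lemma MatSmoothOn.matDeriv {U : Set F} (hU : IsOpen U) (hW : MatSmoothOn ∞ A U) (X : F) :
    MatSmoothOn ∞ (fun u => matDeriv A u X) U := fun i j =>
  contDiffOn_fderiv_dir hU (hW i j) X

lemma fderiv_comm {E : Type*} [NormedAddCommGroup E] [NormedSpace ℝ E]
    {U : Set F} (hU : IsOpen U) {W : F → E} (hW : ContDiffOn ℝ ∞ W U) {u : F} (hu : u ∈ U)
    (X Y : F) :
    fderiv ℝ (fun z => fderiv ℝ W z Y) u X = fderiv ℝ (fun z => fderiv ℝ W z X) u Y := by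
  have h1 : DifferentiableAt ℝ (fderiv ℝ W) u :=
    ((hW.fderiv_of_isOpen hU (m := ∞) (by simp)).contDiffAt (hU.mem_nhds hu)).differentiableAt
      (by simp)
  have h2 : ∀ Z Z', fderiv ℝ (fun z => fderiv ℝ W z Z) u Z' = fderiv ℝ (fderiv ℝ W) u Z' Z := by
    intro Z Z'
    rw [fderiv_clm_apply h1 (differentiableAt_const _)]
    simp
  rw [h2, h2]
  exact ((hW.contDiffAt (hU.mem_nhds hu)).isSymmSndFDerivAt
    (by simpa using WithTop.coe_le_coe.2 (le_top : (2 : ℕ∞) ≤ ⊤))) X Y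

lemma matDeriv_comm {U : Set F} (hU : IsOpen U) (hW : MatSmoothOn ∞ A U) {u : F} (hu : u ∈ U)
    (X Y : F) :
    HydroType.matDeriv (fun z => HydroType.matDeriv A z Y) u X =
      HydroType.matDeriv (fun z => HydroType.matDeriv A z X) u Y := by
  ext i j
  exact fderiv_comm hU (hW i j) hu X Y

end smooth

end

section

variable {n : ℕ} {U : Set (Fin n → ℝ)} {g : MatField n} {u : Fin n → ℝ}

/-! ### Connections -/

/-- The matrix of the connection with coefficient matrices `Γ k` in the direction `X`. -/
def cn (Γ : Fin n → MatField n) (u X : Fin n → ℝ) : Matrix (Fin n) (Fin n) ℝ := ∑ k, X k • Γ k u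

/-- The derivative in the direction `X` of the connection matrix in the constant direction `Y`. -/
def dcn (Γ : Fin n → MatField n) (u X Y : Fin n → ℝ) : Matrix (Fin n) (Fin n) ℝ :=
  ∑ k, Y k • matDeriv (Γ k) u X

/-- The curvature operator of a connection. -/
def curv (Γ : Fin n → MatField n) (u X Y : Fin n → ℝ) : Matrix (Fin n) (Fin n) ℝ :=
  dcn Γ u X Y - dcn Γ u Y X + cn Γ u X * cn Γ u Y - cn Γ u Y * cn Γ u X

lemma cn_hasMatDerivAt (hU : IsOpen U) {Γ : Fin n → MatField n} (hΓ : ∀ k, MatSmoothOn ∞ (Γ k) U)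
    {c V : ℝ → Fin n → ℝ} {t : ℝ} {X V' : Fin n → ℝ} (hc : HasDerivAt c X t) (ht : c t ∈ U)
    (hV : HasDerivAt V V' t) :
    HasMatDerivAt (fun s => cn Γ (c s) (V s)) (dcn Γ (c t) X (V t) + cn Γ (c t) V') t := by
  have h : dcn Γ (c t) X (V t) + cn Γ (c t) V' =
      ∑ k, (V' k • Γ k (c t) + V t k • matDeriv (Γ k) (c t) X) := by
    simp only [dcn, cn, Finset.sum_add_distrib]; abel
  rw [h]
  exact HasMatDerivAt.sum fun k _ => HasMatDerivAt.smul (hasDerivAt_pi.1 hV k) ((hΓ k).hasMatDerivAt hU hc ht)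

/-! ### The Levi-Civita connection -/

/-- The coefficient matrices of the Levi-Civita connection. -/
def chr (g : MatField n) (k : Fin n) : MatField n := fun u => Matrix.of fun i j => christoffel g i k j u

/-- The connection matrix of the Levi-Civita connection in the direction `X`. -/
abbrev conn (g : MatField n) (u X : Fin n → ℝ) : Matrix (Fin n) (Fin n) ℝ := cn (chr g) u X

lemma conn_apply (g : MatField n) (u X : Fin n → ℝ) (i j : Fin n) :
    conn g u X i j = ∑ k, X k * christoffel g i k j u := by
  simp [conn, cn, chr, Matrix.sum_apply]

lemma IsMetricOn.isUnit_det (hg : IsMetricOn U g) (hu : u ∈ U) : IsUnit (g u).det :=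
  isUnit_iff_ne_zero.2 (hg.nondeg u hu)

lemma IsMetricOn.matSmooth (hg : IsMetricOn U g) : MatSmoothOn ∞ g U := hg.smooth

lemma IsMetricOn.matSmooth_inv (hg : IsMetricOn U g) : MatSmoothOn ∞ (fun u => (g u)⁻¹) U :=
  hg.matSmooth.inv hg.nondeg

lemma pd_symm (hU : IsOpen U) (hg : IsMetricOn U g) (hu : u ∈ U) (k i j : Fin n) :
    pd k (fun y => g y i j) u = pd k (fun y => g y j i) u := by
  unfold pd
  have : (fun y => g y i j) =ᶠ[nhds u] fun y => g y j i :=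
    Filter.eventually_of_mem (hU.mem_nhds hu) fun y hy => (hg.symm y hy).apply j i
  rw [this.fderiv_eq]

lemma christoffel_symm (hU : IsOpen U) (hg : IsMetricOn U g) (hu : u ∈ U) (j s k : Fin n) :
    christoffel g j s k u = christoffel g j k s u := by
  unfold christoffel
  congr 1
  refine Finset.sum_congr rfl fun l _ => ?_
  rw [pd_symm hU hg hu l s k]
  ring

lemma conn_symm (hU : IsOpen U) (hg : IsMetricOn U g) (hu : u ∈ U) (X Y : Fin n → ℝ) :
    conn g u X *ᵥ Y = conn g u Y *ᵥ X := by
  ext i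
  simp only [mulVec, dotProduct, conn_apply, Finset.sum_mul]
  rw [Finset.sum_comm]
  refine Finset.sum_congr rfl fun j _ => Finset.sum_congr rfl fun k _ => ?_
  rw [christoffel_symm hU hg hu]
  ring

lemma smooth_christoffel (hU : IsOpen U) (hg : IsMetricOn U g) (j s k : Fin n) :
    ContDiffOn ℝ ∞ (christoffel g j s k) U := by
  unfold christoffel
  refine contDiffOn_const.mul (ContDiffOn.sum fun l _ => (hg.matSmooth_inv j l).mul ?_)
  exact ((contDiffOn_fderiv_dir hU (hg.smooth l k) _).add
    (contDiffOn_fderiv_dir hU (hg.smooth l s) _)).sub (contDiffOn_fderiv_dir hU (hg.smooth s k) _)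

lemma smooth_chr (hU : IsOpen U) (hg : IsMetricOn U g) (k : Fin n) : MatSmoothOn ∞ (chr g k) U :=
  fun i j => smooth_christoffel hU hg i k j

lemma lower_christoffel (hg : IsMetricOn U g) (hu : u ∈ U) (a s k : Fin n) :
    ∑ i, g u a i * christoffel g i s k u = (1 / 2) * (pd s (fun y => g y a k) u +
      pd k (fun y => g y a s) u - pd a (fun y => g y s k) u) := by
  have h := congrFun (show g u *ᵥ ((g u)⁻¹ *ᵥ fun l => (1 / 2) * (pd s (fun y => g y l k) u +
      pd k (fun y => g y l s) u - pd l (fun y => g y s k) u)) = _ by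
    rw [mulVec_mulVec, mul_nonsing_inv _ (hg.isUnit_det hu), one_mulVec]) a
  refine Eq.trans ?_ h
  simp only [mulVec, dotProduct, christoffel]
  refine Finset.sum_congr rfl fun i _ => ?_
  congr 1
  rw [Finset.mul_sum]
  exact Finset.sum_congr rfl fun l _ => by ring

lemma fderiv_eq_sum_pd {E : Type*} [NormedAddCommGroup E] [NormedSpace ℝ E]
    (f : (Fin n → ℝ) → E) (u X : Fin n → ℝ) : fderiv ℝ f u X = ∑ k, X k • pd k f u := by
  have : X = ∑ k, X k • (Pi.single k 1 : Fin n → ℝ) := by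
    ext i; simp [Pi.single_apply]
  conv_lhs => rw [this]
  simp [pd]

/-- Compatibility of the connection with the metric. With the upper index lowered, each Christoffel
symbol is half of three derivatives of `g`; adding the transpose doubles one of them and cancels the
other two. -/
lemma matDeriv_metric (hU : IsOpen U) (hg : IsMetricOn U g) (hu : u ∈ U) (X : Fin n → ℝ) :
    matDeriv g u X = (conn g u X)ᵀ * g u + g u * conn g u X := by
  have key : ∀ a b, (g u * conn g u X) a b = ∑ k, X k * ((1 / 2) * (pd k (fun y => g y a b) u +
      pd b (fun y => g y a k) u - pd a (fun y => g y k b) u)) := by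
    intro a b
    simp only [mul_apply, conn_apply, Finset.mul_sum]
    rw [Finset.sum_comm]
    refine Finset.sum_congr rfl fun k _ => ?_
    rw [← lower_christoffel hg hu, Finset.mul_sum]
    exact Finset.sum_congr rfl fun l _ => by ring
  have h1 : (conn g u X)ᵀ * g u = (g u * conn g u X)ᵀ := by
    rw [transpose_mul, (hg.symm u hu).eq]
  ext a b
  rw [h1, Matrix.add_apply, transpose_apply, key, key, ← Finset.sum_add_distrib]
  simp only [matDeriv, of_apply, fderiv_eq_sum_pd, smul_eq_mul]
  refine Finset.sum_congr rfl fun k _ => ?_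
  rw [pd_symm hU hg hu k b a, pd_symm hU hg hu a k b, pd_symm hU hg hu b k a]
  ring

/-- Two torsion-free metric connections coincide. -/
lemma eq_conn (hU : IsOpen U) (hg : IsMetricOn U g) (hu : u ∈ U)
    (C : (Fin n → ℝ) → Matrix (Fin n) (Fin n) ℝ) (hC : ∀ X Y, C X *ᵥ Y = C Y *ᵥ X)
    (hm : ∀ X, matDeriv g u X = (C X)ᵀ * g u + g u * C X) (X : Fin n → ℝ) : C X = conn g u X := by
  set T : (Fin n → ℝ) → Matrix (Fin n) (Fin n) ℝ := fun X => g u * (C X - conn g u X) with hT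
  have hs : ∀ X Y, T X *ᵥ Y = T Y *ᵥ X := fun X Y => by
    simp only [hT, ← mulVec_mulVec, sub_mulVec, hC X Y, conn_symm hU hg hu X Y]
  have ha : ∀ X, (T X)ᵀ = -T X := fun X => by
    have h2 := (hm X).symm.trans (matDeriv_metric hU hg hu X)
    have h3 : (T X)ᵀ = (C X)ᵀ * g u - (conn g u X)ᵀ * g u := by
      simp only [hT, transpose_mul, (hg.symm u hu).eq, transpose_sub, sub_mul]
    rw [h3, eq_neg_iff_add_eq_zero]
    simp only [hT, mul_sub]
    rw [← sub_eq_zero] at h2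
    rw [← h2]; abel
  have hsk : ∀ X Y Z, (T X *ᵥ Y) ⬝ᵥ Z = -((T X *ᵥ Z) ⬝ᵥ Y) := fun X Y Z => by
    rw [dotProduct_comm, dotProduct_mulVec, ← mulVec_transpose, ha, neg_mulVec, neg_dotProduct]
  -- The lowered difference of the two connections is symmetric in its first two arguments (no
  -- torsion) and skew in the last two (both metric). Such a trilinear form is zero.
  have h0 : ∀ X Y Z, (T X *ᵥ Y) ⬝ᵥ Z = 0 := fun X Y Z => by
    have e1 := hsk X Y Z
    have e2 := hsk Z X Y
    have e3 := hsk Y Z X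
    rw [hs X Z] at e1
    rw [hs Z Y] at e2
    rw [hs Y X] at e3
    linarith
  have hz : T X = 0 := by
    ext i j
    have := h0 X (Pi.single j 1) (Pi.single i 1)
    simpa using this
  have h4 : C X - conn g u X = (g u)⁻¹ * T X := by
    simp only [hT]
    rw [← mul_assoc, nonsing_inv_mul _ (hg.isUnit_det hu), one_mul]
  rw [hz, mul_zero] at h4
  exact sub_eq_zero.1 h4

lemma matDeriv_inv (hU : IsOpen U) (hg : IsMetricOn U g) (hu : u ∈ U) (X : Fin n → ℝ) :
    matDeriv (fun y => (g y)⁻¹) u X = -(conn g u X * (g u)⁻¹ + (g u)⁻¹ * (conn g u X)ᵀ) := by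
  have hl := hasDerivAt_line u X
  have hu' : u + (0 : ℝ) • X ∈ U := by simpa
  have h1 := (hg.matSmooth.hasMatDerivAt hU hl hu').mul (hg.matSmooth_inv.hasMatDerivAt hU hl hu')
  have h2 : HasMatDerivAt (fun t : ℝ => g (u + t • X) * (g (u + t • X))⁻¹) 0 0 := by
    refine (HasMatDerivAt.const (1 : Matrix (Fin n) (Fin n) ℝ) 0).congr ?_
    have : ∀ᶠ t : ℝ in nhds 0, u + t • X ∈ U :=
      hl.continuousAt.eventually_mem (hU.mem_nhds hu')
    exact this.mono fun t ht => mul_nonsing_inv _ (hg.isUnit_det ht)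
  have h3 := h1.unique h2
  simp only [zero_smul, add_zero] at h3
  rw [matDeriv_metric hU hg hu] at h3
  have h4 : matDeriv (fun y => (g y)⁻¹) u X =
      (g u)⁻¹ * (g u * matDeriv (fun y => (g y)⁻¹) u X) := by
    rw [← mul_assoc, nonsing_inv_mul _ (hg.isUnit_det hu), one_mul]
  rw [h4, eq_neg_of_add_eq_zero_right h3, mul_neg, add_mul, mul_add, mul_assoc (conn g u X)ᵀ,
    mul_nonsing_inv _ (hg.isUnit_det hu), mul_one, mul_assoc (g u), ← mul_assoc (g u)⁻¹ (g u),
    nonsing_inv_mul _ (hg.isUnit_det hu), one_mul, add_comm]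

lemma matDeriv_chr (g : MatField n) (k : Fin n) (u X : Fin n → ℝ) (i j : Fin n) :
    matDeriv (chr g k) u X i j = ∑ l, X l * pd l (christoffel g i k j) u := by
  simp only [matDeriv, of_apply, chr, fderiv_eq_sum_pd, smul_eq_mul]

/-- Bridge from the coordinate definition of the Riemann tensor to the curvature operator in which
all later computations run. -/
lemma curv_apply (g : MatField n) (u X Y : Fin n → ℝ) (i s : Fin n) :
    curv (chr g) u X Y i s = ∑ k, ∑ l, X k * Y l * riemann g i s k l u := by
  have e1 : dcn (chr g) u X Y i s = ∑ k, ∑ l, X k * Y l * pd k (christoffel g i l s) u := by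
    simp only [dcn, Matrix.sum_apply, Matrix.smul_apply, matDeriv_chr, smul_eq_mul, Finset.mul_sum]
    rw [Finset.sum_comm]
    exact Finset.sum_congr rfl fun _ _ => Finset.sum_congr rfl fun _ _ => by ring
  have e2 : dcn (chr g) u Y X i s = ∑ k, ∑ l, X k * Y l * pd l (christoffel g i k s) u := by
    simp only [dcn, Matrix.sum_apply, Matrix.smul_apply, matDeriv_chr, smul_eq_mul, Finset.mul_sum]
    exact Finset.sum_congr rfl fun _ _ => Finset.sum_congr rfl fun _ _ => by ring
  have e3 : ∀ Z W, (cn (chr g) u Z * cn (chr g) u W) i s =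
      ∑ k, ∑ l, Z k * W l * ∑ m, christoffel g i k m u * christoffel g m l s u := by
    intro Z W
    simp only [mul_apply, conn_apply, Finset.sum_mul, Finset.mul_sum]
    rw [Finset.sum_comm]
    refine Eq.trans (Finset.sum_congr rfl fun k _ => Finset.sum_comm) ?_
    rw [Finset.sum_comm]
    refine Finset.sum_congr rfl fun k _ => ?_
    exact Finset.sum_congr rfl fun _ _ => Finset.sum_congr rfl fun _ _ => by ring
  have e4 : ∑ k, ∑ l, Y k * X l * ∑ m, christoffel g i k m u * christoffel g m l s u =
      ∑ k, ∑ l, X k * Y l * ∑ m, christoffel g i l m u * christoffel g m k s u := by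
    rw [Finset.sum_comm]
    exact Finset.sum_congr rfl fun _ _ => Finset.sum_congr rfl fun _ _ => by ring
  simp only [curv, Matrix.sub_apply, Matrix.add_apply, e1, e2, e3, e4, riemann,
    Finset.sum_sub_distrib, mul_add, mul_sub, Finset.sum_add_distrib]
  ring

lemma riemann_eq_curv (g : MatField n) (u : Fin n → ℝ) (i s k l : Fin n) :
    riemann g i s k l u = curv (chr g) u (Pi.single k 1) (Pi.single l 1) i s := by
  rw [curv_apply]
  simp [Pi.single_apply]

/-! ### Gradients and Hessians -/

/-- The differential of a function. -/
def dvec (F : ScalarField n) (u : Fin n → ℝ) : Fin n → ℝ := fun j => pd j F u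

/-- The gradient of a function. -/
def grad (g : MatField n) (F : ScalarField n) (u : Fin n → ℝ) : Fin n → ℝ := (g u)⁻¹ *ᵥ dvec F u

variable {F G : ScalarField n}

lemma fderiv_eq_dvec (F : ScalarField n) (u X : Fin n → ℝ) : fderiv ℝ F u X = dvec F u ⬝ᵥ X := by
  rw [fderiv_eq_sum_pd]
  simp only [dvec, dotProduct, smul_eq_mul, mul_comm]

lemma smooth_dvec (hU : IsOpen U) (hF : ContDiffOn ℝ ∞ F U) : ContDiffOn ℝ ∞ (dvec F) U :=
  contDiffOn_pi.2 fun _ => contDiffOn_fderiv_dir hU hF _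

lemma smooth_grad (hU : IsOpen U) (hg : IsMetricOn U g) (hF : ContDiffOn ℝ ∞ F U) :
    ContDiffOn ℝ ∞ (grad g F) U := hg.matSmooth_inv.mulVec (smooth_dvec hU hF)

lemma metric_mulVec_grad (hg : IsMetricOn U g) (hu : u ∈ U) (F : ScalarField n) :
    g u *ᵥ grad g F u = dvec F u := by
  rw [grad, mulVec_mulVec, mul_nonsing_inv _ (hg.isUnit_det hu), one_mulVec]

lemma gradInner_eq (g : MatField n) (F G : ScalarField n) (u : Fin n → ℝ) :
    gradInner g F G u = dvec F u ⬝ᵥ grad g G u := by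
  simp only [gradInner, dotProduct, grad, mulVec, dvec, Finset.mul_sum]
  exact Finset.sum_congr rfl fun _ _ => Finset.sum_congr rfl fun _ _ => by ring

lemma fderiv_dvec_apply (hU : IsOpen U) (hF : ContDiffOn ℝ ∞ F U) (hu : u ∈ U) (X : Fin n → ℝ)
    (s : Fin n) : fderiv ℝ (dvec F) u X s = ∑ j, X j * pd s (pd j F) u := by
  have h : fderiv ℝ (dvec F) u X s = fderiv ℝ (pd s F) u X := by
    have h1 := hasDerivAt_comp_field hU (smooth_dvec hU hF) (hasDerivAt_line u X)
      (by simpa using hu)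
    have h2 := hasDerivAt_comp_field hU (contDiffOn_pi.1 (smooth_dvec hU hF) s)
      (hasDerivAt_line u X) (by simpa using hu)
    have := (hasDerivAt_pi.1 h1 s).unique h2
    rw [zero_smul, add_zero] at this
    exact this
  rw [h, fderiv_eq_sum_pd]
  refine Finset.sum_congr rfl fun j _ => ?_
  rw [smul_eq_mul]
  congr 1
  exact fderiv_comm hU hF hu _ _

lemma hess_lower (hU : IsOpen U) (hg : IsMetricOn U g) (hF : ContDiffOn ℝ ∞ F U) (hu : u ∈ U)
    (X : Fin n → ℝ) : g u *ᵥ (hess g F u *ᵥ X) =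
      fderiv ℝ (dvec F) u X - (conn g u X)ᵀ *ᵥ dvec F u := by
  have h : hess g F u *ᵥ X = (g u)⁻¹ *ᵥ ((Matrix.of fun s j =>
      (pd s (pd j F) u - ∑ m, christoffel g m s j u * pd m F u)) *ᵥ X) := by
    rw [mulVec_mulVec]; rfl
  rw [h, mulVec_mulVec, mul_nonsing_inv _ (hg.isUnit_det hu), one_mulVec]
  ext s
  rw [Pi.sub_apply, fderiv_dvec_apply hU hF hu]
  simp only [mulVec, dotProduct, of_apply, sub_mul, Finset.sum_sub_distrib, transpose_apply,
    conn_apply, Finset.sum_mul]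
  congr 1
  · exact Finset.sum_congr rfl fun _ _ => mul_comm _ _
  · rw [Finset.sum_comm]
    refine Finset.sum_congr rfl fun _ _ => Finset.sum_congr rfl fun _ _ => ?_
    rw [christoffel_symm hU hg hu, dvec]
    ring

/-- The Hessian as the covariant derivative of the gradient: differentiate `g ∇F = dF` and use
compatibility of the connection with `g`. -/
lemma hess_mulVec (hU : IsOpen U) (hg : IsMetricOn U g) (hF : ContDiffOn ℝ ∞ F U) (hu : u ∈ U)
    (X : Fin n → ℝ) :
    hess g F u *ᵥ X = fderiv ℝ (grad g F) u X + conn g u X *ᵥ grad g F u := by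
  have hl := hasDerivAt_line u X
  have hu' : u + (0 : ℝ) • X ∈ U := by simpa
  have h1 := (hg.matSmooth.hasMatDerivAt hU hl hu').mulVec
    (hasDerivAt_comp_field hU (smooth_grad hU hg hF) hl hu')
  have h2 := hasDerivAt_comp_field hU (smooth_dvec hU hF) hl hu'
  have h3 := h1.unique (h2.congr_of_eventuallyEq (by
    have : ∀ᶠ t : ℝ in nhds 0, u + t • X ∈ U :=
      hl.continuousAt.eventually_mem (hU.mem_nhds hu')
    exact this.mono fun t ht => metric_mulVec_grad hg ht F))
  simp only [zero_smul, add_zero] at h3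
  have h4 := hess_lower hU hg hF hu X
  rw [← h3, matDeriv_metric hU hg hu, add_mulVec, ← mulVec_mulVec, ← mulVec_mulVec,
    metric_mulVec_grad hg hu] at h4
  have h5 : g u *ᵥ (hess g F u *ᵥ X) =
      g u *ᵥ (fderiv ℝ (grad g F) u X + conn g u X *ᵥ grad g F u) := by
    rw [h4, mulVec_add]; abel
  have h6 := congrArg (fun y => (g u)⁻¹ *ᵥ y) h5
  simpa [mulVec_mulVec, ← mul_assoc, nonsing_inv_mul _ (hg.isUnit_det hu), mulVec_add] using h6

lemma smooth_hess (hU : IsOpen U) (hg : IsMetricOn U g) (hF : ContDiffOn ℝ ∞ F U) :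
    MatSmoothOn ∞ (hess g F) U := by
  intro i j
  simp only [hess, of_apply]
  refine ContDiffOn.sum fun s _ => (hg.matSmooth_inv i s).mul ?_
  refine (contDiffOn_fderiv_dir hU (contDiffOn_fderiv_dir hU hF _) _).sub
    (ContDiffOn.sum fun m _ => (smooth_christoffel hU hg m s j).mul
      (contDiffOn_fderiv_dir hU hF _))

/-- `W` is symmetric for the bilinear form with matrix `G`. -/
def SelfAdj (G W : Matrix (Fin n) (Fin n) ℝ) : Prop := Wᵀ * G = G * W

lemma SelfAdj.dotProduct_eq {G W : Matrix (Fin n) (Fin n) ℝ} (h : SelfAdj G W)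
    (X Y : Fin n → ℝ) : X ⬝ᵥ G *ᵥ (W *ᵥ Y) = (W *ᵥ X) ⬝ᵥ G *ᵥ Y := by
  rw [mulVec_mulVec, ← h, ← mulVec_mulVec, dotProduct_mulVec, vecMul_transpose]

lemma SelfAdj.mul {G W V : Matrix (Fin n) (Fin n) ℝ} (h : SelfAdj G W) (h' : SelfAdj G V)
    (hc : W * V = V * W) : SelfAdj G (W * V) := by
  unfold SelfAdj at *
  rw [transpose_mul, mul_assoc, h, ← mul_assoc, h', mul_assoc, hc]

lemma SelfAdj.sub {G W V : Matrix (Fin n) (Fin n) ℝ} (h : SelfAdj G W) (h' : SelfAdj G V) :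
    SelfAdj G (W - V) := by
  unfold SelfAdj at *
  rw [transpose_sub, sub_mul, h, h', mul_sub]

lemma SelfAdj.smul {G W : Matrix (Fin n) (Fin n) ℝ} (c : ℝ) (h : SelfAdj G W) :
    SelfAdj G (c • W) := by
  unfold SelfAdj at *
  rw [transpose_smul, Matrix.smul_mul, h, Matrix.mul_smul]

lemma SelfAdj.one (G : Matrix (Fin n) (Fin n) ℝ) : SelfAdj G 1 := by simp [SelfAdj]

lemma ext_bilin {C D : Matrix (Fin n) (Fin n) ℝ} (h : ∀ X Y, X ⬝ᵥ C *ᵥ Y = X ⬝ᵥ D *ᵥ Y) :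
    C = D := by
  ext i j
  simpa using h (Pi.single i 1) (Pi.single j 1)

lemma ext_mulVec {C D : Matrix (Fin n) (Fin n) ℝ} (h : ∀ Y, C *ᵥ Y = D *ᵥ Y) : C = D :=
  ext_bilin fun _ Y => by rw [h Y]

/-- Second partial derivatives commute and the connection has no torsion. -/
lemma selfAdj_hess (hU : IsOpen U) (hg : IsMetricOn U g) (hF : ContDiffOn ℝ ∞ F U) (hu : u ∈ U) :
    SelfAdj (g u) (hess g F u) := by
  have key : ∀ X Y, X ⬝ᵥ g u *ᵥ (hess g F u *ᵥ Y) = Y ⬝ᵥ g u *ᵥ (hess g F u *ᵥ X) := by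
    intro X Y
    rw [hess_lower hU hg hF hu, hess_lower hU hg hF hu, dotProduct_sub, dotProduct_sub]
    congr 1
    · simp only [dotProduct, fderiv_dvec_apply hU hF hu, Finset.mul_sum]
      rw [Finset.sum_comm]
      refine Finset.sum_congr rfl fun i _ => Finset.sum_congr rfl fun j _ => ?_
      rw [show pd j (pd i F) u = pd i (pd j F) u from fderiv_comm hU hF hu _ _]
      ring
    · rw [mulVec_transpose, mulVec_transpose, dotProduct_comm, ← dotProduct_mulVec,
        conn_symm hU hg hu Y X, dotProduct_mulVec, dotProduct_comm]
  refine ext_bilin fun X Y => ?_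
  rw [← mulVec_mulVec, ← mulVec_mulVec, key X Y, dotProduct_mulVec, vecMul_transpose,
    dotProduct_mulVec, ← mulVec_transpose, (hg.symm u hu).eq, dotProduct_comm]

/-- The tensor `W` is a Codazzi tensor for the connection with the matrices `Θ X`. -/
def Codazzi (Θ : (Fin n → ℝ) → Matrix (Fin n) (Fin n) ℝ) (W : MatField n) (u : Fin n → ℝ) : Prop :=
  ∀ X Y, matDeriv W u X *ᵥ Y + Θ X *ᵥ (W u *ᵥ Y) = matDeriv W u Y *ᵥ X + Θ Y *ᵥ (W u *ᵥ X)

lemma eventually_mem_line (hU : IsOpen U) (hu : u ∈ U) (X : Fin n → ℝ) :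
    ∀ᶠ t : ℝ in nhds 0, u + t • X ∈ U :=
  (hasDerivAt_line u X).continuousAt.eventually_mem (hU.mem_nhds (by simpa using hu))

/-- Antisymmetrizing the second covariant derivative of `∇F` leaves the curvature applied to `∇F`,
which is zero for a flat metric. -/
lemma codazzi_hess (hU : IsOpen U) (hg : IsMetricOn U g) (hF : ContDiffOn ℝ ∞ F U) (hu : u ∈ U)
    (hflat : ∀ X Y, curv (chr g) u X Y = 0) : Codazzi (conn g u) (hess g F) u := by
  intro X Y
  have hu' : ∀ Z : Fin n → ℝ, u + (0 : ℝ) • Z ∈ U := fun Z => by simpa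
  have key : ∀ X Y, matDeriv (hess g F) u X *ᵥ Y = fderiv ℝ (fun z => fderiv ℝ (grad g F) z Y) u X
      + (dcn (chr g) u X Y *ᵥ grad g F u + conn g u Y *ᵥ fderiv ℝ (grad g F) u X) := by
    intro X Y
    have hl := hasDerivAt_line u X
    have h1 := ((smooth_hess hU hg hF).hasMatDerivAt hU hl (hu' X)).mulVec (hasDerivAt_const 0 Y)
    have h2 := (hasDerivAt_comp_field hU (contDiffOn_fderiv_dir hU (smooth_grad hU hg hF) Y) hl
      (hu' X)).add ((cn_hasMatDerivAt hU (smooth_chr hU hg) hl (hu' X)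
        (hasDerivAt_const 0 Y)).mulVec (hasDerivAt_comp_field hU (smooth_grad hU hg hF) hl (hu' X)))
    have h3 := h1.unique (h2.congr_of_eventuallyEq ((eventually_mem_line hU hu X).mono fun t ht =>
      hess_mulVec hU hg hF ht Y))
    simpa [cn] using h3
  have hc := congrArg (fun C => C *ᵥ grad g F u) (hflat X Y)
  simp only [curv, add_mulVec, sub_mulVec, zero_mulVec, ← mulVec_mulVec] at hc
  rw [key X Y, key Y X, hess_mulVec hU hg hF hu, hess_mulVec hU hg hF hu, mulVec_add, mulVec_add,
    fderiv_comm hU (smooth_grad hU hg hF) hu X Y]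
  rw [← sub_eq_zero] at hc ⊢
  rw [← hc]
  abel

lemma IsFlux.fderiv_eq {w : MatField n} {E : ScalarField n} (h : IsFlux U w F E) (hu : u ∈ U)
    (X : Fin n → ℝ) : dvec F u ⬝ᵥ w u *ᵥ X = fderiv ℝ E u X := by
  rw [fderiv_eq_dvec, dotProduct_mulVec]
  congr 1
  ext j
  exact h u hu j

lemma isFlux_of_fderiv {w : MatField n} {E : ScalarField n}
    (h : ∀ u ∈ U, ∀ X, dvec F u ⬝ᵥ w u *ᵥ X = fderiv ℝ E u X) : IsFlux U w F E := by
  intro u hu j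
  have := h u hu (Pi.single j 1)
  simpa [dotProduct, pd, dvec] using this

/-- The Hessian of a conserved density of a Codazzi flow is symmetric along it. -/
lemma IsFlux.hess_symm {w : MatField n} {E : ScalarField n} (hU : IsOpen U) (hg : IsMetricOn U g)
    (hF : ContDiffOn ℝ ∞ F U) (hE : ContDiffOn ℝ ∞ E U) (hw : MatSmoothOn ∞ w U)
    (h : IsFlux U w F E) (hu : u ∈ U) (hc : Codazzi (conn g u) w u) (X Y : Fin n → ℝ) :
    (g u *ᵥ (hess g F u *ᵥ X)) ⬝ᵥ w u *ᵥ Y = (g u *ᵥ (hess g F u *ᵥ Y)) ⬝ᵥ w u *ᵥ X := by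
  have hu' : ∀ Z : Fin n → ℝ, u + (0 : ℝ) • Z ∈ U := fun Z => by simpa
  have key : ∀ X Y, fderiv ℝ (dvec F) u X ⬝ᵥ w u *ᵥ Y + dvec F u ⬝ᵥ matDeriv w u X *ᵥ Y =
      fderiv ℝ (fun z => fderiv ℝ E z Y) u X := by
    intro X Y
    have hl := hasDerivAt_line u X
    have h1 := hasDerivAt_dotProduct (hasDerivAt_comp_field hU (smooth_dvec hU hF) hl (hu' X))
      ((hw.hasMatDerivAt hU hl (hu' X)).mulVec (hasDerivAt_const 0 Y))
    have h2 := hasDerivAt_comp_field hU (contDiffOn_fderiv_dir hU hE Y) hl (hu' X)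
    have h3 := h1.unique (h2.congr_of_eventuallyEq ((eventually_mem_line hU hu X).mono fun t ht =>
      h.fderiv_eq ht Y))
    simpa using h3
  -- The second derivative of the flux is symmetric. The Codazzi identity eliminates the derivatives
  -- of `w` and completes the derivative of `dF` to the covariant one.
  have e := fderiv_comm hU hE hu X Y
  rw [← key, ← key] at e
  have hc' := congrArg (fun y => dvec F u ⬝ᵥ y) (hc X Y)
  simp only [dotProduct_add] at hc'
  rw [hess_lower hU hg hF hu, hess_lower hU hg hF hu, sub_dotProduct, sub_dotProduct,
    mulVec_transpose, mulVec_transpose, ← dotProduct_mulVec, ← dotProduct_mulVec]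
  linarith

/-- The bilinear form `Hess F (X, wY)` is symmetric; since both operators are self-adjoint, this
says that they commute. It is the source of every commutation relation between Hessians below. -/
lemma IsFlux.commute_hess {w : MatField n} {E : ScalarField n} (hU : IsOpen U)
    (hg : IsMetricOn U g) (hF : ContDiffOn ℝ ∞ F U) (hE : ContDiffOn ℝ ∞ E U)
    (hw : MatSmoothOn ∞ w U) (h : IsFlux U w F E) (hu : u ∈ U) (hc : Codazzi (conn g u) w u)
    (hs : SelfAdj (g u) (w u)) : hess g F u * w u = w u * hess g F u := by
  have h1 : g u * (hess g F u * w u) = g u * (w u * hess g F u) := by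
    refine ext_bilin fun X Y => ?_
    have e := h.hess_symm hU hg hF hE hw hu hc X Y
    have hF' := selfAdj_hess hU hg hF hu
    have l1 : X ⬝ᵥ g u *ᵥ (hess g F u *ᵥ (w u *ᵥ Y)) = (g u *ᵥ (hess g F u *ᵥ X)) ⬝ᵥ w u *ᵥ Y := by
      rw [hF'.dotProduct_eq, dotProduct_mulVec, ← mulVec_transpose, (hg.symm u hu).eq]
    have l2 : X ⬝ᵥ g u *ᵥ (w u *ᵥ (hess g F u *ᵥ Y)) = (g u *ᵥ (hess g F u *ᵥ Y)) ⬝ᵥ w u *ᵥ X := by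
      rw [hs.dotProduct_eq, dotProduct_comm]
    simp only [← mulVec_mulVec]
    rw [l1, l2, e]
  have h2 := congrArg (fun C => (g u)⁻¹ * C) h1
  simpa [← mul_assoc, nonsing_inv_mul _ (hg.isUnit_det hu)] using h2

end

section

variable {n : ℕ} {U : Set (Fin n → ℝ)} {g : MatField n} {u : Fin n → ℝ}

/-! ### Directional derivatives of matrix fields -/

section matDeriv

variable {A C : MatField n} {f : ScalarField n}

lemma MatSmoothOn.line (hU : IsOpen U) (hA : MatSmoothOn ∞ A U) (hu : u ∈ U) (X : Fin n → ℝ) :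
    HasMatDerivAt (fun t : ℝ => A (u + t • X)) (HydroType.matDeriv A u X) 0 := by
  have h := hA.hasMatDerivAt hU (hasDerivAt_line u X) (by simpa using hu)
  rwa [zero_smul, add_zero] at h

lemma hasDerivAt_field_line {E : Type*} [NormedAddCommGroup E] [NormedSpace ℝ E] (hU : IsOpen U)
    {W : (Fin n → ℝ) → E} (hA : ContDiffOn ℝ ∞ W U) (hu : u ∈ U) (X : Fin n → ℝ) :
    HasDerivAt (fun t : ℝ => W (u + t • X)) (fderiv ℝ W u X) 0 := by
  have h := hasDerivAt_comp_field hU hA (hasDerivAt_line u X) (by simpa using hu)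
  rwa [zero_smul, add_zero] at h

lemma HasMatDerivAt.matDeriv_eq (hU : IsOpen U) (hA : MatSmoothOn ∞ A U) (hu : u ∈ U)
    {X : Fin n → ℝ} {A' : Matrix (Fin n) (Fin n) ℝ} {c : ℝ → Matrix (Fin n) (Fin n) ℝ}
    (h : HasMatDerivAt c A' 0) (hc : ∀ t : ℝ, u + t • X ∈ U → A (u + t • X) = c t) :
    HydroType.matDeriv A u X = A' :=
  (hA.line hU hu X).unique (h.congr ((eventually_mem_line hU hu X).mono hc))

lemma matDeriv_mul (hU : IsOpen U) (hA : MatSmoothOn ∞ A U) (hC : MatSmoothOn ∞ C U) (hu : u ∈ U)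
    (X : Fin n → ℝ) : matDeriv (fun y => A y * C y) u X =
      matDeriv A u X * C u + A u * matDeriv C u X := by
  have := ((hA.line hU hu X).mul (hC.line hU hu X)).matDeriv_eq hU (hA.mul hC) hu
    (fun _ _ => rfl)
  simpa using this

lemma matDeriv_fsmul (hU : IsOpen U) (hf : ContDiffOn ℝ ∞ f U) (hC : MatSmoothOn ∞ C U)
    (hu : u ∈ U) (X : Fin n → ℝ) : matDeriv (fun y => f y • C y) u X =
      fderiv ℝ f u X • C u + f u • matDeriv C u X := by
  have := (HasMatDerivAt.smul (hasDerivAt_field_line hU hf hu X) (hC.line hU hu X)).matDeriv_eq hU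
    (MatSmoothOn.smul hf hC) hu (fun _ _ => rfl)
  simpa using this

lemma matDeriv_fadd (hU : IsOpen U) (hA : MatSmoothOn ∞ A U) (hC : MatSmoothOn ∞ C U) (hu : u ∈ U)
    (X : Fin n → ℝ) : matDeriv (fun y => A y + C y) u X = matDeriv A u X + matDeriv C u X :=
  ((hA.line hU hu X).add (hC.line hU hu X)).matDeriv_eq hU (hA.add hC) hu (fun _ _ => rfl)

lemma matDeriv_fsub (hU : IsOpen U) (hA : MatSmoothOn ∞ A U) (hC : MatSmoothOn ∞ C U) (hu : u ∈ U)
    (X : Fin n → ℝ) : matDeriv (fun y => A y - C y) u X = matDeriv A u X - matDeriv C u X :=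
  ((hA.line hU hu X).sub (hC.line hU hu X)).matDeriv_eq hU (hA.sub hC) hu (fun _ _ => rfl)

lemma matDeriv_transpose (hU : IsOpen U) (hA : MatSmoothOn ∞ A U) (hu : u ∈ U)
    (X : Fin n → ℝ) : matDeriv (fun y => (A y)ᵀ) u X = (matDeriv A u X)ᵀ :=
  ((hA.line hU hu X).transpose).matDeriv_eq hU hA.transpose hu (fun _ _ => rfl)

lemma matDeriv_congr (hU : IsOpen U) (hu : u ∈ U) (h : ∀ y ∈ U, A y = C y) (X : Fin n → ℝ) :
    matDeriv A u X = matDeriv C u X := by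
  ext i j
  simp only [matDeriv, of_apply]
  have : (fun y => A y i j) =ᶠ[nhds u] fun y => C y i j :=
    Filter.eventually_of_mem (hU.mem_nhds hu) fun y hy => by simp [h y hy]
  rw [this.fderiv_eq]

lemma matDeriv_const (A : Matrix (Fin n) (Fin n) ℝ) (u X : Fin n → ℝ) :
    matDeriv (fun _ => A) u X = 0 := by
  ext i j; simp [matDeriv]

end matDeriv

/-- Codazzi tensors under a change of frame. -/
lemma codazzi_gauge (hU : IsOpen U) (hu : u ∈ U) {K W Z : MatField n} (hK : MatSmoothOn ∞ K U)
    (hW : MatSmoothOn ∞ W U) (hdet : (K u).det ≠ 0) {C Θ : (Fin n → ℝ) → Matrix (Fin n) (Fin n) ℝ}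
    (hC : ∀ X, K u * C X = matDeriv K u X + Θ X * K u) (hZ : ∀ y ∈ U, Z y = K y * W y)
    (h : Codazzi Θ Z u) : Codazzi C W u := by
  have key : ∀ X Y, K u *ᵥ (matDeriv W u X *ᵥ Y + C X *ᵥ (W u *ᵥ Y)) =
      matDeriv Z u X *ᵥ Y + Θ X *ᵥ (Z u *ᵥ Y) := by
    intro X Y
    rw [matDeriv_congr hU hu hZ, matDeriv_mul hU hK hW hu, mulVec_add, mulVec_mulVec _ (K u) (C X),
      hC, hZ u hu]
    simp only [add_mulVec, ← mulVec_mulVec]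
    abel
  intro X Y
  have e := congrArg (fun y => (K u)⁻¹ *ᵥ y) ((key X Y).trans ((h X Y).trans (key Y X).symm))
  simpa [mulVec_mulVec, nonsing_inv_mul _ (isUnit_iff_ne_zero.2 hdet)] using e

/-! ### Rotations -/

/-- The infinitesimal rotation `a ∧ c` for the bilinear form with matrix `G`. -/
def wedge (G : Matrix (Fin n) (Fin n) ℝ) (a c : Fin n → ℝ) : Matrix (Fin n) (Fin n) ℝ :=
  vecMulVec a (G *ᵥ c) - vecMulVec c (G *ᵥ a)

lemma wedge_mulVec (G : Matrix (Fin n) (Fin n) ℝ) (a c z : Fin n → ℝ) :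
    wedge G a c *ᵥ z = ((G *ᵥ c) ⬝ᵥ z) • a - ((G *ᵥ a) ⬝ᵥ z) • c := by
  simp [wedge, sub_mulVec, vecMulVec_mulVec]

lemma wedge_skew {G : Matrix (Fin n) (Fin n) ℝ} (hG : Gᵀ = G) (a c : Fin n → ℝ) :
    (wedge G a c)ᵀ * G + G * wedge G a c = 0 := by
  ext i j
  simp [wedge, transpose_sub, transpose_vecMulVec, sub_mul, mul_sub, vecMulVec_mul, mul_vecMulVec,
    ← mulVec_transpose, hG]

/-- The data of a reciprocal transformation of a Hamiltonian system `u_t = v u_x`: the matrices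
`K` and `L` solve `B K + N L = 1`, `A K + M L = v`. -/
structure RecipData (U : Set (Fin n → ℝ)) (g v K L : MatField n) (B A N M : ScalarField n) :
    Prop where
  isOpen : IsOpen U
  metric : IsMetricOn U g
  flat : ∀ u ∈ U, ∀ X Y, curv (chr g) u X Y = 0
  smB : ContDiffOn ℝ ∞ B U
  smA : ContDiffOn ℝ ∞ A U
  smN : ContDiffOn ℝ ∞ N U
  smM : ContDiffOn ℝ ∞ M U
  smv : MatSmoothOn ∞ v U
  smK : MatSmoothOn ∞ K U
  smL : MatSmoothOn ∞ L U
  one_eq : ∀ u ∈ U, B u • K u + N u • L u = 1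
  v_eq : ∀ u ∈ U, A u • K u + M u • L u = v u
  fluxB : IsFlux U v B A
  fluxN : IsFlux U v N M
  delta : ∀ u ∈ U, B u * M u - A u * N u ≠ 0
  codv : ∀ u ∈ U, Codazzi (conn g u) v u
  adjK : ∀ u ∈ U, SelfAdj (g u) (K u)
  adjL : ∀ u ∈ U, SelfAdj (g u) (L u)
  adjv : ∀ u ∈ U, SelfAdj (g u) (v u)
  commKL : ∀ u ∈ U, Commute (K u) (L u)
  commKv : ∀ u ∈ U, Commute (K u) (v u)
  commLv : ∀ u ∈ U, Commute (L u) (v u)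
  detK : ∀ u ∈ U, (K u).det ≠ 0

/-- A Codazzi flow `u_s = w u_x`, which commutes with `K` and `L`, and the fluxes of `B` and `N`
along it. -/
structure FlowData (U : Set (Fin n → ℝ)) (g K L : MatField n) (B N : ScalarField n)
    (w : MatField n) (E G : ScalarField n) : Prop where
  smw : MatSmoothOn ∞ w U
  smE : ContDiffOn ℝ ∞ E U
  smG : ContDiffOn ℝ ∞ G U
  fluxB : IsFlux U w B E
  fluxN : IsFlux U w N G
  cod : ∀ u ∈ U, Codazzi (conn g u) w u
  adj : ∀ u ∈ U, SelfAdj (g u) (w u)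
  commK : ∀ u ∈ U, Commute (K u) (w u)
  commL : ∀ u ∈ U, Commute (L u) (w u)

/-- The rotation part of the transformed connection. -/
def rot (g K L : MatField n) (B N : ScalarField n) (u X : Fin n → ℝ) : Matrix (Fin n) (Fin n) ℝ :=
  wedge (g u) (grad g B u) (K u *ᵥ X) + wedge (g u) (grad g N u) (L u *ᵥ X)

/-- The matrix of the flow before the change of frame. -/
def frameFlow (K L w : MatField n) (E G : ScalarField n) : MatField n := fun u =>
  w u - E u • K u - G u • L u

/-! ### Codazzi tensors in the frame `K` -/

section recip

variable {v K L : MatField n} {B A N M : ScalarField n}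

lemma rot_mulVec (hg : IsMetricOn U g) (hu : u ∈ U) (K L : MatField n) (B N : ScalarField n)
    (X z : Fin n → ℝ) : rot g K L B N u X *ᵥ z =
      ((g u *ᵥ K u *ᵥ X) ⬝ᵥ z) • grad g B u - (dvec B u ⬝ᵥ z) • K u *ᵥ X +
      (((g u *ᵥ L u *ᵥ X) ⬝ᵥ z) • grad g N u - (dvec N u ⬝ᵥ z) • L u *ᵥ X) := by
  rw [rot, add_mulVec, wedge_mulVec, wedge_mulVec, metric_mulVec_grad hg hu,
    metric_mulVec_grad hg hu]

lemma metric_dot_comm (hg : IsMetricOn U g) (hu : u ∈ U) (X Y : Fin n → ℝ) :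
    (g u *ᵥ X) ⬝ᵥ Y = (g u *ᵥ Y) ⬝ᵥ X := by
  rw [dotProduct_comm, dotProduct_mulVec, ← mulVec_transpose, (hg.symm u hu).eq]

/-- The product of two commuting self-adjoint operators is self-adjoint. -/
lemma SelfAdj.symm_of_commute (hg : IsMetricOn U g) (hu : u ∈ U)
    {S T : Matrix (Fin n) (Fin n) ℝ} (hS : SelfAdj (g u) S) (hT : SelfAdj (g u) T)
    (hc : Commute S T) (X Y : Fin n → ℝ) :
    (g u *ᵥ S *ᵥ X) ⬝ᵥ (T *ᵥ Y) = (g u *ᵥ S *ᵥ Y) ⬝ᵥ (T *ᵥ X) := by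
  have h1 : ∀ X Y : Fin n → ℝ, (g u *ᵥ S *ᵥ X) ⬝ᵥ (T *ᵥ Y) = (g u *ᵥ (S * T) *ᵥ Y) ⬝ᵥ X := by
    intro X Y
    rw [metric_dot_comm hg hu, dotProduct_comm, ← hS.dotProduct_eq, dotProduct_comm,
      mulVec_mulVec Y S T]
  rw [h1 X Y, dotProduct_comm, (hS.mul hT hc).dotProduct_eq, dotProduct_comm,
    metric_dot_comm hg hu, ← h1 Y X]

/-- The part of `rot X (T Y)` that is not symmetric in `X`, `Y`. -/
lemma rot_swap (hg : IsMetricOn U g) (hu : u ∈ U) {T : Matrix (Fin n) (Fin n) ℝ}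
    (hK : SelfAdj (g u) (K u)) (hL : SelfAdj (g u) (L u)) (hT : SelfAdj (g u) T)
    (hKT : Commute (K u) T) (hLT : Commute (L u) T) (X Y : Fin n → ℝ) :
    rot g K L B N u X *ᵥ T *ᵥ Y + (dvec B u ⬝ᵥ T *ᵥ Y) • K u *ᵥ X + (dvec N u ⬝ᵥ T *ᵥ Y) • L u *ᵥ X =
    rot g K L B N u Y *ᵥ T *ᵥ X + (dvec B u ⬝ᵥ T *ᵥ X) • K u *ᵥ Y +
      (dvec N u ⬝ᵥ T *ᵥ X) • L u *ᵥ Y := by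
  rw [rot_mulVec hg hu, rot_mulVec hg hu, hK.symm_of_commute hg hu hT hKT X Y,
    hL.symm_of_commute hg hu hT hLT X Y]
  abel

/-- The Codazzi defects of `K` and `L` satisfy two linear relations, with coefficients `(B, N)` and
`(A, M)`, obtained by differentiating `BK + NL = 1` and `AK + ML = v`. In each, the terms with the
differentials of the coefficients are the non-symmetric part of the rotation, by `rot_swap` and, in
the second, the flux identities. The determinant of the system is `BM - AN`. -/
lemma RecipData.codazzi_frame (hr : RecipData U g v K L B A N M) (hu : u ∈ U) :
    Codazzi (fun X => conn g u X + rot g K L B N u X) K u ∧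
    Codazzi (fun X => conn g u X + rot g K L B N u X) L u := by
  have e1 : ∀ X, fderiv ℝ B u X • K u + B u • matDeriv K u X +
      (fderiv ℝ N u X • L u + N u • matDeriv L u X) = 0 := by
    intro X
    rw [← matDeriv_fsmul hr.isOpen hr.smB hr.smK hu, ← matDeriv_fsmul hr.isOpen hr.smN hr.smL hu,
      ← matDeriv_fadd hr.isOpen (MatSmoothOn.smul hr.smB hr.smK) (MatSmoothOn.smul hr.smN hr.smL) hu,
      matDeriv_congr hr.isOpen hu hr.one_eq, matDeriv_const]
  have e2 : ∀ X, fderiv ℝ A u X • K u + A u • matDeriv K u X +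
      (fderiv ℝ M u X • L u + M u • matDeriv L u X) = matDeriv v u X := by
    intro X
    rw [← matDeriv_fsmul hr.isOpen hr.smA hr.smK hu, ← matDeriv_fsmul hr.isOpen hr.smM hr.smL hu,
      ← matDeriv_fadd hr.isOpen (MatSmoothOn.smul hr.smA hr.smK) (MatSmoothOn.smul hr.smM hr.smL) hu,
      matDeriv_congr hr.isOpen hu hr.v_eq]
  set T : MatField n → (Fin n → ℝ) → (Fin n → ℝ) → Fin n → ℝ := fun W X Y =>
    matDeriv W u X *ᵥ Y + (conn g u X + rot g K L B N u X) *ᵥ (W u *ᵥ Y) with hT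
  have s1 : ∀ X Y, B u • T K X Y + N u • T L X Y = B u • T K Y X + N u • T L Y X := by
    have h : ∀ X Y, B u • T K X Y + N u • T L X Y = conn g u X *ᵥ Y + (rot g K L B N u X *ᵥ Y -
        fderiv ℝ B u X • K u *ᵥ Y - fderiv ℝ N u X • L u *ᵥ Y) := by
      intro X Y
      have h1 : conn g u X *ᵥ Y + rot g K L B N u X *ᵥ Y =
          (conn g u X + rot g K L B N u X) *ᵥ ((B u • K u + N u • L u) *ᵥ Y) := by
        rw [hr.one_eq u hu, one_mulVec, add_mulVec]
      have h2 := congrArg (fun C => C *ᵥ Y) (e1 X)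
      simp only [add_mulVec, smul_mulVec, mulVec_add, mulVec_smul, zero_mulVec] at h1 h2
      simp only [hT, add_mulVec, smul_add]
      funext i
      have c1 := congrFun h1 i
      have c2 := congrFun h2 i
      simp only [Pi.add_apply, Pi.sub_apply, Pi.smul_apply, Pi.zero_apply, smul_eq_mul] at c1 c2 ⊢
      linear_combination c2 - c1
    intro X Y
    have hs := rot_swap (B := B) (N := N) hr.metric hu (hr.adjK u hu) (hr.adjL u hu)
      (SelfAdj.one _) (Commute.one_right _) (Commute.one_right _) X Y
    simp only [one_mulVec, ← fderiv_eq_dvec] at hs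
    rw [h, h, conn_symm hr.isOpen hr.metric hu X Y]
    congr 1
    rw [← sub_eq_zero] at hs ⊢
    rw [← hs]
    abel
  have s2 : ∀ X Y, A u • T K X Y + M u • T L X Y = A u • T K Y X + M u • T L Y X := by
    have h : ∀ X Y, A u • T K X Y + M u • T L X Y = (matDeriv v u X *ᵥ Y +
        conn g u X *ᵥ (v u *ᵥ Y)) + (rot g K L B N u X *ᵥ (v u *ᵥ Y) -
        fderiv ℝ A u X • K u *ᵥ Y - fderiv ℝ M u X • L u *ᵥ Y) := by
      intro X Y
      rw [← e2 X]
      simp only [hT, ← hr.v_eq u hu]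
      simp only [add_mulVec, smul_mulVec, mulVec_add, mulVec_smul, smul_add]
      abel
    intro X Y
    have hs := rot_swap (B := B) (N := N) hr.metric hu (hr.adjK u hu) (hr.adjL u hu)
      (hr.adjv u hu) (hr.commKv u hu) (hr.commLv u hu) X Y
    rw [hr.fluxB.fderiv_eq hu, hr.fluxN.fderiv_eq hu, hr.fluxB.fderiv_eq hu,
      hr.fluxN.fderiv_eq hu] at hs
    rw [h, h, hr.codv u hu X Y]
    congr 1
    rw [← sub_eq_zero] at hs ⊢
    rw [← hs]
    abel
  -- Cramer's rule for the two relations `s1` and `s2`.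
  have hd := hr.delta u hu
  constructor
  · intro X Y
    change T K X Y = T K Y X
    have h1 := s1 X Y
    have h2 := s2 X Y
    funext i
    have h1' := congrFun h1 i
    have h2' := congrFun h2 i
    simp only [Pi.add_apply, Pi.smul_apply, smul_eq_mul] at h1' h2'
    refine mul_left_cancel₀ hd ?_
    linear_combination M u * h1' - N u * h2'
  · intro X Y
    change T L X Y = T L Y X
    have h1 := s1 X Y
    have h2 := s2 X Y
    funext i
    have h1' := congrFun h1 i
    have h2' := congrFun h2 i
    simp only [Pi.add_apply, Pi.smul_apply, smul_eq_mul] at h1' h2'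
    refine mul_left_cancel₀ hd ?_
    linear_combination B u * h2' - A u * h1'

/-- Differentiating `EK + GL` produces `dE(X) KY + dG(X) LY`. By the flux identities these are
`dB(wX) KY + dN(wX) LY`, precisely what `rot_swap` needs to symmetrize the rotation applied to `wY`.
-/
lemma RecipData.codazzi_frameFlow {w : MatField n} {E G : ScalarField n}
    (hr : RecipData U g v K L B A N M) (hw : FlowData U g K L B N w E G) (hu : u ∈ U) :
    Codazzi (fun X => conn g u X + rot g K L B N u X) (frameFlow K L w E G) u := by
  obtain ⟨cK, cL⟩ := hr.codazzi_frame hu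
  have e : ∀ X, matDeriv (frameFlow K L w E G) u X = matDeriv w u X - (fderiv ℝ E u X • K u +
      E u • matDeriv K u X) - (fderiv ℝ G u X • L u + G u • matDeriv L u X) := by
    intro X
    have sK := MatSmoothOn.smul hw.smE hr.smK
    have sL := MatSmoothOn.smul hw.smG hr.smL
    rw [← matDeriv_fsmul hr.isOpen hw.smE hr.smK hu, ← matDeriv_fsmul hr.isOpen hw.smG hr.smL hu,
      ← matDeriv_fsub hr.isOpen hw.smw sK hu, ← matDeriv_fsub hr.isOpen (hw.smw.sub sK) sL hu]
    rfl
  intro X Y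
  have cw := hw.cod u hu X Y
  have cK' := congrArg (fun y => E u • y) (cK X Y)
  have cL' := congrArg (fun y => G u • y) (cL X Y)
  have hs := rot_swap (B := B) (N := N) hr.metric hu (hr.adjK u hu) (hr.adjL u hu)
      (hw.adj u hu) (hw.commK u hu) (hw.commL u hu) X Y
  rw [hw.fluxB.fderiv_eq hu, hw.fluxN.fderiv_eq hu, hw.fluxB.fderiv_eq hu,
      hw.fluxN.fderiv_eq hu] at hs
  rw [e X, e Y]
  simp only [frameFlow, add_mulVec, sub_mulVec, smul_mulVec, mulVec_sub, mulVec_smul,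
    smul_add] at cw cK' cL' hs ⊢
  funext i
  have c1 := congrFun cw i
  have c2 := congrFun cK' i
  have c3 := congrFun cL' i
  have c4 := congrFun hs i
  simp only [Pi.add_apply, Pi.sub_apply, Pi.smul_apply, smul_eq_mul] at c1 c2 c3 c4 ⊢
  linear_combination c1 - c2 - c3 + c4

end recip

end

/-! ### Connection and curvature of the transformed metric -/

section

variable {n : ℕ} {U : Set (Fin n → ℝ)} {g : MatField n} {u : Fin n → ℝ}

section recip

variable {v K L gt : MatField n} {B A N M : ScalarField n}

lemma RecipData.isMetricOn (hr : RecipData U g v K L B A N M)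
    (hgt : ∀ u ∈ U, gt u = (K u)ᵀ * g u * K u) : IsMetricOn U gt where
  smooth := ((hr.smK.transpose.mul hr.metric.matSmooth).mul hr.smK).congr hgt
  symm u hu := by
    rw [IsSymm, hgt u hu, transpose_mul, transpose_mul, transpose_transpose,
      (hr.metric.symm u hu).eq, mul_assoc]
  nondeg u hu := by
    rw [hgt u hu, det_mul, det_mul, det_transpose]
    exact mul_ne_zero (mul_ne_zero (hr.detK u hu) (hr.metric.nondeg u hu)) (hr.detK u hu)

lemma rot_skew (hg : IsMetricOn U g) (hu : u ∈ U) (K L : MatField n) (B N : ScalarField n)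
    (X : Fin n → ℝ) : (rot g K L B N u X)ᵀ * g u + g u * rot g K L B N u X = 0 := by
  have h1 := wedge_skew (hg.symm u hu).eq (grad g B u) (K u *ᵥ X)
  have h2 := wedge_skew (hg.symm u hu).eq (grad g N u) (L u *ᵥ X)
  rw [rot, transpose_add, add_mul, mul_add]
  rw [add_add_add_comm, h1, h2, add_zero]

/-- The connection defined by this formula is metric for `KᵀgK` because `rot` is skew for `g`, and
torsion-free because `K` is Codazzi for `conn + rot`. Uniqueness of the Levi-Civita connection gives
the claim. -/
lemma RecipData.conn_eq (hr : RecipData U g v K L B A N M)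
    (hgt : ∀ u ∈ U, gt u = (K u)ᵀ * g u * K u) (hu : u ∈ U) (X : Fin n → ℝ) :
    K u * conn gt u X = matDeriv K u X + (conn g u X + rot g K L B N u X) * K u := by
  have hK : IsUnit (K u).det := isUnit_iff_ne_zero.2 (hr.detK u hu)
  set C : (Fin n → ℝ) → Matrix (Fin n) (Fin n) ℝ := fun X =>
    (K u)⁻¹ * (matDeriv K u X + (conn g u X + rot g K L B N u X) * K u) with hC
  have hKC : ∀ X, K u * C X = matDeriv K u X + (conn g u X + rot g K L B N u X) * K u := fun X => by
    rw [hC, ← mul_assoc, mul_nonsing_inv _ hK, one_mul]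
  have h1 : ∀ X Y, C X *ᵥ Y = C Y *ᵥ X := by
    intro X Y
    have := (hr.codazzi_frame hu).1 X Y
    simp only [hC, ← mulVec_mulVec]
    congr 1
    simpa only [add_mulVec, ← mulVec_mulVec] using this
  have h2 : ∀ X, matDeriv gt u X = (C X)ᵀ * gt u + gt u * C X := by
    intro X
    have e1 : gt u * C X = (K u)ᵀ * g u * (matDeriv K u X +
        (conn g u X + rot g K L B N u X) * K u) := by
      rw [hgt u hu, mul_assoc ((K u)ᵀ * g u), hKC]
    have e2 : (C X)ᵀ * gt u = ((matDeriv K u X)ᵀ + (K u)ᵀ * ((conn g u X)ᵀ +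
        (rot g K L B N u X)ᵀ)) * g u * K u := by
      rw [hgt u hu, ← mul_assoc, ← mul_assoc, ← transpose_mul, hKC]
      simp only [transpose_add, transpose_mul]
    have e3 := rot_skew hr.metric hu K L B N X
    rw [matDeriv_congr hr.isOpen hu hgt, matDeriv_mul hr.isOpen
      (hr.smK.transpose.mul hr.metric.matSmooth) hr.smK hu, matDeriv_mul hr.isOpen
      hr.smK.transpose hr.metric.matSmooth hu, matDeriv_transpose hr.isOpen hr.smK hu,
      matDeriv_metric hr.isOpen hr.metric hu, e1, e2]
    have e4 : (K u)ᵀ * ((rot g K L B N u X)ᵀ * g u + g u * rot g K L B N u X) * K u = 0 := by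
      rw [e3, mul_zero, zero_mul]
    rw [← sub_eq_zero]
    rw [← neg_eq_zero] at e4
    rw [← e4]
    noncomm_ring
  have := eq_conn hr.isOpen (hr.isMetricOn hgt) hu C h1 h2 X
  rw [← this, hKC]

/-- The covariant derivative of a rotation. -/
lemma hasMatDerivAt_wedge (hU : IsOpen U) (hg : IsMetricOn U g) (hu : u ∈ U) (X : Fin n → ℝ)
    {a c : (Fin n → ℝ) → Fin n → ℝ} (ha : ContDiffOn ℝ ∞ a U) (hc : ContDiffOn ℝ ∞ c U) :
    HasMatDerivAt (fun t : ℝ => wedge (g (u + t • X)) (a (u + t • X)) (c (u + t • X)))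
      (wedge (g u) (fderiv ℝ a u X + conn g u X *ᵥ a u) (c u) +
        wedge (g u) (a u) (fderiv ℝ c u X + conn g u X *ᵥ c u) -
        (conn g u X * wedge (g u) (a u) (c u) - wedge (g u) (a u) (c u) * conn g u X)) 0 := by
  have h1 := hasDerivAt_field_line hU ha hu X
  have h2 := hasDerivAt_field_line hU hc hu X
  have h3 := hg.matSmooth.line hU hu X
  have h4 := (HasMatDerivAt.vecMulVec h1 (h3.mulVec h2)).sub
    (HasMatDerivAt.vecMulVec h2 (h3.mulVec h1))
  simp only [zero_smul, add_zero] at h4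
  convert h4 using 1
  · rfl
  rw [matDeriv_metric hU hg hu]
  simp only [wedge, mul_sub, sub_mul, mul_vecMulVec, vecMulVec_mul, mulVec_add, vecMulVec_add,
    add_vecMulVec, add_mulVec, ← mulVec_mulVec, ← mulVec_transpose]
  abel

lemma smooth_matVec (hW : MatSmoothOn ∞ K U) (Y : Fin n → ℝ) :
    ContDiffOn ℝ ∞ (fun y => K y *ᵥ Y) U := hW.mulVec contDiffOn_const

lemma fderiv_matVec (hU : IsOpen U) (hW : MatSmoothOn ∞ K U) (hu : u ∈ U) (X Y : Fin n → ℝ) :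
    fderiv ℝ (fun y => K y *ᵥ Y) u X = matDeriv K u X *ᵥ Y := by
  have h1 := hasDerivAt_field_line hU (smooth_matVec hW Y) hu X
  have h2 := (hW.line hU hu X).mulVec (hasDerivAt_const 0 Y)
  simpa using h1.unique h2

/-- Leibniz rule for the covariant derivative of the rotation: a derivative falling on `∇B` or `∇N`
becomes a Hessian, and the commutator with `conn` corrects for the ordinary derivative. -/
lemma RecipData.hasMatDerivAt_rot (hr : RecipData U g v K L B A N M) (hu : u ∈ U)
    (X Y : Fin n → ℝ) :
    HasMatDerivAt (fun t : ℝ => rot g K L B N (u + t • X) Y)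
      (wedge (g u) (hess g B u *ᵥ X) (K u *ᵥ Y) + wedge (g u) (hess g N u *ᵥ X) (L u *ᵥ Y) +
        (wedge (g u) (grad g B u) (matDeriv K u X *ᵥ Y + conn g u X *ᵥ K u *ᵥ Y) +
        wedge (g u) (grad g N u) (matDeriv L u X *ᵥ Y + conn g u X *ᵥ L u *ᵥ Y)) -
        (conn g u X * rot g K L B N u Y - rot g K L B N u Y * conn g u X)) 0 := by
  have h1 := hasMatDerivAt_wedge hr.isOpen hr.metric hu X (smooth_grad hr.isOpen hr.metric hr.smB)
    (smooth_matVec hr.smK Y)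
  have h2 := hasMatDerivAt_wedge hr.isOpen hr.metric hu X (smooth_grad hr.isOpen hr.metric hr.smN)
    (smooth_matVec hr.smL Y)
  have h3 := h1.add h2
  rw [fderiv_matVec hr.isOpen hr.smK hu, fderiv_matVec hr.isOpen hr.smL hu,
    ← hess_mulVec hr.isOpen hr.metric hr.smB hu, ← hess_mulVec hr.isOpen hr.metric hr.smN hu] at h3
  convert h3 using 1
  · rfl
  simp only [rot, mul_add, add_mul]
  abel

lemma RecipData.smooth_rot (hr : RecipData U g v K L B A N M) (Y : Fin n → ℝ) :
    MatSmoothOn ∞ (fun y => rot g K L B N y Y) U := by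
  have h : ∀ {a c : (Fin n → ℝ) → Fin n → ℝ}, ContDiffOn ℝ ∞ a U → ContDiffOn ℝ ∞ c U →
      MatSmoothOn ∞ (fun y => wedge (g y) (a y) (c y)) U := fun ha hc =>
    (MatSmoothOn.vecMulVec ha (hr.metric.matSmooth.mulVec hc)).sub
      (MatSmoothOn.vecMulVec hc (hr.metric.matSmooth.mulVec ha))
  exact (h (smooth_grad hr.isOpen hr.metric hr.smB) (smooth_matVec hr.smK Y)).add
    (h (smooth_grad hr.isOpen hr.metric hr.smN) (smooth_matVec hr.smL Y))

lemma RecipData.matDeriv_rot (hr : RecipData U g v K L B A N M) (hu : u ∈ U)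
    (X Y : Fin n → ℝ) : matDeriv (fun y => rot g K L B N y Y) u X =
      wedge (g u) (hess g B u *ᵥ X) (K u *ᵥ Y) + wedge (g u) (hess g N u *ᵥ X) (L u *ᵥ Y) +
        (wedge (g u) (grad g B u) (matDeriv K u X *ᵥ Y + conn g u X *ᵥ K u *ᵥ Y) +
        wedge (g u) (grad g N u) (matDeriv L u X *ᵥ Y + conn g u X *ᵥ L u *ᵥ Y)) -
        (conn g u X * rot g K L B N u Y - rot g K L B N u Y * conn g u X) :=
  (hr.hasMatDerivAt_rot hu X Y).matDeriv_eq hr.isOpen (hr.smooth_rot Y) hu fun _ _ => rfl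

/-- The curvature of the transformed metric in terms of the curvature of the connection in the
frame `K`. -/
lemma RecipData.curv_gauge (hr : RecipData U g v K L B A N M)
    (hgt : ∀ u ∈ U, gt u = (K u)ᵀ * g u * K u) (hu : u ∈ U) (X Y : Fin n → ℝ) :
    K u * curv (chr gt) u X Y =
      (curv (chr g) u X Y + (matDeriv (fun y => rot g K L B N y Y) u X +
        (conn g u X * rot g K L B N u Y - rot g K L B N u Y * conn g u X)) -
        (matDeriv (fun y => rot g K L B N y X) u Y +
        (conn g u Y * rot g K L B N u X - rot g K L B N u X * conn g u Y)) +
        (rot g K L B N u X * rot g K L B N u Y - rot g K L B N u Y * rot g K L B N u X)) * K u := by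
  -- The identity of `RecipData.conn_eq` in the direction `Y`, differentiated along `X`.
  have key : ∀ X Y, matDeriv K u X * conn gt u Y + K u * dcn (chr gt) u X Y =
      matDeriv (fun y => matDeriv K y Y) u X + ((dcn (chr g) u X Y +
        matDeriv (fun y => rot g K L B N y Y) u X) * K u +
        (conn g u Y + rot g K L B N u Y) * matDeriv K u X) := by
    intro X Y
    have hl := hasDerivAt_line u X
    have hu' : u + (0 : ℝ) • X ∈ U := by simpa
    have h1 := (hr.smK.line hr.isOpen hu X).mul (cn_hasMatDerivAt hr.isOpen
      (smooth_chr hr.isOpen (hr.isMetricOn hgt)) hl hu' (hasDerivAt_const 0 Y))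
    have h2 := ((hr.smK.matDeriv hr.isOpen Y).line hr.isOpen hu X).add
      (((cn_hasMatDerivAt hr.isOpen (smooth_chr hr.isOpen hr.metric) hl hu'
        (hasDerivAt_const 0 Y)).add ((hr.smooth_rot Y).line hr.isOpen hu X)).mul
        (hr.smK.line hr.isOpen hu X))
    have h3 := h1.unique (h2.congr ((eventually_mem_line hr.isOpen hu X).mono fun t ht =>
      hr.conn_eq hgt ht Y))
    simpa [cn] using h3
  have kX := key X Y
  have kY := key Y X
  have cX := hr.conn_eq hgt hu X
  have cY := hr.conn_eq hgt hu Y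
  -- The second derivatives of `K` are symmetric and drop out of the antisymmetrization.
  rw [matDeriv_comm hr.isOpen hr.smK hu] at kX
  have l : K u * curv (chr gt) u X Y = K u * dcn (chr gt) u X Y - K u * dcn (chr gt) u Y X +
      (K u * conn gt u X * conn gt u Y - K u * conn gt u Y * conn gt u X) := by
    rw [curv]; noncomm_ring
  rw [l, eq_sub_of_add_eq' kX, eq_sub_of_add_eq' kY, cX, cY]
  have l2 : (matDeriv K u X + (conn g u X + rot g K L B N u X) * K u) * conn gt u Y -
      (matDeriv K u Y + (conn g u Y + rot g K L B N u Y) * K u) * conn gt u X =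
      matDeriv K u X * conn gt u Y - matDeriv K u Y * conn gt u X +
      ((conn g u X + rot g K L B N u X) * (K u * conn gt u Y) -
      (conn g u Y + rot g K L B N u Y) * (K u * conn gt u X)) := by
    noncomm_ring
  rw [l2, cX, cY, curv]
  noncomm_ring

/-- The curvature of `∇` vanishes, and the Codazzi identities for `K` and `L` turn the derivatives
of `KY` and `LY` into products of rotations. What remains besides the Hessians is bilinear in `∇B`,
`∇N` and contains only their scalar products, namely `2Q`, `2R` and `P + S`. -/
lemma RecipData.curv_frame (hr : RecipData U g v K L B A N M) (hu : u ∈ U)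
    {P Q R S : ScalarField n} (hPS : P u + S u = gradInner g B N u)
    (hQ : Q u = (1 / 2) * gradInner g B B u) (hR : R u = (1 / 2) * gradInner g N N u)
    (X Y : Fin n → ℝ) :
    curv (chr g) u X Y + (matDeriv (fun y => rot g K L B N y Y) u X +
        (conn g u X * rot g K L B N u Y - rot g K L B N u Y * conn g u X)) -
        (matDeriv (fun y => rot g K L B N y X) u Y +
        (conn g u Y * rot g K L B N u X - rot g K L B N u X * conn g u Y)) +
        (rot g K L B N u X * rot g K L B N u Y - rot g K L B N u Y * rot g K L B N u X) =
    wedge (g u) (frameFlow K L (hess g B) Q S u *ᵥ X) (K u *ᵥ Y) +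
      wedge (g u) (K u *ᵥ X) (frameFlow K L (hess g B) Q S u *ᵥ Y) +
      wedge (g u) (frameFlow K L (hess g N) P R u *ᵥ X) (L u *ᵥ Y) +
      wedge (g u) (L u *ᵥ X) (frameFlow K L (hess g N) P R u *ᵥ Y) := by
  obtain ⟨cK, cL⟩ := hr.codazzi_frame hu
  have cK' := cK X Y
  have cL' := cL X Y
  simp only [add_mulVec, rot_mulVec hr.metric hu] at cK' cL'
  rw [hr.flat u hu, hr.matDeriv_rot hu, hr.matDeriv_rot hu]
  refine ext_mulVec fun z => ?_
  have hsym := metric_dot_comm hr.metric hu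
  have kk : (g u *ᵥ K u *ᵥ Y) ⬝ᵥ (K u *ᵥ X) = (g u *ᵥ K u *ᵥ X) ⬝ᵥ (K u *ᵥ Y) := hsym _ _
  have ll : (g u *ᵥ L u *ᵥ Y) ⬝ᵥ (L u *ᵥ X) = (g u *ᵥ L u *ᵥ X) ⬝ᵥ (L u *ᵥ Y) := hsym _ _
  have kl : (g u *ᵥ K u *ᵥ Y) ⬝ᵥ (L u *ᵥ X) = (g u *ᵥ K u *ᵥ X) ⬝ᵥ (L u *ᵥ Y) :=
    (hr.adjK u hu).symm_of_commute hr.metric hu (hr.adjL u hu) (hr.commKL u hu) Y X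
  have lk1 : (g u *ᵥ L u *ᵥ X) ⬝ᵥ (K u *ᵥ Y) = (g u *ᵥ K u *ᵥ X) ⬝ᵥ (L u *ᵥ Y) := by
    rw [hsym, kl]
  have lk2 : (g u *ᵥ L u *ᵥ Y) ⬝ᵥ (K u *ᵥ X) = (g u *ᵥ K u *ᵥ X) ⬝ᵥ (L u *ᵥ Y) := by
    rw [hsym]
  have gb : ∀ w : Fin n → ℝ, (g u *ᵥ w) ⬝ᵥ grad g B u = dvec B u ⬝ᵥ w := fun w => by
    rw [hsym, metric_mulVec_grad hr.metric hu]
  have gn : ∀ w : Fin n → ℝ, (g u *ᵥ w) ⬝ᵥ grad g N u = dvec N u ⬝ᵥ w := fun w => by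
    rw [hsym, metric_mulVec_grad hr.metric hu]
  have bb : dvec B u ⬝ᵥ grad g B u = 2 * Q u := by rw [hQ, gradInner_eq]; ring
  have nn : dvec N u ⬝ᵥ grad g N u = 2 * R u := by rw [hR, gradInner_eq]; ring
  have bn : dvec B u ⬝ᵥ grad g N u = P u + S u := by rw [hPS, gradInner_eq]
  -- Scalar products have been reduced to canonical representatives, so that the final identity is
  -- polynomial in them; next, the Codazzi identities are solved for the covariant derivatives of
  -- `KY` and `LY` along `X`.
  have nb : dvec N u ⬝ᵥ grad g B u = P u + S u := by
    rw [← bn, ← gb, ← gn, hsym]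
  have eK : matDeriv K u X *ᵥ Y + conn g u X *ᵥ K u *ᵥ Y = matDeriv K u Y *ᵥ X +
      conn g u Y *ᵥ K u *ᵥ X + (rot g K L B N u Y *ᵥ K u *ᵥ X - rot g K L B N u X *ᵥ K u *ᵥ Y) := by
    have := cK X Y
    simp only [add_mulVec] at this
    rw [← sub_eq_zero] at this ⊢
    rw [← this]; abel
  have eL : matDeriv L u X *ᵥ Y + conn g u X *ᵥ L u *ᵥ Y = matDeriv L u Y *ᵥ X +
      conn g u Y *ᵥ L u *ᵥ X + (rot g K L B N u Y *ᵥ L u *ᵥ X - rot g K L B N u X *ᵥ L u *ᵥ Y) := by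
    have := cL X Y
    simp only [add_mulVec] at this
    rw [← sub_eq_zero] at this ⊢
    rw [← this]; abel
  rw [eK, eL]
  simp only [add_mulVec, sub_mulVec, zero_mulVec, ← mulVec_mulVec, wedge_mulVec,
    metric_mulVec_grad hr.metric hu, rot_mulVec hr.metric hu, frameFlow, mulVec_add, mulVec_sub,
    mulVec_smul, smul_mulVec, dotProduct_add, dotProduct_sub, dotProduct_smul, add_dotProduct,
    sub_dotProduct, smul_dotProduct, gb, gn, kk, ll, kl, lk1, lk2, bb, nn, bn, nb]
  funext i
  simp only [Pi.add_apply, Pi.sub_apply, Pi.smul_apply, Pi.zero_apply, smul_eq_mul]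
  ring

/-- `C` maps the form `CᵀGC` isometrically to `G`, hence intertwines the rotations of the two forms.
-/
lemma mul_wedge {C G : Matrix (Fin n) (Fin n) ℝ} (a c : Fin n → ℝ) :
    C * wedge (Cᵀ * G * C) a c = wedge G (C *ᵥ a) (C *ᵥ c) * C := by
  simp only [wedge, mul_sub, sub_mul, mul_vecMulVec, vecMulVec_mul, ← mulVec_transpose,
    ← mulVec_mulVec]

/-- The curvature operator of the transformed metric. -/
lemma RecipData.curv_eq (hr : RecipData U g v K L B A N M)
    (hgt : ∀ u ∈ U, gt u = (K u)ᵀ * g u * K u) (hu : u ∈ U)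
    {P Q R S : ScalarField n} (hPS : P u + S u = gradInner g B N u)
    (hQ : Q u = (1 / 2) * gradInner g B B u) (hR : R u = (1 / 2) * gradInner g N N u)
    {lam mu vt : MatField n} (hlam : K u * lam u = frameFlow K L (hess g B) Q S u)
    (hmu : K u * mu u = frameFlow K L (hess g N) P R u) (hvt : K u * vt u = L u)
    (X Y : Fin n → ℝ) : curv (chr gt) u X Y =
      wedge (gt u) (lam u *ᵥ X) Y + wedge (gt u) X (lam u *ᵥ Y) +
      wedge (gt u) (mu u *ᵥ X) (vt u *ᵥ Y) + wedge (gt u) (vt u *ᵥ X) (mu u *ᵥ Y) := by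
  have h1 := hr.curv_gauge hgt hu X Y
  rw [hr.curv_frame hu hPS hQ hR, ← hlam, ← hmu, ← hvt] at h1
  have h2 : K u * curv (chr gt) u X Y = K u * (wedge (gt u) (lam u *ᵥ X) Y +
      wedge (gt u) X (lam u *ᵥ Y) + wedge (gt u) (mu u *ᵥ X) (vt u *ᵥ Y) +
      wedge (gt u) (vt u *ᵥ X) (mu u *ᵥ Y)) := by
    rw [h1, hgt u hu]
    simp only [mul_add, add_mul, mul_wedge, mulVec_mulVec]
  have h3 := congrArg (fun C => (K u)⁻¹ * C) h2
  simpa only [← mul_assoc, nonsing_inv_mul _ (isUnit_iff_ne_zero.2 (hr.detK u hu)), one_mul] using h3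

/-- Raising an index turns a rotation into a bivector; on coordinate vectors this produces the
Kronecker symbols of the curvature expansion. -/
lemma wedge_mul_inv {G : Matrix (Fin n) (Fin n) ℝ} (hG : Gᵀ = G) (hd : IsUnit G.det)
    (a c : Fin n → ℝ) : wedge G a c * G⁻¹ = vecMulVec a c - vecMulVec c a := by
  have h : (G⁻¹)ᵀ = G⁻¹ := by rw [transpose_nonsing_inv, hG]
  simp only [wedge, sub_mul, vecMulVec_mul, ← mulVec_transpose, h, mulVec_mulVec,
    nonsing_inv_mul _ hd, one_mulVec]

lemma curvature_eq_of_curv (hg : IsMetricOn U gt) (hu : u ∈ U) {lam mu vt : MatField n}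
    (h : ∀ X Y, curv (chr gt) u X Y =
      wedge (gt u) (lam u *ᵥ X) Y + wedge (gt u) X (lam u *ᵥ Y) +
      wedge (gt u) (mu u *ᵥ X) (vt u *ᵥ Y) + wedge (gt u) (vt u *ᵥ X) (mu u *ᵥ Y))
    (i j k l : Fin n) : curvature gt i j k l u =
        lam u i k * (1 : Matrix (Fin n) (Fin n) ℝ) j l
          + lam u j l * (1 : Matrix (Fin n) (Fin n) ℝ) i k
          - lam u j k * (1 : Matrix (Fin n) (Fin n) ℝ) i l
          - lam u i l * (1 : Matrix (Fin n) (Fin n) ℝ) j k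
          + mu u i k * vt u j l + mu u j l * vt u i k
          - mu u j k * vt u i l - mu u i l * vt u j k := by
  have hs := (hg.symm u hu).eq
  have h1 : curvature gt i j k l u =
      (curv (chr gt) u (Pi.single k 1) (Pi.single l 1) * (gt u)⁻¹) i j := by
    rw [curvature, mul_apply]
    refine Finset.sum_congr rfl fun s _ => ?_
    have h : ((gt u)⁻¹)ᵀ = (gt u)⁻¹ := by rw [transpose_nonsing_inv, hs]
    rw [riemann_eq_curv, mul_comm, ← congrFun (congrFun h s) j, transpose_apply]
  rw [h1, h]
  simp only [add_mul, wedge_mul_inv hs (hg.isUnit_det hu), Matrix.add_apply, Matrix.sub_apply,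
    vecMulVec_apply, mulVec_single_one, col_apply, one_apply, Pi.single_apply]
  ring

end recip

end

section

variable {n : ℕ} {U : Set (Fin n → ℝ)} {g : MatField n} {u : Fin n → ℝ}

lemma fderiv_eq_of_line {E : Type*} [NormedAddCommGroup E] [NormedSpace ℝ E]
    (hU : IsOpen U) {W : (Fin n → ℝ) → E} (hA : ContDiffOn ℝ ∞ W U) (hu : u ∈ U) {X : Fin n → ℝ}
    {c : ℝ → E} {c' : E} (h : HasDerivAt c c' 0)
    (hc : ∀ t : ℝ, u + t • X ∈ U → W (u + t • X) = c t) : fderiv ℝ W u X = c' :=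
  (hasDerivAt_field_line hU hA hu X).unique
    (h.congr_of_eventuallyEq ((eventually_mem_line hU hu X).mono hc))

lemma smooth_gradInner (hU : IsOpen U) (hg : IsMetricOn U g) {F G : ScalarField n}
    (hF : ContDiffOn ℝ ∞ F U) (hG : ContDiffOn ℝ ∞ G U) : ContDiffOn ℝ ∞ (gradInner g F G) U :=
  (ContDiffOn.vec_dotProduct (smooth_dvec hU hF) (smooth_grad hU hg hG)).congr fun _ _ => gradInner_eq g F G _

lemma gradInner_comm (hg : IsMetricOn U g) (hu : u ∈ U) (F G : ScalarField n) :
    gradInner g F G u = gradInner g G F u := by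
  rw [gradInner_eq, gradInner_eq, ← metric_mulVec_grad hg hu F, metric_dot_comm hg hu,
    metric_mulVec_grad hg hu]

/-- By metric compatibility the covariant derivatives of `dF` and of `∇G` suffice; the connection
terms cancel. In particular `(∇F, ∇G)` is the sum of a flux of `F` along `Hess G` and a flux of `G`
along `Hess F`, when such fluxes exist. -/
lemma fderiv_gradInner (hU : IsOpen U) (hg : IsMetricOn U g) {F G : ScalarField n}
    (hF : ContDiffOn ℝ ∞ F U) (hG : ContDiffOn ℝ ∞ G U) (hu : u ∈ U) (X : Fin n → ℝ) :
    fderiv ℝ (gradInner g F G) u X =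
      dvec F u ⬝ᵥ (hess g G u *ᵥ X) + dvec G u ⬝ᵥ (hess g F u *ᵥ X) := by
  have h := hasDerivAt_dotProduct (hasDerivAt_field_line hU (smooth_dvec hU hF) hu X)
    (hasDerivAt_field_line hU (smooth_grad hU hg hG) hu X)
  rw [fderiv_eq_of_line hU (smooth_gradInner hU hg hF hG) hu h fun _ _ => gradInner_eq g F G _]
  simp only [zero_smul, add_zero]
  have h1 : fderiv ℝ (dvec F) u X = g u *ᵥ (hess g F u *ᵥ X) + (conn g u X)ᵀ *ᵥ dvec F u := by
    rw [hess_lower hU hg hF hu]; abel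
  have h2 : fderiv ℝ (grad g G) u X = hess g G u *ᵥ X - conn g u X *ᵥ grad g G u := by
    rw [hess_mulVec hU hg hG hu]; abel
  rw [h1, h2, add_dotProduct, metric_dot_comm hg hu, metric_mulVec_grad hg hu, dotProduct_sub,
    mulVec_transpose, ← dotProduct_mulVec]
  ring

/-! ### Flows of Codazzi type -/

lemma IsCurveIn.hasDerivAt {c : ℝ → Fin n → ℝ} (hc : IsCurveIn U c) (x : ℝ) :
    HasDerivAt c (deriv c x) x :=
  (hc.smooth.differentiable (by simp) x).hasDerivAt

lemma IsCurveIn.smooth_deriv {c : ℝ → Fin n → ℝ} (hc : IsCurveIn U c) :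
    ContDiff ℝ ∞ (deriv c) :=
  (contDiff_infty_iff_deriv.1 hc.smooth).2

lemma contDiff_flow {c : ℝ → Fin n → ℝ} (hc : IsCurveIn U c) {w : MatField n}
    (hw : MatSmoothOn ∞ w U) : ContDiff ℝ ∞ (flow w c) := by
  rw [← contDiffOn_univ]
  exact (hw.comp hc.smooth.contDiffOn fun x _ => hc.mem x).mulVec hc.smooth_deriv.contDiffOn

lemma hasDerivAt_flow {c : ℝ → Fin n → ℝ} (hU : IsOpen U) (hc : IsCurveIn U c) {w : MatField n}
    (hw : MatSmoothOn ∞ w U) (x : ℝ) : HasDerivAt (flow w c)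
      (matDeriv w (c x) (deriv c x) *ᵥ deriv c x + w (c x) *ᵥ deriv (deriv c) x) x :=
  (hw.hasMatDerivAt hU (hc.hasDerivAt x) (hc.mem x)).mulVec
    (hc.smooth_deriv.differentiable (by simp) x).hasDerivAt

lemma deriv_variation {c V : ℝ → Fin n → ℝ} (hc : Differentiable ℝ c)
    (hV : Differentiable ℝ V) (ε x : ℝ) : deriv (c + ε • V) x = deriv c x + ε • deriv V x := by
  rw [deriv_add (hc x) ((hV x).const_smul ε), deriv_const_smul _ (hV x)]

lemma hasDerivAt_variation_flow {c V : ℝ → Fin n → ℝ} (hU : IsOpen U) (hc : IsCurveIn U c)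
    (hV : Differentiable ℝ V) {w : MatField n} (hw : MatSmoothOn ∞ w U) (x : ℝ) :
    HasDerivAt (fun ε : ℝ => flow w (c + ε • V) x)
      (matDeriv w (c x) (V x) *ᵥ deriv c x + w (c x) *ᵥ deriv V x) 0 := by
  have h : ∀ ε : ℝ, flow w (c + ε • V) x = w (c x + ε • V x) *ᵥ (deriv c x + ε • deriv V x) := by
    intro ε
    rw [flow, deriv_variation (hc.smooth.differentiable (by simp)) hV]
    rfl
  simp only [h]
  have := (hw.line hU (hc.mem x) (V x)).mulVec (hasDerivAt_line (deriv c x) (deriv V x))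
  simpa using this

/-- The terms with `u_xx` cancel because the matrices commute. The Codazzi identities replace
derivatives along `v u_x` and `w u_x` by derivatives along `u_x`; these cancel by differentiating
`vw = wv`, and the connection terms by the absence of torsion. -/
lemma flowsCommute_of_codazzi (hU : IsOpen U) (hg : IsMetricOn U g) {v w : MatField n}
    (hv : MatSmoothOn ∞ v U) (hw : MatSmoothOn ∞ w U) (cv : ∀ u ∈ U, Codazzi (conn g u) v u)
    (cw : ∀ u ∈ U, Codazzi (conn g u) w u) (hvw : ∀ u ∈ U, Commute (v u) (w u)) :
    FlowsCommute U v w := by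
  intro c hc x
  have dv : ∀ {w : MatField n}, MatSmoothOn ∞ w U → Differentiable ℝ (flow w c) := fun hw =>
    (contDiff_flow hc hw).differentiable (by simp)
  have h1 := hasDerivAt_variation_flow hU hc (dv hv) hw x
  have h2 := hasDerivAt_variation_flow hU hc (dv hw) hv x
  rw [(hasDerivAt_flow hU hc hv x).deriv] at h1
  rw [(hasDerivAt_flow hU hc hw x).deriv] at h2
  refine ⟨_, h1, ?_⟩
  convert h2 using 1
  have hx := hc.mem x
  have e1 := cw _ hx (flow v c x) (deriv c x)
  have e2 := cv _ hx (flow w c x) (deriv c x)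
  have e3 : matDeriv v (c x) (deriv c x) * w (c x) + v (c x) * matDeriv w (c x) (deriv c x) =
      matDeriv w (c x) (deriv c x) * v (c x) + w (c x) * matDeriv v (c x) (deriv c x) := by
    rw [← matDeriv_mul hU hv hw hx, ← matDeriv_mul hU hw hv hx]
    exact matDeriv_congr hU hx hvw _
  have e4 := congrArg (fun C => C *ᵥ deriv c x) e3
  have e5 := congrArg (fun C => C *ᵥ deriv (deriv c) x) (hvw _ hx).eq
  have e6 := congrArg (fun C => conn g (c x) (deriv c x) *ᵥ (C *ᵥ deriv c x)) (hvw _ hx).eq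
  have e7 := conn_symm hU hg hx (flow v c x) (flow w c x)
  simp only [flow, add_mulVec, ← mulVec_mulVec, mulVec_add] at e1 e2 e4 e5 e6 e7 ⊢
  funext i
  have c1 := congrFun e1 i
  have c2 := congrFun e2 i
  have c4 := congrFun e4 i
  have c5 := congrFun e5 i
  have c6 := congrFun e6 i
  have c7 := congrFun e7 i
  simp only [Pi.add_apply] at c1 c2 c4 c5 c6 c7 ⊢
  linear_combination c1 - c2 - c4 - c5 - c6 - c7

/-! ### The local part of an operator -/

/-- The local part is the raised covariant derivative of `ξ` along the curve. This is the invariant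
form used from here on. -/
lemma NonlocalOp.localPart_eq {m : ℕ} (J : NonlocalOp n m) (hU : IsOpen U)
    (hg : IsMetricOn U J.metric) {c : ℝ → Fin n → ℝ} (ξ : ℝ → Fin n → ℝ) {x : ℝ} (hx : c x ∈ U) :
    J.localPart c ξ x =
      (J.metric (c x))⁻¹ *ᵥ (deriv ξ x - (conn J.metric (c x) (deriv c x))ᵀ *ᵥ ξ x) := by
  ext i
  rw [mulVec_sub, Pi.sub_apply]
  simp only [NonlocalOp.localPart, mulVec, dotProduct,
    Finset.sum_sub_distrib, transpose_apply, conn_apply, Finset.sum_mul, Finset.mul_sum]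
  congr 1
  rw [Finset.sum_comm]
  refine Finset.sum_congr rfl fun s _ => Finset.sum_congr rfl fun j _ =>
    Finset.sum_congr rfl fun k _ => ?_
  rw [christoffel_symm hU hg hx j s k]
  ring

lemma NonlocalOp.localPart_dvec {m : ℕ} (J : NonlocalOp n m) (hU : IsOpen U)
    (hg : IsMetricOn U J.metric) {c : ℝ → Fin n → ℝ} (hc : IsCurveIn U c) {H : ScalarField n}
    (hH : ContDiffOn ℝ ∞ H U) (x : ℝ) :
    J.localPart c (fun y j => pd j H (c y)) x = hess J.metric H (c x) *ᵥ deriv c x := by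
  have h : deriv (fun y j => pd j H (c y)) x = fderiv ℝ (dvec H) (c x) (deriv c x) :=
    (hasDerivAt_comp_field hU (smooth_dvec hU hH) (hc.hasDerivAt x) (hc.mem x)).deriv
  rw [J.localPart_eq hU hg _ (hc.mem x), h]
  change _ *ᵥ (_ - _ *ᵥ dvec H (c x)) = _
  rw [← hess_lower hU hg hH (hc.mem x), mulVec_mulVec, nonsing_inv_mul _ (hg.isUnit_det (hc.mem x)),
    one_mulVec]

/-- Through each point of an open set passes a curve with a given velocity. -/
lemma exists_curve (hU : IsOpen U) (hu : u ∈ U) (X : Fin n → ℝ) :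
    ∃ (c : ℝ → Fin n → ℝ) (r : ℝ), r ≠ 0 ∧ IsCurveIn U c ∧ c 0 = u ∧ deriv c 0 = r • X := by
  have h0 := eventually_mem_line hU hu X
  obtain ⟨δ, hδ, h⟩ := Metric.eventually_nhds_iff.1 h0
  -- The sine keeps the parameter within `δ / 2 < δ`, so that the curve is defined on the whole line
  -- and stays in `U`; its velocity at `0` is `(δ / 2) X`.
  refine ⟨fun t => u + (δ / 2 * Real.sin t) • X, δ / 2, by positivity, ⟨?_, fun t => h ?_⟩, by simp, ?_⟩
  · exact contDiff_const.add ((contDiff_const.mul Real.contDiff_sin).smul contDiff_const)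
  · rw [Real.dist_eq, sub_zero, abs_mul, abs_of_pos (by positivity)]
    nlinarith [Real.abs_sin_le_one t]
  · have := (((Real.hasDerivAt_sin 0).const_mul (δ / 2)).smul_const X).const_add u
    simpa using this.deriv

/-- The local operator has no tails, so it produces `Hess H u_x` on every curve, and the velocity of
a curve at a point has an arbitrary direction. -/
lemma eq_hess_of_generates (hU : IsOpen U) (hg : IsMetricOn U g) {H : ScalarField n}
    (hH : ContDiffOn ℝ ∞ H U) {w : MatField n} (h : (localOp g).Generates U H w) (hu : u ∈ U) :
    w u = hess g H u := by
  obtain ⟨φ, -, -, h⟩ := h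
  refine ext_mulVec fun X => ?_
  obtain ⟨c, r, hr, hc, h0, h1⟩ := exists_curve hU hu X
  have e := h c hc 0
  rw [NonlocalOp.applyWith, (localOp g).localPart_dvec hU hg hc hH] at e
  simp only [flow, h0, h1, Finset.univ_eq_empty, Finset.sum_empty, add_zero, localOp,
    mulVec_smul] at e
  exact smul_right_injective _ hr e

/-! ### The transformed flows -/

section recip

variable {v K L gt vt w : MatField n} {B A N M E G : ScalarField n}

/-- A conserved density `H` of the flow `v` has a Hessian commuting with `v`, hence with `K` and
`L`, which are combinations of `1` and `v` with scalar coefficients. -/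
lemma RecipData.flowData_hess (hr : RecipData U g v K L B A N M) {H F : ScalarField n}
    (hH : ContDiffOn ℝ ∞ H U) (hF : ContDiffOn ℝ ∞ F U) (hE : ContDiffOn ℝ ∞ E U)
    (hG : ContDiffOn ℝ ∞ G U) (hHF : IsFlux U v H F) (hBE : IsFlux U (hess g H) B E)
    (hNG : IsFlux U (hess g H) N G) : FlowData U g K L B N (hess g H) E G := by
  have hc : ∀ u ∈ U, Commute (v u) (hess g H u) := fun u hu =>
    (hHF.commute_hess hr.isOpen hr.metric hH hF hr.smv hu (hr.codv u hu) (hr.adjv u hu)).symm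
  have d1 : ∀ u ∈ U, (B u * M u - A u * N u) • K u = M u • 1 - N u • v u := fun u hu => by
    rw [← hr.one_eq u hu, ← hr.v_eq u hu]
    simp only [smul_add, smul_smul, sub_smul]
    rw [mul_comm (M u) (N u), mul_comm (M u) (B u), mul_comm (N u) (A u)]
    abel
  have d2 : ∀ u ∈ U, (B u * M u - A u * N u) • L u = B u • v u - A u • 1 := fun u hu => by
    rw [← hr.one_eq u hu, ← hr.v_eq u hu]
    simp only [smul_add, smul_smul, sub_smul]
    rw [mul_comm (A u) (B u)]
    abel
  have d3 : ∀ u ∈ U, ∀ C D : Matrix (Fin n) (Fin n) ℝ,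
      (B u * M u - A u * N u) • C = D → Commute D (hess g H u) → Commute C (hess g H u) := by
    intro u hu C D e hD
    have : C = (B u * M u - A u * N u)⁻¹ • D := by
      rw [← e, smul_smul, inv_mul_cancel₀ (hr.delta u hu), one_smul]
    rw [this]
    exact hD.smul_left _
  exact
  { smw := smooth_hess hr.isOpen hr.metric hH
    smE := hE
    smG := hG
    fluxB := hBE
    fluxN := hNG
    cod := fun u hu => codazzi_hess hr.isOpen hr.metric hH hu (hr.flat u hu)
    adj := fun u hu => selfAdj_hess hr.isOpen hr.metric hH hu
    commK := fun u hu => d3 u hu _ _ (d1 u hu)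
      (((Commute.one_left _).smul_left _).sub_left ((hc u hu).smul_left _))
    commL := fun u hu => d3 u hu _ _ (d2 u hu)
      (((hc u hu).smul_left _).sub_left ((Commute.one_left _).smul_left _)) }

/-- Since `Kw = wK` and `K Ṽ = L`, the product is `w (BK + NL) - EK - GL`, and the bracket is `1`.
-/
lemma mul_newFlow (hr : RecipData U g v K L B A N M) (hw : FlowData U g K L B N w E G)
    (hvt : ∀ u ∈ U, K u * vt u = L u) (hu : u ∈ U) :
    K u * newFlow B N vt w E G u = frameFlow K L w E G u := by
  have h1 : w u = w u * (B u • K u + N u • L u) := by rw [hr.one_eq u hu, mul_one]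
  have h2 : K u * (w u * vt u) = w u * L u := by
    rw [← mul_assoc, (hw.commK u hu).eq, mul_assoc, hvt u hu]
  rw [frameFlow]
  conv_rhs => rw [h1]
  simp only [newFlow, mul_sub, mul_add, Matrix.mul_smul, h2, hvt u hu, mul_one, (hw.commK u hu).eq]
  abel

lemma commute_of_mul {C D V : Matrix (Fin n) (Fin n) ℝ} (hC : IsUnit C.det) (h : Commute C V)
    (hV : Commute V (C * D)) : Commute V D := by
  have e : C * (V * D) = C * (D * V) := by
    rw [← mul_assoc, h.eq, mul_assoc, hV.eq, mul_assoc]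
  have := congrArg (fun X => C⁻¹ * X) e
  simp only [← mul_assoc, nonsing_inv_mul _ hC, one_mul] at this
  exact this

lemma RecipData.smooth_vt (hr : RecipData U g v K L B A N M)
    (hvt : ∀ u ∈ U, K u * vt u = L u) : MatSmoothOn ∞ vt U :=
  ((hr.smK.inv hr.detK).mul hr.smL).congr fun u hu => by
    rw [← hvt u hu, ← mul_assoc, nonsing_inv_mul _ (isUnit_iff_ne_zero.2 (hr.detK u hu)), one_mul]

lemma RecipData.codazzi_vt (hr : RecipData U g v K L B A N M)
    (hgt : ∀ u ∈ U, gt u = (K u)ᵀ * g u * K u) (hvt : ∀ u ∈ U, K u * vt u = L u) (hu : u ∈ U) :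
    Codazzi (conn gt u) vt u :=
  codazzi_gauge hr.isOpen hu hr.smK (hr.smooth_vt hvt) (hr.detK u hu) (hr.conn_eq hgt hu)
    (fun y hy => (hvt y hy).symm) (hr.codazzi_frame hu).2

/-- Carries self-adjointness for `g` in the frame to self-adjointness for the transformed metric. -/
lemma selfAdj_of_mul {G C W Z : Matrix (Fin n) (Fin n) ℝ} (hC : SelfAdj G C) (hZ : SelfAdj G Z)
    (hCW : C * W = Z) (hCZ : Commute C Z) : SelfAdj (Cᵀ * G * C) W := by
  unfold SelfAdj at *
  rw [← mul_assoc, ← mul_assoc, ← transpose_mul, hCW, hZ, mul_assoc (Cᵀ * G), hCW, hC, mul_assoc,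
    ← hCZ.eq, ← mul_assoc]

lemma RecipData.selfAdj_vt (hr : RecipData U g v K L B A N M)
    (hgt : ∀ u ∈ U, gt u = (K u)ᵀ * g u * K u) (hvt : ∀ u ∈ U, K u * vt u = L u) (hu : u ∈ U) :
    SelfAdj (gt u) (vt u) := by
  rw [hgt u hu]
  exact selfAdj_of_mul (hr.adjK u hu) (hr.adjL u hu) (hvt u hu) (hr.commKL u hu)

lemma selfAdj_newFlow (hr : RecipData U g v K L B A N M) (hw : FlowData U g K L B N w E G)
    (hgt : ∀ u ∈ U, gt u = (K u)ᵀ * g u * K u) (hvt : ∀ u ∈ U, K u * vt u = L u) (hu : u ∈ U) :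
    SelfAdj (gt u) (newFlow B N vt w E G u) := by
  rw [hgt u hu]
  refine selfAdj_of_mul (hr.adjK u hu) (((hw.adj u hu).sub ((hr.adjK u hu).smul _)).sub
    ((hr.adjL u hu).smul _)) (mul_newFlow hr hw hvt hu) ?_
  exact ((hw.commK u hu).sub_right ((Commute.refl _).smul_right _)).sub_right
    ((hr.commKL u hu).smul_right _)

lemma commute_vt_flow (hr : RecipData U g v K L B A N M) (hw : FlowData U g K L B N w E G)
    (hvt : ∀ u ∈ U, K u * vt u = L u) (hu : u ∈ U) : Commute (vt u) (w u) :=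
  (commute_of_mul (isUnit_iff_ne_zero.2 (hr.detK u hu)) (hw.commK u hu)
    (by rw [hvt u hu]; exact (hw.commL u hu).symm)).symm

lemma commute_vt_newFlow (hr : RecipData U g v K L B A N M) (hw : FlowData U g K L B N w E G)
    (hvt : ∀ u ∈ U, K u * vt u = L u) (hu : u ∈ U) : Commute (vt u) (newFlow B N vt w E G u) := by
  have h := commute_vt_flow hr hw hvt hu
  exact (((h.smul_right _).sub_right ((Commute.one_right _).smul_right _)).add_right
    ((h.mul_right (Commute.refl _)).smul_right _)).sub_right ((Commute.refl _).smul_right _)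

lemma commute_newFlow (hr : RecipData U g v K L B A N M) (hw : FlowData U g K L B N w E G)
    {w' : MatField n} {E' G' : ScalarField n} (hw' : FlowData U g K L B N w' E' G')
    (hvt : ∀ u ∈ U, K u * vt u = L u) (hu : u ∈ U) (h : Commute (w u) (w' u)) :
    Commute (newFlow B N vt w E G u) (newFlow B N vt w' E' G' u) := by
  have h1 := commute_vt_newFlow hr hw' hvt hu
  have h2 := commute_vt_flow hr hw hvt hu
  have h3 : Commute (w u) (newFlow B N vt w' E' G' u) :=
    (((h.smul_right _).sub_right ((Commute.one_right _).smul_right _)).add_right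
      ((h.mul_right h2.symm).smul_right _)).sub_right (h2.symm.smul_right _)
  exact (((h3.smul_left _).sub_left ((Commute.one_left _).smul_left _)).add_left
    ((h3.mul_left h1).smul_left _)).sub_left (h1.smul_left _)

lemma smooth_newFlow (hr : RecipData U g v K L B A N M) (hw : FlowData U g K L B N w E G)
    (hvt : ∀ u ∈ U, K u * vt u = L u) : MatSmoothOn ∞ (newFlow B N vt w E G) U := by
  have sv := hr.smooth_vt hvt
  exact (((MatSmoothOn.smul hr.smB hw.smw).sub (MatSmoothOn.smul hw.smE (MatSmoothOn.const 1))).add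
    (MatSmoothOn.smul hr.smN (hw.smw.mul sv))).sub (MatSmoothOn.smul hw.smG sv)

lemma codazzi_newFlow (hr : RecipData U g v K L B A N M) (hw : FlowData U g K L B N w E G)
    (hgt : ∀ u ∈ U, gt u = (K u)ᵀ * g u * K u) (hvt : ∀ u ∈ U, K u * vt u = L u) (hu : u ∈ U) :
    Codazzi (conn gt u) (newFlow B N vt w E G) u :=
  codazzi_gauge hr.isOpen hu hr.smK (smooth_newFlow hr hw hvt) (hr.detK u hu) (hr.conn_eq hgt hu)
    (fun _ hy => (mul_newFlow hr hw hvt hy).symm) (hr.codazzi_frameFlow hw hu)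

end recip

end

section

variable {n : ℕ} {U : Set (Fin n → ℝ)} {g : MatField n} {u : Fin n → ℝ}

/-! ### Transformed densities -/

section recip

variable {v K L gt vt lam mu : MatField n} {B A N M P Q R S H F E G : ScalarField n}

/-- The density of the transform of a conservation law. -/
def newDensity (B A N M H F : ScalarField n) : ScalarField n := fun u =>
  (H u * M u - F u * N u) / (B u * M u - A u * N u)

/-- The flux of the transform of a conservation law. -/
def newFlux (B A N M H F : ScalarField n) : ScalarField n := fun u =>
  (B u * F u - A u * H u) / (B u * M u - A u * N u)

lemma RecipData.smooth_newDensity (hr : RecipData U g v K L B A N M) (hH : ContDiffOn ℝ ∞ H U)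
    (hF : ContDiffOn ℝ ∞ F U) : ContDiffOn ℝ ∞ (newDensity B A N M H F) U :=
  ((hH.mul hr.smM).sub (hF.mul hr.smN)).div ((hr.smB.mul hr.smM).sub (hr.smA.mul hr.smN)) hr.delta

lemma RecipData.smooth_newFlux (hr : RecipData U g v K L B A N M) (hH : ContDiffOn ℝ ∞ H U)
    (hF : ContDiffOn ℝ ∞ F U) : ContDiffOn ℝ ∞ (newFlux B A N M H F) U :=
  ((hr.smB.mul hF).sub (hr.smA.mul hH)).div ((hr.smB.mul hr.smM).sub (hr.smA.mul hr.smN)) hr.delta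

/-- Comparison of coefficients in `H dx + F dt = H̃ dX + F̃ dT`; the definitions of `H̃` and `F̃`
are Cramer's rule. -/
lemma RecipData.density_eq (hr : RecipData U g v K L B A N M) (hu : u ∈ U) (H F : ScalarField n) :
    H u = newDensity B A N M H F u * B u + newFlux B A N M H F u * N u ∧
    F u = newDensity B A N M H F u * A u + newFlux B A N M H F u * M u := by
  have := hr.delta u hu
  unfold newDensity newFlux
  constructor <;>
  · rw [div_mul_eq_mul_div, div_mul_eq_mul_div, ← add_div, eq_div_iff this]
    ring

/-- The differential of a conserved density, relative to the differentials of `B` and `N`. -/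
def relDiff (B A N M H F : ScalarField n) (u : Fin n → ℝ) : Fin n → ℝ :=
  dvec H u - newDensity B A N M H F u • dvec B u - newFlux B A N M H F u • dvec N u

lemma fderiv_mul_add_mul (hU : IsOpen U) {a b c d f : ScalarField n} (ha : ContDiffOn ℝ ∞ a U)
    (hb : ContDiffOn ℝ ∞ b U) (hc : ContDiffOn ℝ ∞ c U) (hd : ContDiffOn ℝ ∞ d U)
    (hf : ContDiffOn ℝ ∞ f U) (h : ∀ y ∈ U, f y = a y * b y + c y * d y) (hu : u ∈ U)
    (X : Fin n → ℝ) : fderiv ℝ f u X = fderiv ℝ a u X * b u + a u * fderiv ℝ b u X +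
      (fderiv ℝ c u X * d u + c u * fderiv ℝ d u X) := by
  have e := ((hasDerivAt_field_line hU ha hu X).mul (hasDerivAt_field_line hU hb hu X)).add
    ((hasDerivAt_field_line hU hc hu X).mul (hasDerivAt_field_line hU hd hu X))
  simpa using fderiv_eq_of_line hU hf hu e fun t ht => h _ ht

lemma RecipData.frame_eq (hr : RecipData U g v K L B A N M) (hu : u ∈ U) :
    (B u * M u - A u * N u) • K u = M u • 1 - N u • v u ∧
    (B u * M u - A u * N u) • L u = B u • v u - A u • 1 := by
  rw [← hr.one_eq u hu, ← hr.v_eq u hu]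
  simp only [smul_add, smul_smul, sub_smul]
  constructor
  · rw [mul_comm (M u) (N u), mul_comm (M u) (B u), mul_comm (N u) (A u)]
    abel
  · rw [mul_comm (A u) (B u)]
    abel

/-- With `θ = relDiff`, differentiating `RecipData.density_eq` gives `B dH̃ + N dF̃ = θ` and, by the
flux identities, `A dH̃ + M dF̃ = θ ∘ v`. Solving this system reproduces the matrices `K` and `L`.
-/
lemma RecipData.fderiv_newDensity (hr : RecipData U g v K L B A N M) (hH : ContDiffOn ℝ ∞ H U)
    (hF : ContDiffOn ℝ ∞ F U) (hHF : IsFlux U v H F) (hu : u ∈ U) (X : Fin n → ℝ) :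
    fderiv ℝ (newDensity B A N M H F) u X = relDiff B A N M H F u ⬝ᵥ (K u *ᵥ X) ∧
    fderiv ℝ (newFlux B A N M H F) u X = relDiff B A N M H F u ⬝ᵥ (L u *ᵥ X) := by
  have s1 := hr.smooth_newDensity hH hF
  have s2 := hr.smooth_newFlux hH hF
  have e1 := fderiv_mul_add_mul hr.isOpen s1 hr.smB s2 hr.smN hH
    (fun y hy => (hr.density_eq hy H F).1) hu X
  have e2 := fderiv_mul_add_mul hr.isOpen s1 hr.smA s2 hr.smM hF
    (fun y hy => (hr.density_eq hy H F).2) hu X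
  have f1 := hr.fluxB.fderiv_eq hu X
  have f2 := hr.fluxN.fderiv_eq hu X
  have f3 := hHF.fderiv_eq hu X
  have d1 := congrArg (fun C => relDiff B A N M H F u ⬝ᵥ (C *ᵥ X)) (hr.frame_eq hu).1
  have d2 := congrArg (fun C => relDiff B A N M H F u ⬝ᵥ (C *ᵥ X)) (hr.frame_eq hu).2
  have r : ∀ Y, relDiff B A N M H F u ⬝ᵥ Y = dvec H u ⬝ᵥ Y -
      newDensity B A N M H F u * (dvec B u ⬝ᵥ Y) - newFlux B A N M H F u * (dvec N u ⬝ᵥ Y) := by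
    intro Y
    simp only [relDiff, sub_dotProduct, smul_dotProduct, smul_eq_mul]
  simp only [smul_mulVec, sub_mulVec, one_mulVec, dotProduct_smul, dotProduct_sub, smul_eq_mul,
    r X, r (v u *ᵥ X)] at d1 d2
  rw [fderiv_eq_dvec H, fderiv_eq_dvec B, fderiv_eq_dvec N] at e1
  rw [f1, f2, f3] at d1 d2
  constructor
  · refine mul_left_cancel₀ (hr.delta u hu) ?_
    linear_combination -d1 - M u * e1 + N u * e2
  · refine mul_left_cancel₀ (hr.delta u hu) ?_
    linear_combination -d2 - B u * e2 + A u * e1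

/-- The vector field with the differential `relDiff`. -/
def relGrad (g : MatField n) (B A N M H F : ScalarField n) (u : Fin n → ℝ) : Fin n → ℝ :=
  grad g H u - newDensity B A N M H F u • grad g B u - newFlux B A N M H F u • grad g N u

lemma RecipData.metric_mulVec_relGrad (hr : RecipData U g v K L B A N M) (hu : u ∈ U)
    (H F : ScalarField n) : g u *ᵥ relGrad g B A N M H F u = relDiff B A N M H F u := by
  simp only [relGrad, relDiff, mulVec_sub, mulVec_smul, metric_mulVec_grad hr.metric hu]

/-- The differential of `H̃` is `Kᵀ g relGrad`, and the metric is `KᵀgK`; cancel `Kᵀ` and `g`. -/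
lemma RecipData.mulVec_grad_newDensity (hr : RecipData U g v K L B A N M)
    (hgt : ∀ u ∈ U, gt u = (K u)ᵀ * g u * K u) (hH : ContDiffOn ℝ ∞ H U)
    (hF : ContDiffOn ℝ ∞ F U) (hHF : IsFlux U v H F) (hu : u ∈ U) :
    K u *ᵥ grad gt (newDensity B A N M H F) u = relGrad g B A N M H F u := by
  have hK : IsUnit (K u).det := isUnit_iff_ne_zero.2 (hr.detK u hu)
  have h1 : dvec (newDensity B A N M H F) u = (K u)ᵀ *ᵥ g u *ᵥ relGrad g B A N M H F u := by
    ext j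
    have := (hr.fderiv_newDensity hH hF hHF hu (Pi.single j 1)).1
    rw [fderiv_eq_dvec, ← hr.metric_mulVec_relGrad hu, dotProduct_mulVec, ← mulVec_transpose] at this
    simpa using this
  have h2 : (K u)ᵀ *ᵥ (g u *ᵥ (K u *ᵥ grad gt (newDensity B A N M H F) u)) =
      (K u)ᵀ *ᵥ g u *ᵥ relGrad g B A N M H F u := by
    rw [← h1, ← metric_mulVec_grad (hr.isMetricOn hgt) hu, hgt u hu, mulVec_mulVec, mulVec_mulVec,
      mul_assoc]
  have h3 := congrArg (fun y => (g u)⁻¹ *ᵥ ((K u)ᵀ)⁻¹ *ᵥ y) h2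
  have hK' : IsUnit ((K u)ᵀ).det := by rwa [det_transpose]
  simpa only [mulVec_mulVec, ← mul_assoc, mul_assoc (g u)⁻¹ _ (K u)ᵀ, nonsing_inv_mul _ hK',
    nonsing_inv_mul _ (hr.metric.isUnit_det hu), mul_one, one_mul, one_mulVec] using h3

lemma RecipData.smooth_relGrad (hr : RecipData U g v K L B A N M) (hH : ContDiffOn ℝ ∞ H U)
    (hF : ContDiffOn ℝ ∞ F U) : ContDiffOn ℝ ∞ (relGrad g B A N M H F) U :=
  ((smooth_grad hr.isOpen hr.metric hH).sub ((hr.smooth_newDensity hH hF).smul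
    (smooth_grad hr.isOpen hr.metric hr.smB))).sub ((hr.smooth_newFlux hH hF).smul
    (smooth_grad hr.isOpen hr.metric hr.smN))

lemma RecipData.fderiv_relGrad (hr : RecipData U g v K L B A N M) (hH : ContDiffOn ℝ ∞ H U)
    (hF : ContDiffOn ℝ ∞ F U) (hu : u ∈ U) (X : Fin n → ℝ) :
    fderiv ℝ (relGrad g B A N M H F) u X + conn g u X *ᵥ relGrad g B A N M H F u =
      hess g H u *ᵥ X - newDensity B A N M H F u • hess g B u *ᵥ X -
      newFlux B A N M H F u • hess g N u *ᵥ X -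
      fderiv ℝ (newDensity B A N M H F) u X • grad g B u -
      fderiv ℝ (newFlux B A N M H F) u X • grad g N u := by
  have gl : ∀ {W : ScalarField n}, ContDiffOn ℝ ∞ W U → HasDerivAt (fun t : ℝ =>
      grad g W (u + t • X)) (fderiv ℝ (grad g W) u X) 0 := fun hW =>
    hasDerivAt_field_line hr.isOpen (smooth_grad hr.isOpen hr.metric hW) hu X
  have e := ((gl hH).sub ((hasDerivAt_field_line hr.isOpen (hr.smooth_newDensity hH hF) hu X).smul
    (gl hr.smB))).sub ((hasDerivAt_field_line hr.isOpen (hr.smooth_newFlux hH hF) hu X).smul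
    (gl hr.smN))
  rw [fderiv_eq_of_line hr.isOpen (hr.smooth_relGrad hH hF) hu e fun _ _ => rfl,
    hess_mulVec hr.isOpen hr.metric hH hu, hess_mulVec hr.isOpen hr.metric hr.smB hu,
    hess_mulVec hr.isOpen hr.metric hr.smN hu]
  simp only [zero_smul, add_zero, relGrad, mulVec_sub, mulVec_smul, smul_add]
  abel

/-- The Hessian of the transformed density. -/
lemma RecipData.mul_hess_newDensity (hr : RecipData U g v K L B A N M)
    (hgt : ∀ u ∈ U, gt u = (K u)ᵀ * g u * K u) (hH : ContDiffOn ℝ ∞ H U)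
    (hF : ContDiffOn ℝ ∞ F U) (hHF : IsFlux U v H F) (hu : u ∈ U) (X : Fin n → ℝ) :
    K u *ᵥ hess gt (newDensity B A N M H F) u *ᵥ X =
      hess g H u *ᵥ X - newDensity B A N M H F u • hess g B u *ᵥ X -
      newFlux B A N M H F u • hess g N u *ᵥ X -
      (dvec B u ⬝ᵥ relGrad g B A N M H F u) • K u *ᵥ X -
      (dvec N u ⬝ᵥ relGrad g B A N M H F u) • L u *ᵥ X := by
  have hm := hr.isMetricOn hgt
  have s := smooth_grad hr.isOpen hm (hr.smooth_newDensity hH hF)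
  have e := (hr.smK.line hr.isOpen hu X).mulVec (hasDerivAt_field_line hr.isOpen s hu X)
  have e1 := fderiv_eq_of_line hr.isOpen (hr.smooth_relGrad hH hF) hu e fun t ht =>
    (hr.mulVec_grad_newDensity hgt hH hF hHF ht).symm
  simp only [zero_smul, add_zero] at e1
  have e2 := hr.fderiv_relGrad hH hF hu X
  rw [hess_mulVec hr.isOpen hm (hr.smooth_newDensity hH hF) hu, mulVec_add, mulVec_mulVec _ (K u)
    (conn gt u X), hr.conn_eq hgt hu, add_mulVec, ← mulVec_mulVec,
    hr.mulVec_grad_newDensity hgt hH hF hHF hu]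
  rw [e1] at e2
  have gk : ∀ Y : Fin n → ℝ, (g u *ᵥ Y) ⬝ᵥ relGrad g B A N M H F u =
      relDiff B A N M H F u ⬝ᵥ Y := fun Y => by
    rw [metric_dot_comm hr.metric hu, hr.metric_mulVec_relGrad hu]
  -- The rotation of `relGrad` contributes `dH̃(X) ∇B + dF̃(X) ∇N`, which cancels the derivatives of
  -- the coefficients in `RecipData.fderiv_relGrad`. Only the multiples of `KX` and `LX` survive.
  have e3 := rot_mulVec hr.metric hu K L B N X (relGrad g B A N M H F u)
  rw [gk, gk, ← (hr.fderiv_newDensity hH hF hHF hu X).1,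
    ← (hr.fderiv_newDensity hH hF hHF hu X).2] at e3
  rw [add_mulVec, e3]
  funext i
  have c2 := congrFun e2 i
  simp only [Pi.add_apply, Pi.sub_apply, Pi.smul_apply, smul_eq_mul] at c2 ⊢
  linear_combination c2

/-- After multiplication by `K` both sides are combinations of the Hessians of `H`, `B`, `N` and of
`K`, `L`. The tails with `λ` and `μ` restore the Hessians of `B` and `N` subtracted in the Hessian
of `H̃`; the tails with `1` and `Ṽ` adjust the coefficients of `K` and `L` to `-E` and `-G`. -/
lemma RecipData.generates_newFlow (hr : RecipData U g v K L B A N M)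
    (hgt : ∀ u ∈ U, gt u = (K u)ᵀ * g u * K u) (hvt : ∀ u ∈ U, K u * vt u = L u)
    (hwB : FlowData U g K L B N (hess g B) Q S) (hwN : FlowData U g K L B N (hess g N) P R)
    (hPS : ∀ u ∈ U, P u + S u = gradInner g B N u)
    (hQ : ∀ u, Q u = (1 / 2) * gradInner g B B u)
    (hR : ∀ u, R u = (1 / 2) * gradInner g N N u)
    (hlam : lam = newFlow B N vt (hess g B) Q S) (hmu : mu = newFlow B N vt (hess g N) P R)
    (hH : ContDiffOn ℝ ∞ H U) (hF : ContDiffOn ℝ ∞ F U) (hHF : IsFlux U v H F)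
    {w : MatField n} (hw : FlowData U g K L B N w E G) (hwH : ∀ u ∈ U, w u = hess g H u) :
    (fourTailOp gt lam mu vt).Generates U (newDensity B A N M H F) (newFlow B N vt w E G) := by
  have hm := hr.isMetricOn hgt
  have sD := hr.smooth_newDensity hH hF
  have sF := hr.smooth_newFlux hH hF
  have sHB := smooth_gradInner hr.isOpen hr.metric hr.smB hH
  have sHN := smooth_gradInner hr.isOpen hr.metric hr.smN hH
  have kl : ∀ u ∈ U, K u * lam u = frameFlow K L (hess g B) Q S u := fun u hu => by
    rw [hlam]; exact mul_newFlow hr hwB hvt hu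
  have km : ∀ u ∈ U, K u * mu u = frameFlow K L (hess g N) P R u := fun u hu => by
    rw [hmu]; exact mul_newFlow hr hwN hvt hu
  have aux : ∀ {W Z V Y f : ScalarField n}, ContDiffOn ℝ ∞ W U → ContDiffOn ℝ ∞ Z U →
      ContDiffOn ℝ ∞ V U → ContDiffOn ℝ ∞ Y U → ContDiffOn ℝ ∞ f U →
      ContDiffOn ℝ ∞ (fun u => f u - W u * Z u - V u * Y u) U := fun h1 h2 h3 h4 h5 =>
    (h5.sub (h1.mul h2)).sub (h3.mul h4)
  -- Since `E` is a flux of `B` along `Hess H`, the function `(∇B, ∇H) - E` is a flux of `H` along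
  -- `Hess B`. Subtracting `H̃` times the flux `Q` of `B` and `F̃` times the flux `S` of `N` gives
  -- the flux of `H̃` along `λ`; likewise below for `μ`.
  set φB : ScalarField n := fun u => (gradInner g B H u - E u) -
    newDensity B A N M H F u * Q u - newFlux B A N M H F u * S u with hφB
  set φN : ScalarField n := fun u => (gradInner g N H u - G u) -
    newDensity B A N M H F u * P u - newFlux B A N M H F u * R u with hφN
  have sB : ContDiffOn ℝ ∞ φB U := aux sD hwB.smE sF hwB.smG (sHB.sub hw.smE)
  have sN : ContDiffOn ℝ ∞ φN U := aux sD hwN.smE sF hwN.smG (sHN.sub hw.smG)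
  have daux : ∀ {W Z V Y f f' : ScalarField n}, ContDiffOn ℝ ∞ W U → ContDiffOn ℝ ∞ Z U →
      ContDiffOn ℝ ∞ V U → ContDiffOn ℝ ∞ Y U → ContDiffOn ℝ ∞ f U → ContDiffOn ℝ ∞ f' U →
      ∀ u ∈ U, ∀ X, fderiv ℝ (fun u => (f u - f' u) - W u * Z u - V u * Y u) u X =
        fderiv ℝ f u X - fderiv ℝ f' u X - (fderiv ℝ W u X * Z u + W u * fderiv ℝ Z u X) -
        (fderiv ℝ V u X * Y u + V u * fderiv ℝ Y u X) := by
    intro W Z V Y f f' h1 h2 h3 h4 h5 h6 u hu X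
    have l : ∀ {W : ScalarField n}, ContDiffOn ℝ ∞ W U → HasDerivAt (fun t : ℝ =>
      W (u + t • X)) (fderiv ℝ W u X) 0 := fun hW => hasDerivAt_field_line hr.isOpen hW hu X
    have e := (((l h5).sub (l h6)).sub ((l h1).mul (l h2))).sub ((l h3).mul (l h4))
    simpa using fderiv_eq_of_line hr.isOpen (aux h1 h2 h3 h4 (h5.sub h6)) hu e fun _ _ => rfl
  have rel : ∀ u Y, relDiff B A N M H F u ⬝ᵥ Y = dvec H u ⬝ᵥ Y -
      newDensity B A N M H F u * (dvec B u ⬝ᵥ Y) - newFlux B A N M H F u * (dvec N u ⬝ᵥ Y) := by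
    intro u Y
    simp only [relDiff, sub_dotProduct, smul_dotProduct, smul_eq_mul]
  have main : ∀ u ∈ U, ∀ Y, dvec (newDensity B A N M H F) u ⬝ᵥ Y =
      relDiff B A N M H F u ⬝ᵥ (K u *ᵥ Y) := fun u hu Y => by
    rw [← fderiv_eq_dvec, (hr.fderiv_newDensity hH hF hHF hu Y).1]
  have fl : ∀ {f e C D : ScalarField n} {W : MatField n}, ContDiffOn ℝ ∞ f U →
      ContDiffOn ℝ ∞ e U → FlowData U g K L B N (hess g f) C D →
      (∀ u ∈ U, K u * W u = frameFlow K L (hess g f) C D u) → IsFlux U w f e →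
      IsFlux U W (newDensity B A N M H F) (fun u => (gradInner g f H u - e u) -
        newDensity B A N M H F u * C u - newFlux B A N M H F u * D u) := by
    intro f e C D W hf he hfl hK hwf
    refine isFlux_of_fderiv fun u hu X => ?_
    rw [daux sD hfl.smE sF hfl.smG (smooth_gradInner hr.isOpen hr.metric hf hH) he u hu,
      fderiv_gradInner hr.isOpen hr.metric hf hH hu, ← hwf.fderiv_eq hu, hwH u hu,
      ← hfl.fluxB.fderiv_eq hu, ← hfl.fluxN.fderiv_eq hu, main u hu, mulVec_mulVec, hK u hu,
      (hr.fderiv_newDensity hH hF hHF hu X).1, (hr.fderiv_newDensity hH hF hHF hu X).2]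
    simp only [frameFlow, sub_mulVec, smul_mulVec, dotProduct_sub, dotProduct_smul, smul_eq_mul,
      rel]
    ring
  refine ⟨![newDensity B A N M H F, φB, newFlux B A N M H F, φN], ?_, ?_, ?_⟩
  · intro α
    fin_cases α
    exacts [sD, sB, sF, sN]
  · intro α
    fin_cases α
    · refine isFlux_of_fderiv fun u hu X => ?_
      change dvec (newDensity B A N M H F) u ⬝ᵥ ((1 : Matrix (Fin n) (Fin n) ℝ) *ᵥ X) = _
      rw [one_mulVec, ← fderiv_eq_dvec]
      rfl
    · exact fl hr.smB hw.smE hwB kl hw.fluxB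
    · refine isFlux_of_fderiv fun u hu X => ?_
      change dvec (newDensity B A N M H F) u ⬝ᵥ (vt u *ᵥ X) =
        fderiv ℝ (newFlux B A N M H F) u X
      rw [main u hu, mulVec_mulVec, hvt u hu, (hr.fderiv_newDensity hH hF hHF hu X).2]
    · exact fl hr.smN hw.smG hwN km hw.fluxN
  · intro c hc x
    rw [NonlocalOp.applyWith, NonlocalOp.localPart_dvec _ hr.isOpen hm hc sD]
    have hx := hc.mem x
    simp only [Fin.sum_univ_four, fourTailOp, flow]
    change newFlow B N vt w E G (c x) *ᵥ deriv c x = hess gt (newDensity B A N M H F) (c x) *ᵥ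
      deriv c x + (newDensity B A N M H F (c x) • lam (c x) *ᵥ deriv c x +
      φB (c x) • (1 : Matrix (Fin n) (Fin n) ℝ) *ᵥ deriv c x +
      newFlux B A N M H F (c x) • mu (c x) *ᵥ deriv c x + φN (c x) • vt (c x) *ᵥ deriv c x)
    generalize deriv c x = X at *
    generalize c x = u at *
    have hK : IsUnit (K u).det := isUnit_iff_ne_zero.2 (hr.detK u hx)
    refine mulVec_injective_of_isUnit ((Matrix.isUnit_iff_isUnit_det _).2 hK) ?_
    have hX := hr.mul_hess_newDensity hgt hH hF hHF hx X
    -- Of the multiple `2Q` of `H̃`, one half is cancelled by the tail with `λ` and the other by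
    -- `φB`. The multiple `P + S` of `F̃` is shared by the tail with `μ` and `φB`.
    have b1 : dvec B u ⬝ᵥ relGrad g B A N M H F u = gradInner g B H u -
        newDensity B A N M H F u * (2 * Q u) - newFlux B A N M H F u * (P u + S u) := by
      rw [hPS u hx, hQ, gradInner_eq, gradInner_eq, gradInner_eq]
      simp only [relGrad, dotProduct_sub, dotProduct_smul, smul_eq_mul]
      ring
    have n1 : dvec N u ⬝ᵥ relGrad g B A N M H F u = gradInner g N H u -
        newDensity B A N M H F u * (P u + S u) - newFlux B A N M H F u * (2 * R u) := by
      rw [hPS u hx, hR, gradInner_comm hr.metric hx B N, gradInner_eq, gradInner_eq, gradInner_eq]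
      simp only [relGrad, dotProduct_sub, dotProduct_smul, smul_eq_mul]
      ring
    simp only [mulVec_add, mulVec_smul, hX, b1, n1, one_mulVec]
    rw [mulVec_mulVec, mul_newFlow hr hw hvt hx, mulVec_mulVec, kl u hx, mulVec_mulVec, km u hx,
      mulVec_mulVec, hvt u hx]
    simp only [frameFlow, sub_mulVec, smul_mulVec, hwH u hx, hφB, hφN]
    funext i
    simp only [Pi.add_apply, Pi.sub_apply, Pi.smul_apply, smul_eq_mul]
    ring

/-- Fluxes are determined up to constants. Increasing the last one by `1` adds the last left factor,
which is `J₄`, to the generated flow. -/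
lemma generates_add_tail {J₁ J₂ J₃ J₄ w w' : MatField n}
    (h : (fourTailOp J₁ J₂ J₃ J₄).Generates U H w) (hw : ∀ u ∈ U, w' u = w u + J₄ u) :
    (fourTailOp J₁ J₂ J₃ J₄).Generates U H w' := by
  obtain ⟨φ, h1, h2, h3⟩ := h
  refine ⟨fun α u => φ α u + if α = 3 then 1 else 0, fun α => (h1 α).add contDiffOn_const,
    fun α u hu j => ?_, fun c hc x => ?_⟩
  · rw [h2 α u hu j, pd, pd, fderiv_add_const]
  · have e := h3 c hc x
    simp only [flow, NonlocalOp.applyWith, add_smul, Finset.sum_add_distrib, ite_smul, one_smul,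
      zero_smul, Finset.sum_ite_eq', Finset.mem_univ, if_true] at e ⊢
    rw [hw _ (hc.mem x), add_mulVec, e, add_assoc]
    rfl

end recip

end

/-! ### Change of the independent variables; the reciprocal data -/

section

variable {n : ℕ} {U : Set (Fin n → ℝ)} {g : MatField n} {u : Fin n → ℝ}

section recip

variable {v K L gt vt lam mu : MatField n} {B A N M P Q R S H F E G : ScalarField n}

lemma hasDerivAt_coord_line {m : ℕ} {F : Type*} [NormedAddCommGroup F] [NormedSpace ℝ F]
    {f : (Fin m → ℝ) → F} {p : Fin m → ℝ} (hf : DifferentiableAt ℝ f p) (k : Fin m) :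
    HasDerivAt (fun s : ℝ => f (p + s • Pi.single k 1)) (pd k f p) 0 := by
  have hf' : DifferentiableAt ℝ f (p + (0 : ℝ) • Pi.single k 1) := by simpa using hf
  have h := hf'.hasFDerivAt.comp_hasDerivAt (0 : ℝ) (hasDerivAt_line p (Pi.single k 1))
  rw [zero_smul, add_zero] at h
  exact h

/-- The chain rule for the change of the independent variables. -/
lemma pd_reciprocal {Ω : Set (Fin 4 → ℝ)} {c ct : (Fin 4 → ℝ) → Fin n → ℝ}
    {X T : (Fin 4 → ℝ) → ℝ} (hΩ : IsOpen Ω) (hc : DifferentiableOn ℝ c Ω)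
    (hX : DifferentiableOn ℝ X Ω) (hT : DifferentiableOn ℝ T Ω)
    (h : ∀ p ∈ Ω, DifferentiableAt ℝ ct ![X p, T p, p 2, p 3] ∧ c p = ct ![X p, T p, p 2, p 3])
    {p : Fin 4 → ℝ} (hp : p ∈ Ω) (k : Fin 4) :
    pd k c p = pd k X p • pd 0 ct ![X p, T p, p 2, p 3] + pd k T p • pd 1 ct ![X p, T p, p 2, p 3] +
      (Pi.single k 1 : Fin 4 → ℝ) 2 • pd 2 ct ![X p, T p, p 2, p 3] +
      (Pi.single k 1 : Fin 4 → ℝ) 3 • pd 3 ct ![X p, T p, p 2, p 3] := by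
  have hn := hΩ.mem_nhds hp
  have d1 := hasDerivAt_coord_line ((hc p hp).differentiableAt hn) k
  have dX := hasDerivAt_coord_line ((hX p hp).differentiableAt hn) k
  have dT := hasDerivAt_coord_line ((hT p hp).differentiableAt hn) k
  have dl := hasDerivAt_pi.1 (hasDerivAt_line p (Pi.single k 1))
  have dΦ : HasDerivAt (fun s : ℝ => (![X (p + s • Pi.single k 1), T (p + s • Pi.single k 1),
      (p + s • (Pi.single k 1 : Fin 4 → ℝ)) 2, (p + s • (Pi.single k 1 : Fin 4 → ℝ)) 3] :
      Fin 4 → ℝ)) ![pd k X p, pd k T p, (Pi.single k 1 : Fin 4 → ℝ) 2,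
      (Pi.single k 1 : Fin 4 → ℝ) 3] 0 := by
    rw [hasDerivAt_pi]
    intro i
    fin_cases i
    exacts [dX, dT, dl 2, dl 3]
  have h0 : p + (0 : ℝ) • (Pi.single k 1 : Fin 4 → ℝ) = p := by simp
  have hd := (h p hp).1
  have d2 := (HasFDerivAt.comp_hasDerivAt (x := (0 : ℝ)) (by rw [h0]; exact hd.hasFDerivAt) dΦ)
  have hev : ∀ᶠ s : ℝ in nhds 0, p + s • (Pi.single k 1 : Fin 4 → ℝ) ∈ Ω :=
    (hasDerivAt_line p _).continuousAt.eventually_mem (by rw [h0]; exact hn)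
  have e := d1.unique (d2.congr_of_eventuallyEq (hev.mono fun s hs => (h _ hs).2))
  rw [e, fderiv_eq_sum_pd, Fin.sum_univ_four]
  rfl

/-- The chain rule gives `u_x = B u_X + N u_T` and `u_t = A u_X + M u_T`, so `u_t = v u_x` reads `Δ
K u_T = Δ L u_X`, and `K` is invertible. For the other times the same rule yields the new derivative
as `w u_x` minus the flux multiples of `u_X` and `u_T`. -/
lemma RecipData.transformsFlows (hr : RecipData U g v K L B A N M)
    (hvt : ∀ u ∈ U, K u * vt u = L u) (w₁ w₂ : MatField n) (P Q R S : ScalarField n) :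
    TransformsFlows U B A P Q N M R S v w₁ w₂ vt (newFlow B N vt w₁ P R)
      (newFlow B N vt w₂ Q S) := by
  intro Ω c ct X T hΩ hc hX hT hU hflow hdX hdT h p hp q hq
  have key := pd_reciprocal hΩ hc hX hT h hp
  rw [← hq] at key
  have hu := hU p hp
  have hct : ct q = c p := by rw [hq, (h p hp).2]
  obtain ⟨f1, f2, f3⟩ := hflow p hp
  obtain ⟨x0, x1, x2, x3⟩ := hdX p hp
  obtain ⟨t0, t1, t2, t3⟩ := hdT p hp
  have k0 := key 0
  have k1 := key 1
  have k2 := key 2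
  have k3 := key 3
  simp only [Pi.single_apply, x0, x1, x2, x3, t0, t1, t2, t3] at k0 k1 k2 k3
  norm_num [Fin.ext_iff] at k0 k1 k2 k3
  rw [k1, k0] at f1
  rw [k2, k0] at f2
  rw [k3, k0] at f3
  rw [hct]
  generalize pd 0 ct q = a at *
  generalize pd 1 ct q = b at *
  generalize pd 2 ct q = a₂ at *
  generalize pd 3 ct q = a₃ at *
  generalize c p = u at *
  have hK : IsUnit (K u).det := isUnit_iff_ne_zero.2 (hr.detK u hu)
  have hb : b = vt u *ᵥ a := by
    refine mulVec_injective_of_isUnit ((Matrix.isUnit_iff_isUnit_det _).2 hK) ?_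
    simp only [mulVec_mulVec, hvt u hu]
    refine smul_right_injective _ (hr.delta u hu) ?_
    simp only [← smul_mulVec, (hr.frame_eq hu).1, (hr.frame_eq hu).2]
    simp only [sub_mulVec, smul_mulVec, one_mulVec, mulVec_add, mulVec_smul] at f1 ⊢
    rw [← sub_eq_zero] at f1 ⊢
    rw [← f1]
    abel
  subst hb
  refine ⟨rfl, ?_, ?_⟩
  · simp only [newFlow, add_mulVec, sub_mulVec, smul_mulVec, one_mulVec, mulVec_add, mulVec_smul,
      ← mulVec_mulVec] at f2 ⊢
    rw [← sub_eq_zero] at f2 ⊢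
    rw [← f2]
    abel
  · simp only [newFlow, add_mulVec, sub_mulVec, smul_mulVec, one_mulVec, mulVec_add, mulVec_smul,
      ← mulVec_mulVec] at f3 ⊢
    rw [← sub_eq_zero] at f3 ⊢
    rw [← f3]
    abel

lemma curv_eq_zero_of_isFlatOn (h : IsFlatOn U g) (hu : u ∈ U) (X Y : Fin n → ℝ) :
    curv (chr g) u X Y = 0 := by
  ext i s
  rw [curv_apply]
  simp [h u hu]

/-- The data of the reciprocal transformation given by two conservation laws. -/
lemma recipData_of_isFlux (hU : IsOpen U) (hg : IsMetricOn U g) (hflat : IsFlatOn U g)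
    {h : ScalarField n} (hh : ContDiffOn ℝ ∞ h U) (hB : ContDiffOn ℝ ∞ B U)
    (hA : ContDiffOn ℝ ∞ A U) (hN : ContDiffOn ℝ ∞ N U) (hM : ContDiffOn ℝ ∞ M U)
    (hBA : IsFlux U (hess g h) B A) (hNM : IsFlux U (hess g h) N M)
    (hdelta : ∀ u ∈ U, B u * M u - A u * N u ≠ 0)
    (hdet : ∀ u ∈ U, (M u • (1 : Matrix (Fin n) (Fin n) ℝ) - N u • hess g h u).det ≠ 0) :
    RecipData U g (hess g h)
      (fun u => (B u * M u - A u * N u)⁻¹ • (M u • 1 - N u • hess g h u))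
      (fun u => (B u * M u - A u * N u)⁻¹ • (B u • hess g h u - A u • 1)) B A N M := by
  have sv := smooth_hess hU hg hh
  have sd := ((hB.mul hM).sub (hA.mul hN)).inv hdelta
  have cv : ∀ {a b : ℝ} {u}, Commute (a • hess g h u - b • 1) (hess g h u) := fun {a b u} =>
    ((Commute.refl _).smul_left _).sub_left ((Commute.one_left _).smul_left _)
  have cv' : ∀ {a b : ℝ} {u}, Commute (a • 1 - b • hess g h u) (hess g h u) := fun {a b u} =>
    ((Commute.one_left _).smul_left _).sub_left ((Commute.refl _).smul_left _)
  have av := fun u (hu : u ∈ U) => selfAdj_hess hU hg hh hu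
  exact
  { isOpen := hU
    metric := hg
    flat := fun u hu => curv_eq_zero_of_isFlatOn hflat hu
    smB := hB
    smA := hA
    smN := hN
    smM := hM
    smv := sv
    smK := MatSmoothOn.smul sd ((MatSmoothOn.smul hM (MatSmoothOn.const 1)).sub
      (MatSmoothOn.smul hN sv))
    smL := MatSmoothOn.smul sd ((MatSmoothOn.smul hB sv).sub
      (MatSmoothOn.smul hA (MatSmoothOn.const 1)))
    one_eq := fun u hu => by
      ext i j
      have := hdelta u hu
      simp only [Matrix.add_apply, Matrix.smul_apply, Matrix.sub_apply, smul_eq_mul]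
      field_simp
      ring
    v_eq := fun u hu => by
      ext i j
      have := hdelta u hu
      simp only [Matrix.add_apply, Matrix.smul_apply, Matrix.sub_apply, smul_eq_mul]
      field_simp
      ring
    fluxB := hBA
    fluxN := hNM
    delta := hdelta
    codv := fun u hu => codazzi_hess hU hg hh hu (curv_eq_zero_of_isFlatOn hflat hu)
    adjK := fun u hu => (((SelfAdj.one _).smul _).sub ((av u hu).smul _)).smul _
    adjL := fun u hu => (((av u hu).smul _).sub ((SelfAdj.one _).smul _)).smul _
    adjv := av
    commKL := fun u _ => ((((Commute.one_left _).smul_left _).sub_left (cv.symm.smul_left _)).smul_left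
      _).smul_right _
    commKv := fun u _ => cv'.smul_left _
    commLv := fun u _ => cv.smul_left _
    detK := fun u hu => by
      rw [det_smul]
      exact mul_ne_zero (pow_ne_zero _ (inv_ne_zero (hdelta u hu))) (hdet u hu) }

end recip

end

section

/-! ### Differentiation under the integral sign -/

section param

/-- Tube lemma. A perturbed curve `c + εV` may leave `U` far away for every `ε ≠ 0`; over the
compact supports of the test covectors it stays in `U` for small `ε`, which is enough. -/
lemma eventually_slice_mem {X : Type*} [NormedAddCommGroup X] {O : Set (ℝ × X)}
    (hO : IsOpen O) {C : Set X} (hC : IsCompact C)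
    (h0 : ∀ x ∈ C, ((0 : ℝ), x) ∈ O) : ∃ δ > 0, ∀ ε : ℝ, |ε| ≤ δ → ∀ x ∈ C, (ε, x) ∈ O := by
  obtain ⟨V, W, hV, hW, h0V, hCW, hVW⟩ := generalized_tube_lemma (isCompact_singleton (x := (0 : ℝ)))
    hC hO (by rintro ⟨a, b⟩ ⟨ha, hb⟩; obtain rfl : a = 0 := ha; exact h0 b hb)
  obtain ⟨δ, hδ, h⟩ := Metric.nhds_basis_closedBall.mem_iff.1 (hV.mem_nhds (h0V rfl))
  exact ⟨δ, hδ, fun ε hε x hx => hVW ⟨h (by simpa [Real.dist_eq] using hε), hCW hx⟩⟩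

variable {X : Type*} [NormedAddCommGroup X] [NormedSpace ℝ X] [MeasurableSpace X] [BorelSpace X]

/-- The derivative of a weighted integral, over a compact set, of a function which is smooth near
the parameter value `0`. -/
lemma hasDerivAt_integral_weighted (μ : Measure X) [IsFiniteMeasureOnCompacts μ]
    {f : ℝ → X → ℝ} {O : Set (ℝ × X)} (hO : IsOpen O)
    (hf : ContDiffOn ℝ ∞ (fun p : ℝ × X => f p.1 p.2) O) {C : Set X} (hC : IsCompact C)
    (h0 : ∀ x ∈ C, ((0 : ℝ), x) ∈ O) (hs : ∀ ε, ∀ x ∉ C, f ε x = 0) {k : X → ℝ}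
    (hk : Measurable k) (hk1 : ∀ x, |k x| ≤ 1) {f' : X → ℝ}
    (hf' : ∀ x ∈ C, HasDerivAt (fun ε => f ε x) (f' x) 0) (hs' : ∀ x ∉ C, f' x = 0) :
    HasDerivAt (fun ε => ∫ x, k x * f ε x ∂μ) (∫ x, k x * f' x ∂μ) 0 := by
  obtain ⟨δ, hδ, hδO⟩ := eventually_slice_mem hO hC h0
  set D : ℝ × X → ℝ := fun p => fderiv ℝ (fun p : ℝ × X => f p.1 p.2) p (1, 0) with hD
  have hDc : ContinuousOn D O := (contDiffOn_fderiv_dir hO hf (1, 0)).continuousOn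
  have hder : ∀ ε x, (ε, x) ∈ O → HasDerivAt (fun e => f e x) (D (ε, x)) ε := by
    intro ε x hx
    have hl : HasDerivAt (fun e : ℝ => (e, x)) ((1 : ℝ), (0 : X)) ε :=
      (hasDerivAt_id ε).prodMk (hasDerivAt_const ε x)
    exact hasDerivAt_comp_field hO hf hl hx
  have hK : IsCompact (Set.Icc (-δ) δ ×ˢ C) := isCompact_Icc.prod hC
  have hKO : Set.Icc (-δ) δ ×ˢ C ⊆ O := by
    rintro ⟨a, b⟩ ⟨ha, hb⟩
    exact hδO a (abs_le.2 ha) b hb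
  -- The parameter derivative is bounded on a compact box, so a constant on `C` dominates. The
  -- weight `k` is only measurable because the kernel of the antiderivative is discontinuous.
  obtain ⟨b, hb⟩ := hK.exists_bound_of_continuousOn (hDc.mono hKO)
  have hslice : ∀ ε : ℝ, |ε| ≤ δ → ContinuousOn (fun x => f ε x) C := fun ε hε =>
    hf.continuousOn.comp (f := fun x => (ε, x)) (by fun_prop) fun x hx => hδO ε hε x hx
  have hmeas : ∀ ε : ℝ, |ε| ≤ δ → AEStronglyMeasurable (fun x => k x * f ε x) (μ.restrict C) :=
    fun ε hε => hk.aestronglyMeasurable.mul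
      ((hslice ε hε).aestronglyMeasurable_of_isCompact hC hC.measurableSet)
  have hset : ∀ h : X → ℝ, (∀ x ∉ C, h x = 0) → ∫ x, k x * h x ∂μ = ∫ x in C, k x * h x ∂μ :=
    fun h hh => (setIntegral_eq_integral_of_forall_compl_eq_zero fun x hx => by simp [hh x hx]).symm
  have hDf : ∀ x ∈ C, D (0, x) = f' x := fun x hx => (hder 0 x (h0 x hx)).unique (hf' x hx)
  have e1 : (fun ε => ∫ x, k x * f ε x ∂μ) = fun ε => ∫ x in C, k x * f ε x ∂μ :=
    funext fun ε => hset _ (hs ε)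
  have e2 : ∫ x, k x * f' x ∂μ = ∫ x in C, k x * D (0, x) ∂μ := by
    rw [hset _ hs']
    exact setIntegral_congr_fun hC.measurableSet fun x hx => by simp only [hDf x hx]
  rw [e1, e2]
  have : IsFiniteMeasure (μ.restrict C) := ⟨by simpa using hC.measure_lt_top⟩
  have hball : ∀ ε ∈ Metric.ball (0 : ℝ) δ, |ε| ≤ δ := fun ε hε => by
    have := Metric.mem_ball.1 hε
    rw [Real.dist_eq, sub_zero] at this
    exact this.le
  have hD0 : ContinuousOn (fun x => D (0, x)) C :=
    hDc.comp (f := fun x => ((0 : ℝ), x)) (by fun_prop) h0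
  refine (hasDerivAt_integral_of_dominated_loc_of_deriv_le (bound := fun _ => b)
    (Metric.ball_mem_nhds 0 hδ) ?_ ?_ (hk.aestronglyMeasurable.mul
      (hD0.aestronglyMeasurable_of_isCompact hC hC.measurableSet)) (F' := fun ε x => k x * D (ε, x))
      ?_ (integrable_const b) ?_).2
  · filter_upwards [Metric.ball_mem_nhds 0 hδ] with ε hε using hmeas ε (hball ε hε)
  · have hi : Integrable (fun x => f 0 x) (μ.restrict C) :=
      (hslice 0 (by simpa using hδ.le)).integrableOn_compact hC
    exact hi.bdd_mul hk.aestronglyMeasurable (c := 1) (Filter.Eventually.of_forall hk1)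
  · refine (ae_restrict_iff' hC.measurableSet).2 (Filter.Eventually.of_forall fun x hx ε hε => ?_)
    rw [norm_mul]
    have h1 := hb (ε, x) ⟨abs_le.1 (hball ε hε), hx⟩
    have h2 : ‖k x‖ ≤ 1 := hk1 x
    calc ‖k x‖ * ‖D (ε, x)‖ ≤ 1 * ‖D (ε, x)‖ := by gcongr
      _ ≤ b := by rw [one_mul]; exact h1
  · refine (ae_restrict_iff' hC.measurableSet).2 (Filter.Eventually.of_forall fun x hx ε hε => ?_)
    exact (hder ε x (hδO ε (hball ε hε) x hx)).const_mul _

lemma integrable_slice (μ : Measure X) [IsFiniteMeasureOnCompacts μ]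
    {f : ℝ → X → ℝ} {O : Set (ℝ × X)} (hO : IsOpen O)
    (hf : ContDiffOn ℝ ∞ (fun p : ℝ × X => f p.1 p.2) O) {C : Set X} (hC : IsCompact C)
    (h0 : ∀ x ∈ C, ((0 : ℝ), x) ∈ O) (hs : ∀ ε, ∀ x ∉ C, f ε x = 0) :
    ∀ᶠ ε : ℝ in nhds 0, Integrable (f ε) μ := by
  obtain ⟨δ, hδ, hδO⟩ := eventually_slice_mem hO hC h0
  filter_upwards [Metric.ball_mem_nhds 0 hδ] with ε hε
  have hε' : |ε| ≤ δ := by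
    have := Metric.mem_ball.1 hε
    rw [Real.dist_eq, sub_zero] at this
    exact this.le
  have hc : ContinuousOn (fun x => f ε x) C :=
    hf.continuousOn.comp (f := fun x => (ε, x)) (by fun_prop) fun x hx => hδO ε hε' x hx
  have := hc.integrableOn_compact (μ := μ) hC
  rwa [integrableOn_iff_integrable_of_support_subset] at this
  intro x hx
  by_contra h
  exact hx (hs ε x h)

end param

/-! ### The skew-symmetric antiderivative -/

namespace NonlocalOp

/-- The kernel of the skew-symmetric antiderivative. -/
def kern (p : ℝ × ℝ) : ℝ := (1 / 2) * ((if p.2 ≤ p.1 then 1 else 0) - if p.1 ≤ p.2 then 1 else 0)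

lemma kern_swap (p : ℝ × ℝ) : kern p.swap = -kern p := by
  simp only [kern, Prod.fst_swap, Prod.snd_swap]; ring

lemma measurable_kern : Measurable kern := by
  unfold kern
  exact (((measurable_const.ite (measurableSet_le measurable_snd measurable_fst)
    measurable_const)).sub (measurable_const.ite (measurableSet_le measurable_fst measurable_snd)
    measurable_const)).const_mul _

lemma abs_kern_le (p : ℝ × ℝ) : |kern p| ≤ 1 := by
  unfold kern
  split_ifs <;> norm_num [abs_le]

/-- Both half-lines contain `x`, where the two indicators cancel and the kernel is zero, so the
integrands agree at every point. -/
lemma antideriv_eq_integral_kern {b : ℝ → ℝ} (hb : Integrable b) (x : ℝ) :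
    antideriv b x = ∫ y, kern (x, y) * b y := by
  rw [antideriv, ← integral_indicator measurableSet_Iic, ← integral_indicator measurableSet_Ici,
    ← integral_sub (hb.indicator measurableSet_Iic) (hb.indicator measurableSet_Ici),
    ← integral_const_mul]
  refine integral_congr_ae (Filter.Eventually.of_forall fun y => ?_)
  simp only [kern, Set.indicator_apply, Set.mem_Iic, Set.mem_Ici]
  split_ifs <;> ring

lemma integrable_kern {a b : ℝ → ℝ} (ha : Integrable a) (hb : Integrable b) :
    Integrable (fun p : ℝ × ℝ => kern p * (a p.1 * b p.2)) (volume.prod volume) :=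
  (ha.mul_prod hb).bdd_mul measurable_kern.aestronglyMeasurable (c := 1)
    (Filter.Eventually.of_forall abs_kern_le)

lemma mul_antideriv_eq {a b : ℝ → ℝ} (hb : Integrable b) :
    (fun x => a x * antideriv b x) = fun x => ∫ y, kern (x, y) * (a x * b y) := by
  funext x
  rw [antideriv_eq_integral_kern hb, ← integral_const_mul]
  exact integral_congr_ae (Filter.Eventually.of_forall fun y => by ring)

lemma integrable_mul_antideriv {a b : ℝ → ℝ} (ha : Integrable a) (hb : Integrable b) :
    Integrable fun x => a x * antideriv b x := by
  rw [mul_antideriv_eq hb]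
  exact (integrable_kern ha hb).integral_prod_left

lemma integral_mul_antideriv {a b : ℝ → ℝ} (ha : Integrable a) (hb : Integrable b) :
    ∫ x, a x * antideriv b x = ∫ p : ℝ × ℝ, kern p * (a p.1 * b p.2) ∂(volume.prod volume) := by
  rw [mul_antideriv_eq hb, integral_prod _ (integrable_kern ha hb)]

/-- Fubini and the antisymmetry of the kernel. -/
lemma integral_mul_antideriv_skew {a b : ℝ → ℝ} (ha : Integrable a) (hb : Integrable b) :
    ∫ x, a x * antideriv b x = -∫ x, b x * antideriv a x := by
  rw [integral_mul_antideriv ha hb, integral_mul_antideriv hb ha, ← integral_prod_swap, ← integral_neg]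
  refine integral_congr_ae (Filter.Eventually.of_forall fun p => ?_)
  simp only [kern_swap, Prod.fst_swap, Prod.snd_swap]
  ring

/-- The antiderivative differs from `∫_{-∞}^x b` by the constant half of the total integral. -/
lemma hasDerivAt_antideriv {b : ℝ → ℝ} (hb : Integrable b) (hc : Continuous b) (x : ℝ) :
    HasDerivAt (antideriv b) (b x) x := by
  have h1 : ∀ y, ∫ z in Set.Iic y, b z = (∫ z in Set.Iic (0 : ℝ), b z) + ∫ z in (0 : ℝ)..y, b z :=
    fun y => by
      rw [← intervalIntegral.integral_Iic_sub_Iic hb.integrableOn hb.integrableOn]; ring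
  have h2 : antideriv b = fun y => (∫ z in Set.Iic (0 : ℝ), b z) + (∫ z in (0 : ℝ)..y, b z) -
      (1 / 2) * ∫ z, b z := by
    funext y
    have := intervalIntegral.integral_Iic_add_Ioi (b := y) hb.integrableOn hb.integrableOn
    rw [antideriv, integral_Ici_eq_integral_Ioi, ← this, ← h1]
    ring
  rw [h2]
  exact ((intervalIntegral.integral_hasDerivAt_right (hc.intervalIntegrable _ _)
    (hc.stronglyMeasurableAtFilter _ _) hc.continuousAt).const_add _).sub_const _

lemma contDiff_antideriv {b : ℝ → ℝ} (hb : Integrable b) (hc : ContDiff ℝ ∞ b) :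
    ContDiff ℝ ∞ (antideriv b) := by
  rw [contDiff_infty_iff_deriv]
  refine ⟨fun x => (hasDerivAt_antideriv hb hc.continuous x).differentiableAt, ?_⟩
  rwa [show deriv (antideriv b) = b from
    funext fun x => (hasDerivAt_antideriv hb hc.continuous x).deriv]

/-- The derivative of the pairing of two densities by the skew-symmetric antiderivative. -/
lemma hasDerivAt_integral_mul_antideriv {a b : ℝ → ℝ → ℝ} {O : Set (ℝ × ℝ)} (hO : IsOpen O)
    (ha : ContDiffOn ℝ ∞ (fun p : ℝ × ℝ => a p.1 p.2) O)
    (hb : ContDiffOn ℝ ∞ (fun p : ℝ × ℝ => b p.1 p.2) O) {C : Set ℝ} (hC : IsCompact C)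
    (h0 : ∀ x ∈ C, ((0 : ℝ), x) ∈ O) (hsa : ∀ ε, ∀ x ∉ C, a ε x = 0)
    (hsb : ∀ ε, ∀ x ∉ C, b ε x = 0) {a' b' : ℝ → ℝ}
    (ha' : ∀ x, HasDerivAt (fun ε => a ε x) (a' x) 0)
    (hb' : ∀ x, HasDerivAt (fun ε => b ε x) (b' x) 0) (hca' : Continuous a') (hcb' : Continuous b') :
    HasDerivAt (fun ε => ∫ x, a ε x * antideriv (b ε) x)
      ((∫ x, a' x * antideriv (b 0) x) + ∫ x, a 0 x * antideriv b' x) 0 := by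
  have z : ∀ {f : ℝ → ℝ → ℝ} {f' : ℝ → ℝ}, (∀ ε, ∀ x ∉ C, f ε x = 0) →
      (∀ x, HasDerivAt (fun ε => f ε x) (f' x) 0) → ∀ x ∉ C, f' x = 0 := by
    intro f f' hf hf' x hx
    have h : (fun ε => f ε x) = fun _ => 0 := funext fun ε => hf ε x hx
    have h' := hf' x
    rw [h] at h'
    exact h'.unique (hasDerivAt_const 0 0)
  have za := z hsa ha'
  have zb := z hsb hb'
  have ia := integrable_slice volume hO ha hC h0 hsa
  have ib := integrable_slice volume hO hb hC h0 hsb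
  have ia' : Integrable a' := hca'.integrable_of_hasCompactSupport (HasCompactSupport.intro hC za)
  have ib' : Integrable b' := hcb'.integrable_of_hasCompactSupport (HasCompactSupport.intro hC zb)
  -- As a double integral the pairing has a kernel independent of `ε`, so only the product of the
  -- two smooth densities is differentiated.
  have hev : (fun ε => ∫ x, a ε x * antideriv (b ε) x) =ᶠ[nhds 0]
      fun ε => ∫ p : ℝ × ℝ, kern p * (a ε p.1 * b ε p.2) ∂(volume.prod volume) := by
    filter_upwards [ia, ib] with ε h1 h2 using integral_mul_antideriv h1 h2
  refine HasDerivAt.congr_of_eventuallyEq ?_ hev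
  have ia0 : Integrable (a 0) := ia.self_of_nhds
  have ib0 : Integrable (b 0) := ib.self_of_nhds
  rw [integral_mul_antideriv ia' ib0, integral_mul_antideriv ia0 ib',
    ← integral_add (integrable_kern ia' ib0) (integrable_kern ia0 ib')]
  simp only [← mul_add]
  set O2 : Set (ℝ × (ℝ × ℝ)) := {q | (q.1, q.2.1) ∈ O ∧ (q.1, q.2.2) ∈ O}
  have hm1 : ContDiff ℝ ∞ fun q : ℝ × (ℝ × ℝ) => (q.1, q.2.1) := by fun_prop
  have hm2 : ContDiff ℝ ∞ fun q : ℝ × (ℝ × ℝ) => (q.1, q.2.2) := by fun_prop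
  refine hasDerivAt_integral_weighted (volume.prod volume) (f := fun ε p => a ε p.1 * b ε p.2)
    (O := O2) (C := C ×ˢ C) ((hO.preimage hm1.continuous).inter (hO.preimage hm2.continuous))
    ?_ (hC.prod hC) (fun p hp => ⟨h0 _ hp.1, h0 _ hp.2⟩) ?_ measurable_kern abs_kern_le ?_ ?_
  · exact (ha.comp hm1.contDiffOn fun q hq => hq.1).mul (hb.comp hm2.contDiffOn fun q hq => hq.2)
  · intro ε p hp
    rw [Set.mem_prod, not_and_or] at hp
    rcases hp with hp | hp
    · simp [hsa ε _ hp]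
    · simp [hsb ε _ hp]
  · exact fun p _ => (ha' p.1).mul (hb' p.2)
  · intro p hp
    rw [Set.mem_prod, not_and_or] at hp
    rcases hp with hp | hp
    · simp [hsa 0 _ hp, za _ hp]
    · simp [hsb 0 _ hp, zb _ hp]

lemma integral_eq_zero_of_hasDerivAt_compact {f f' : ℝ → ℝ} (hf : ∀ x, HasDerivAt f (f' x) x)
    (hc : Continuous f') (hs : HasCompactSupport f) : ∫ x, f' x = 0 := by
  have h : f' = deriv f := funext fun x => (hf x).deriv.symm
  have hs' : HasCompactSupport f' := by rw [h]; exact hs.deriv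
  exact integral_eq_zero_of_hasDerivAt_of_integrable hf (hc.integrable_of_hasCompactSupport hs')
    ((continuous_iff_continuousAt.2 fun x => (hf x).continuousAt).integrable_of_hasCompactSupport hs)

end NonlocalOp

end

section

/-! ### A criterion for nonlocal operators to be Hamiltonian -/

namespace NonlocalOp

variable {n m : ℕ} {U : Set (Fin n → ℝ)} {J : NonlocalOp n m} {σ : Fin m → Fin m}

/-- The tails of `J` are given by a commuting family of symmetric Codazzi tensors, with the
involution `σ` of the indices, which is compatible with the curvature of the metric. -/
structure IsCodazziFamily (J : NonlocalOp n m) (U : Set (Fin n → ℝ)) (σ : Fin m → Fin m) : Prop where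
  isOpen : IsOpen U
  metric : IsMetricOn U J.metric
  invol : Function.Involutive σ
  right_eq : ∀ α, J.right α = J.left (σ α)
  smooth : ∀ α, MatSmoothOn ∞ (J.left α) U
  cod : ∀ α, ∀ u ∈ U, Codazzi (conn J.metric u) (J.left α) u
  adj : ∀ α, ∀ u ∈ U, SelfAdj (J.metric u) (J.left α u)
  comm : ∀ α β, ∀ u ∈ U, Commute (J.left α u) (J.left β u)
  curv_eq : ∀ u ∈ U, ∀ X Y, curv (chr J.metric) u X Y =
    ∑ α, wedge (J.metric u) (J.left α u *ᵥ X) (J.right α u *ᵥ Y)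

/-- The covariant derivative of a covector along a curve. -/
def covD (J : NonlocalOp n m) (c ξ : ℝ → Fin n → ℝ) (x : ℝ) : Fin n → ℝ :=
  deriv ξ x - (conn J.metric (c x) (deriv c x))ᵀ *ᵥ ξ x

/-- The nonlocal functions in `J ξ`. -/
def tail (J : NonlocalOp n m) (c ξ : ℝ → Fin n → ℝ) (α : Fin m) : ℝ → ℝ :=
  antideriv (J.tailDensity c ξ α)

lemma IsTest.hasDerivAt {ξ : ℝ → Fin n → ℝ} (h : IsTest ξ) (x : ℝ) :
    HasDerivAt ξ (deriv ξ x) x := (h.smooth.differentiable (by simp) x).hasDerivAt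

lemma IsTest.smooth_deriv {ξ : ℝ → Fin n → ℝ} (h : IsTest ξ) : ContDiff ℝ ∞ (deriv ξ) :=
  (contDiff_infty_iff_deriv.1 h.smooth).2

variable {c ξ η ζ V : ℝ → Fin n → ℝ}

lemma contDiff_matField {W : MatField n} (hW : MatSmoothOn ∞ W U) (hc : IsCurveIn U c)
    {y : ℝ → Fin n → ℝ} (hy : ContDiff ℝ ∞ y) : ContDiff ℝ ∞ fun x => W (c x) *ᵥ y x := by
  rw [← contDiffOn_univ]
  exact (hW.comp hc.smooth.contDiffOn fun x _ => hc.mem x).mulVec hy.contDiffOn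

lemma contDiff_dotProduct {y z : ℝ → Fin n → ℝ} (hy : ContDiff ℝ ∞ y) (hz : ContDiff ℝ ∞ z) :
    ContDiff ℝ ∞ fun x => y x ⬝ᵥ z x := by
  rw [← contDiffOn_univ]
  exact ContDiffOn.vec_dotProduct hy.contDiffOn hz.contDiffOn

lemma matSmooth_cn {F : Type*} [NormedAddCommGroup F] [NormedSpace ℝ F] {s : Set F}
    {Γ : Fin n → MatField n} (hΓ : ∀ k, MatSmoothOn ∞ (Γ k) U) {y z : F → Fin n → ℝ}
    (hy : ContDiffOn ℝ ∞ y s) (hm : Set.MapsTo y s U) (hz : ContDiffOn ℝ ∞ z s) :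
    MatSmoothOn ∞ (fun p => cn Γ (y p) (z p)) s :=
  MatSmoothOn.sum fun k _ => MatSmoothOn.smul (contDiffOn_pi.1 hz k) ((hΓ k).comp hy hm)

lemma contDiff_cn (hU : IsOpen U) {g : MatField n} (hg : IsMetricOn U g) (hc : IsCurveIn U c)
    {y z : ℝ → Fin n → ℝ} (hy : ContDiff ℝ ∞ y) (hz : ContDiff ℝ ∞ z) :
    ContDiff ℝ ∞ (fun x => conn g (c x) (z x) *ᵥ y x) ∧
    ContDiff ℝ ∞ (fun x => (conn g (c x) (z x))ᵀ *ᵥ y x) := by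
  have h := matSmooth_cn (smooth_chr hU hg) hc.smooth.contDiffOn (s := Set.univ)
    (fun x _ => hc.mem x) hz.contDiffOn
  rw [← contDiffOn_univ, ← contDiffOn_univ]
  exact ⟨h.mulVec hy.contDiffOn, h.transpose.mulVec hy.contDiffOn⟩

namespace IsCodazziFamily

lemma smooth_right (hJ : J.IsCodazziFamily U σ) (α : Fin m) : MatSmoothOn ∞ (J.right α) U := by
  rw [hJ.right_eq]; exact hJ.smooth _

lemma contDiff_tailDensity (hJ : J.IsCodazziFamily U σ) (hc : IsCurveIn U c) (hξ : IsTest ξ)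
    (α : Fin m) : ContDiff ℝ ∞ (J.tailDensity c ξ α) :=
  contDiff_dotProduct (contDiff_flow hc (hJ.smooth_right α)) hξ.smooth

lemma hasCompactSupport_dot {y : ℝ → Fin n → ℝ} (hξ : IsTest ξ) :
    HasCompactSupport fun x => y x ⬝ᵥ ξ x :=
  hξ.compact.mono fun x hx => by
    intro h; exact hx (by simp [h])

lemma hasCompactSupport_dot' {y : ℝ → Fin n → ℝ} (hξ : IsTest ξ) :
    HasCompactSupport fun x => ξ x ⬝ᵥ y x := by
  simp only [dotProduct_comm (ξ _)]
  exact hasCompactSupport_dot hξ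

lemma integrable_tailDensity (hJ : J.IsCodazziFamily U σ) (hc : IsCurveIn U c) (hξ : IsTest ξ)
    (α : Fin m) : Integrable (J.tailDensity c ξ α) :=
  (hJ.contDiff_tailDensity hc hξ α).continuous.integrable_of_hasCompactSupport
    (hasCompactSupport_dot hξ)

lemma contDiff_tail (hJ : J.IsCodazziFamily U σ) (hc : IsCurveIn U c) (hξ : IsTest ξ)
    (α : Fin m) : ContDiff ℝ ∞ (J.tail c ξ α) :=
  contDiff_antideriv (hJ.integrable_tailDensity hc hξ α) (hJ.contDiff_tailDensity hc hξ α)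

lemma hasDerivAt_tail (hJ : J.IsCodazziFamily U σ) (hc : IsCurveIn U c) (hξ : IsTest ξ)
    (α : Fin m) (x : ℝ) : HasDerivAt (J.tail c ξ α) (J.tailDensity c ξ α x) x :=
  hasDerivAt_antideriv (hJ.integrable_tailDensity hc hξ α)
    (hJ.contDiff_tailDensity hc hξ α).continuous x

lemma contDiff_covD (hJ : J.IsCodazziFamily U σ) (hc : IsCurveIn U c) (hξ : IsTest ξ) :
    ContDiff ℝ ∞ (J.covD c ξ) :=
  hξ.smooth_deriv.sub (contDiff_cn hJ.isOpen hJ.metric hc hξ.smooth hc.smooth_deriv).2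

lemma apply_eq (hJ : J.IsCodazziFamily U σ) (hc : IsCurveIn U c) (ξ : ℝ → Fin n → ℝ) (x : ℝ) :
    J.apply c ξ x = (J.metric (c x))⁻¹ *ᵥ J.covD c ξ x +
      ∑ α, J.tail c ξ α x • flow (J.left α) c x := by
  rw [NonlocalOp.apply, applyWith, J.localPart_eq hJ.isOpen hJ.metric _ (hc.mem x)]
  rfl

lemma contDiff_apply (hJ : J.IsCodazziFamily U σ) (hc : IsCurveIn U c) (hξ : IsTest ξ) :
    ContDiff ℝ ∞ (J.apply c ξ) := by
  rw [show J.apply c ξ = _ from funext (hJ.apply_eq hc ξ)]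
  exact (contDiff_matField hJ.metric.matSmooth_inv hc (hJ.contDiff_covD hc hξ)).add
    (ContDiff.sum fun α _ => (hJ.contDiff_tail hc hξ α).smul (contDiff_flow hc (hJ.smooth α)))

/-- The density of the derivative of the bracket of `ξ` and `ζ` along `V`, up to a total
derivative. -/
def variationDensity (J : NonlocalOp n m) (c ξ ζ V : ℝ → Fin n → ℝ) (x : ℝ) : ℝ :=
  -(ξ x ⬝ᵥ conn J.metric (c x) (V x) *ᵥ J.apply c ζ x) +
    ζ x ⬝ᵥ conn J.metric (c x) (V x) *ᵥ J.apply c ξ x +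
    ∑ α, ((J.covD c ζ x ⬝ᵥ J.left α (c x) *ᵥ V x) * J.tail c ξ α x -
      (J.covD c ξ x ⬝ᵥ J.left α (c x) *ᵥ V x) * J.tail c ζ α x)

lemma covD_eq (hJ : J.IsCodazziFamily U σ) (hc : IsCurveIn U c) (ξ : ℝ → Fin n → ℝ) (x : ℝ) :
    J.covD c ξ x = J.metric (c x) *ᵥ J.apply c ξ x -
      ∑ β, J.tail c ξ β x • J.metric (c x) *ᵥ J.left β (c x) *ᵥ deriv c x := by
  rw [hJ.apply_eq hc, mulVec_add, mulVec_mulVec, mul_nonsing_inv _ (hJ.metric.isUnit_det (hc.mem x)),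
    one_mulVec, mulVec_sum]
  simp only [mulVec_smul, flow, add_sub_cancel_right]

lemma sum_skew_eq_zero {ι : Type*} [Fintype ι] (f h : ι → ℝ) (G : ι → ι → ℝ)
    (hG : ∀ a b, G a b = G b a) : ∑ a, ∑ b, (f b * h a - h b * f a) * G b a = 0 := by
  have e : ∑ a, ∑ b, (f b * h a - h b * f a) * G b a =
      -∑ a, ∑ b, (f b * h a - h b * f a) * G b a := by
    conv_lhs => rw [Finset.sum_comm]
    rw [← Finset.sum_neg_distrib]
    refine Finset.sum_congr rfl fun a _ => ?_
    rw [← Finset.sum_neg_distrib]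
    refine Finset.sum_congr rfl fun b _ => ?_
    rw [hG a b]
    ring
  linarith

/-- Replacing `covD` by `g J` changes the density by terms bilinear in the nonlocal functions of `ξ`
and `ζ` and skew in them. Their coefficients are symmetric in the tail indices because the tails
commute and are self-adjoint, so the sum vanishes. -/
lemma variationDensity_eq (hJ : J.IsCodazziFamily U σ) (hc : IsCurveIn U c)
    (ξ ζ V : ℝ → Fin n → ℝ) (x : ℝ) :
    variationDensity J c ξ ζ V x =
      -(ξ x ⬝ᵥ conn J.metric (c x) (V x) *ᵥ J.apply c ζ x) +
      ζ x ⬝ᵥ conn J.metric (c x) (V x) *ᵥ J.apply c ξ x +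
      ∑ α, (((J.metric (c x) *ᵥ J.apply c ζ x) ⬝ᵥ J.left α (c x) *ᵥ V x) * J.tail c ξ α x -
      ((J.metric (c x) *ᵥ J.apply c ξ x) ⬝ᵥ J.left α (c x) *ᵥ V x) * J.tail c ζ α x) := by
  rw [variationDensity]
  congr 1
  have hx := hc.mem x
  have h := sum_skew_eq_zero (fun α => J.tail c ξ α x) (fun α => J.tail c ζ α x) (fun b a =>
    (J.metric (c x) *ᵥ J.left b (c x) *ᵥ deriv c x) ⬝ᵥ J.left a (c x) *ᵥ V x) (fun a b => by
      rw [(hJ.adj a _ hx).symm_of_commute hJ.metric hx (hJ.adj b _ hx) (hJ.comm a b _ hx),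
        metric_dot_comm hJ.metric hx])
  rw [← sub_eq_zero, ← h, ← Finset.sum_sub_distrib]
  refine Finset.sum_congr rfl fun α _ => ?_
  simp only [hJ.covD_eq hc, sub_dotProduct, sum_dotProduct, smul_dotProduct, smul_eq_mul, sub_mul,
    Finset.sum_mul, Finset.sum_sub_distrib]
  have e : ∀ f h : Fin m → ℝ, ∀ a : ℝ, ∑ b, f b * h b * a = ∑ b, f b * a * h b := fun f h a =>
    Finset.sum_congr rfl fun _ _ => by ring
  rw [e, e]
  ring

/-- The cyclic sum of the densities of the derivatives of the brackets vanishes. -/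
lemma variationDensity_cyclic (hJ : J.IsCodazziFamily U σ) (hc : IsCurveIn U c)
    (ξ η ζ : ℝ → Fin n → ℝ) (x : ℝ) :
    variationDensity J c ξ ζ (J.apply c η) x + variationDensity J c η ξ (J.apply c ζ) x +
      variationDensity J c ζ η (J.apply c ξ) x = 0 := by
  have hx := hc.mem x
  simp only [hJ.variationDensity_eq hc]
  -- The three vector fields are now `J ξ`, `J η`, `J ζ`. Absence of torsion cancels the connection
  -- terms in pairs, self-adjointness of the tails cancels the rest.
  have cs := conn_symm hJ.isOpen hJ.metric hx
  have s : ∀ α X Y, (J.metric (c x) *ᵥ X) ⬝ᵥ J.left α (c x) *ᵥ Y =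
      (J.metric (c x) *ᵥ Y) ⬝ᵥ J.left α (c x) *ᵥ X := fun α X Y => by
    simpa using (SelfAdj.one _).symm_of_commute hJ.metric hx (hJ.adj α _ hx) (Commute.one_left _) X Y
  rw [cs (J.apply c η x) (J.apply c ζ x), cs (J.apply c ζ x) (J.apply c ξ x),
    cs (J.apply c η x) (J.apply c ξ x)]
  simp only [Finset.sum_sub_distrib, s _ (J.apply c ζ x) (J.apply c η x),
    s _ (J.apply c ξ x) (J.apply c ζ x), s _ (J.apply c η x) (J.apply c ξ x)]
  ring

end IsCodazziFamily

end NonlocalOp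

end

/-! ### Skew-symmetry and the first variation of the bracket -/

section

namespace NonlocalOp

variable {n m : ℕ} {U : Set (Fin n → ℝ)} {J : NonlocalOp n m} {σ : Fin m → Fin m}
variable {c ξ η ζ V : ℝ → Fin n → ℝ}

lemma bracket_eq (J : NonlocalOp n m) (c ξ ζ : ℝ → Fin n → ℝ)
    (h1 : Integrable fun x => ξ x ⬝ᵥ J.localPart c ζ x)
    (h2 : ∀ α, Integrable fun x => (flow (J.left α) c x ⬝ᵥ ξ x) *
      antideriv (J.tailDensity c ζ α) x) :
    J.bracket c ξ ζ = (∫ x, ξ x ⬝ᵥ J.localPart c ζ x) +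
      ∑ α, ∫ x, (flow (J.left α) c x ⬝ᵥ ξ x) * antideriv (J.tailDensity c ζ α) x := by
  rw [← integral_finsetSum _ fun α _ => h2 α, ← integral_add h1 (integrable_finsetSum _
    fun α _ => h2 α), bracket]
  refine integral_congr_ae (Filter.Eventually.of_forall fun x => ?_)
  simp only [NonlocalOp.apply, applyWith, dotProduct_add, dotProduct_sum, dotProduct_smul,
    smul_eq_mul]
  congr 1
  exact Finset.sum_congr rfl fun α _ => by rw [dotProduct_comm, mul_comm]

lemma eq_zero_of_notMem_tsupport {x : ℝ} (hx : x ∉ tsupport ξ) : ξ x = 0 ∧ deriv ξ x = 0 := by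
  refine ⟨image_eq_zero_of_notMem_tsupport hx, ?_⟩
  by_contra h
  exact hx (support_deriv_subset h)

lemma matSmooth_matDeriv {F : Type*} [NormedAddCommGroup F] [NormedSpace ℝ F] {s : Set F}
    (hU : IsOpen U) {W : MatField n} (hW : MatSmoothOn ∞ W U) {y z : F → Fin n → ℝ}
    (hy : ContDiffOn ℝ ∞ y s) (hm : Set.MapsTo y s U) (hz : ContDiffOn ℝ ∞ z s) :
    MatSmoothOn ∞ (fun p => matDeriv W (y p) (z p)) s := fun i j =>
  (((hW i j).fderiv_of_isOpen hU (m := ∞) (by simp)).comp hy hm).clm_apply hz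

namespace IsCodazziFamily

lemma integrable_flow_dot (hJ : J.IsCodazziFamily U σ) (hc : IsCurveIn U c) (hξ : IsTest ξ)
    (α : Fin m) : Integrable fun x => flow (J.left α) c x ⬝ᵥ ξ x :=
  (contDiff_dotProduct (contDiff_flow hc (hJ.smooth α))
    hξ.smooth).continuous.integrable_of_hasCompactSupport (hasCompactSupport_dot hξ)

lemma bracket_eq_integral (hJ : J.IsCodazziFamily U σ) (hc : IsCurveIn U c) (hξ : IsTest ξ)
    (hζ : IsTest ζ) : J.bracket c ξ ζ =
      (∫ x, ξ x ⬝ᵥ (J.metric (c x))⁻¹ *ᵥ J.covD c ζ x) +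
      ∑ α, ∫ x, (flow (J.left α) c x ⬝ᵥ ξ x) * antideriv (J.tailDensity c ζ α) x := by
  have h : ∀ x, J.localPart c ζ x = (J.metric (c x))⁻¹ *ᵥ J.covD c ζ x := fun x =>
    J.localPart_eq hJ.isOpen hJ.metric ζ (hc.mem x)
  rw [bracket_eq]
  · simp only [h]
  · simp only [h]
    exact (contDiff_dotProduct hξ.smooth (contDiff_matField hJ.metric.matSmooth_inv hc
      (hJ.contDiff_covD hc hζ))).continuous.integrable_of_hasCompactSupport
      (hasCompactSupport_dot' hξ)
  · exact fun α => integrable_mul_antideriv (hJ.integrable_flow_dot hc hξ α)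
      (hJ.integrable_tailDensity hc hζ α)

lemma inv_symm (hJ : J.IsCodazziFamily U σ) {u : Fin n → ℝ} (hu : u ∈ U) :
    ((J.metric u)⁻¹)ᵀ = (J.metric u)⁻¹ := by
  rw [transpose_nonsing_inv, (hJ.metric.symm u hu).eq]

lemma inv_dot_comm (hJ : J.IsCodazziFamily U σ) {u : Fin n → ℝ} (hu : u ∈ U) (X Y : Fin n → ℝ) :
    X ⬝ᵥ (J.metric u)⁻¹ *ᵥ Y = Y ⬝ᵥ (J.metric u)⁻¹ *ᵥ X := by
  rw [dotProduct_mulVec, ← mulVec_transpose, hJ.inv_symm hu, dotProduct_comm]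

lemma left_eq_right (hJ : J.IsCodazziFamily U σ) (α : Fin m) : J.left α = J.right (σ α) := by
  rw [hJ.right_eq, hJ.invol]

lemma sum_involution (hJ : J.IsCodazziFamily U σ) (f : Fin m → ℝ) : ∑ α, f (σ α) = ∑ α, f α :=
  Equiv.sum_comp hJ.invol.toPerm f

/-- The symmetrized local part is the derivative of `g^{ij} ξ_i ζ_j`, by metric compatibility. The
tails `α` and `σ α` have left and right factors exchanged, so skewness of the antiderivative pairs
them. -/
lemma bracket_skew (hJ : J.IsCodazziFamily U σ) (hc : IsCurveIn U c) (hξ : IsTest ξ)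
    (hζ : IsTest ζ) : J.bracket c ξ ζ = -J.bracket c ζ ξ := by
  rw [hJ.bracket_eq_integral hc hξ hζ, hJ.bracket_eq_integral hc hζ hξ, neg_add]
  have sI : ∀ {ξ ζ : ℝ → Fin n → ℝ}, IsTest ζ → ContDiff ℝ ∞ fun x => (J.metric (c x))⁻¹ *ᵥ
      J.covD c ζ x := fun hζ => contDiff_matField hJ.metric.matSmooth_inv hc (hJ.contDiff_covD hc hζ)
  have c1 := (contDiff_dotProduct hξ.smooth (sI (ξ := ξ) hζ)).continuous
  have c2 := (contDiff_dotProduct hζ.smooth (sI (ξ := ξ) hξ)).continuous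
  congr 1
  · rw [eq_neg_iff_add_eq_zero, ← integral_add
      (c1.integrable_of_hasCompactSupport (hasCompactSupport_dot' hξ))
      (c2.integrable_of_hasCompactSupport (hasCompactSupport_dot' hζ))]
    refine integral_eq_zero_of_hasDerivAt_compact
      (f := fun x => ξ x ⬝ᵥ (J.metric (c x))⁻¹ *ᵥ ζ x) (fun x => ?_) (c1.add c2)
      (hasCompactSupport_dot' hξ)
    have hx := hc.mem x
    have h := hasDerivAt_dotProduct (hξ.hasDerivAt x)
      ((hJ.metric.matSmooth_inv.hasMatDerivAt hJ.isOpen (hc.hasDerivAt x) hx).mulVec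
        (hζ.hasDerivAt x))
    convert h using 1
    rw [hJ.inv_dot_comm hx (ζ x), covD, covD, matDeriv_inv hJ.isOpen hJ.metric hx]
    simp only [sub_dotProduct, dotProduct_sub, dotProduct_add, mulVec_sub, neg_mulVec, add_mulVec,
      dotProduct_neg, ← mulVec_mulVec]
    rw [mulVec_transpose _ (ξ x), ← dotProduct_mulVec]
    ring
  · rw [← Finset.sum_neg_distrib, ← hJ.sum_involution]
    refine Finset.sum_congr rfl fun α _ => ?_
    rw [integral_mul_antideriv_skew (hJ.integrable_flow_dot hc hξ _)
      (hJ.integrable_tailDensity hc hζ _)]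
    have e1 : J.tailDensity c ζ (σ α) = fun x => flow (J.left α) c x ⬝ᵥ ζ x := by
      funext x; rw [tailDensity, ← hJ.left_eq_right]
    have e2 : (fun x => flow (J.left (σ α)) c x ⬝ᵥ ξ x) = J.tailDensity c ξ α := by
      funext x; rw [tailDensity, hJ.right_eq]
    rw [e1, e2]

/-- The derivative of `flow (J.left α) c ⬝ ξ` along `V`. -/
def flowVariation (J : NonlocalOp n m) (c V ξ : ℝ → Fin n → ℝ) (α : Fin m) (x : ℝ) : ℝ :=
  (matDeriv (J.left α) (c x) (V x) *ᵥ deriv c x + J.left α (c x) *ᵥ deriv V x) ⬝ᵥ ξ x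

/-- The derivative of the local part of the bracket along `V`. -/
def localVariation (J : NonlocalOp n m) (c V ξ ζ : ℝ → Fin n → ℝ) (x : ℝ) : ℝ :=
  ξ x ⬝ᵥ (matDeriv (fun u => (J.metric u)⁻¹) (c x) (V x) *ᵥ J.covD c ζ x -
    (J.metric (c x))⁻¹ *ᵥ (dcn (chr J.metric) (c x) (V x) (deriv c x) +
      conn J.metric (c x) (deriv V x))ᵀ *ᵥ ζ x)

lemma contDiff_flowVariation (hJ : J.IsCodazziFamily U σ) (hc : IsCurveIn U c)
    (hV : ContDiff ℝ ∞ V) (hξ : IsTest ξ) (α : Fin m) :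
    ContDiff ℝ ∞ (flowVariation J c V ξ α) := by
  have h := (matSmooth_matDeriv hJ.isOpen (hJ.smooth α) hc.smooth.contDiffOn (s := Set.univ)
    (fun x _ => hc.mem x) hV.contDiffOn).mulVec hc.smooth_deriv.contDiffOn
  rw [contDiffOn_univ] at h
  exact contDiff_dotProduct (h.add (contDiff_matField (hJ.smooth α) hc
    (contDiff_infty_iff_deriv.1 hV).2)) hξ.smooth

lemma contDiff_localVariation (hJ : J.IsCodazziFamily U σ) (hc : IsCurveIn U c)
    (hV : ContDiff ℝ ∞ V) (hξ : IsTest ξ) (hζ : IsTest ζ) :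
    ContDiff ℝ ∞ (localVariation J c V ξ ζ) := by
  have hm : Set.MapsTo c Set.univ U := fun x _ => hc.mem x
  have h1 := (matSmooth_matDeriv hJ.isOpen hJ.metric.matSmooth_inv hc.smooth.contDiffOn
    hm hV.contDiffOn).mulVec (hJ.contDiff_covD hc hζ).contDiffOn
  have h2 : MatSmoothOn ∞ (fun x => dcn (chr J.metric) (c x) (V x) (deriv c x)) Set.univ :=
    MatSmoothOn.sum fun k _ => MatSmoothOn.smul (contDiffOn_pi.1 hc.smooth_deriv.contDiffOn k)
      (matSmooth_matDeriv hJ.isOpen (smooth_chr hJ.isOpen hJ.metric k) hc.smooth.contDiffOn hm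
        hV.contDiffOn)
  have h3 := (h2.add (matSmooth_cn (smooth_chr hJ.isOpen hJ.metric) hc.smooth.contDiffOn hm
    (contDiff_infty_iff_deriv.1 hV).2.contDiffOn)).transpose.mulVec hζ.smooth.contDiffOn
  rw [contDiffOn_univ] at h1 h3
  exact contDiff_dotProduct hξ.smooth
    (h1.sub (contDiff_matField hJ.metric.matSmooth_inv hc h3))

lemma smooth_variation_point {c V : ℝ → Fin n → ℝ} (hc : ContDiff ℝ ∞ c) (hV : ContDiff ℝ ∞ V) :
    ContDiff ℝ ∞ fun p : ℝ × ℝ => c p.2 + p.1 • V p.2 :=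
  (hc.comp contDiff_snd).add (contDiff_fst.smul (hV.comp contDiff_snd))

/-- The derivative of the bracket, before integrations by parts. -/
lemma hasDerivAt_bracket_raw (hJ : J.IsCodazziFamily U σ) (hc : IsCurveIn U c)
    (hV : ContDiff ℝ ∞ V) (hξ : IsTest ξ) (hζ : IsTest ζ) :
    HasDerivAt (fun ε : ℝ => J.bracket (c + ε • V) ξ ζ)
      ((∫ x, localVariation J c V ξ ζ x) + ∑ α,
        ((∫ x, flowVariation J c V ξ α x * J.tail c ζ α x) +
          ∫ x, (flow (J.left α) c x ⬝ᵥ ξ x) * antideriv (flowVariation J c V ζ (σ α)) x)) 0 := by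
  have dc : Differentiable ℝ c := hc.smooth.differentiable (by simp)
  have dV : Differentiable ℝ V := hV.differentiable (by simp)
  have sV' : ContDiff ℝ ∞ (deriv V) := (contDiff_infty_iff_deriv.1 hV).2
  have sp := smooth_variation_point hc.smooth hV
  have sp' := smooth_variation_point hc.smooth_deriv sV'
  -- The vector field `V` need not have compact support, so `c + εV` need not be a curve in `U`. All
  -- statements about the perturbed integrands are restricted to this open set of pairs `(ε, x)`.
  set O : Set (ℝ × ℝ) := {p | c p.2 + p.1 • V p.2 ∈ U} with hOdef
  have hO : IsOpen O := hJ.isOpen.preimage sp.continuous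
  set C : Set ℝ := tsupport ξ ∪ tsupport ζ with hCdef
  have hC : IsCompact C := hξ.compact.isCompact.union hζ.compact.isCompact
  have h0 : ∀ x ∈ C, ((0 : ℝ), x) ∈ O := fun x _ => by simpa [hOdef] using hc.mem x
  have zξ : ∀ x ∉ C, ξ x = 0 := fun x hx => (eq_zero_of_notMem_tsupport fun h => hx (Or.inl h)).1
  have zζ : ∀ x ∉ C, ζ x = 0 := fun x hx => (eq_zero_of_notMem_tsupport fun h => hx (Or.inr h)).1
  have e0 : c + (0 : ℝ) • V = c := by simp
  have fl : ∀ (W : MatField n), MatSmoothOn ∞ W U → ∀ {ξ : ℝ → Fin n → ℝ}, IsTest ξ →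
      ContDiffOn ℝ ∞ (fun p : ℝ × ℝ => flow W (c + p.1 • V) p.2 ⬝ᵥ ξ p.2) O := by
    intro W hW ξ hξ
    have h : ∀ p : ℝ × ℝ, flow W (c + p.1 • V) p.2 =
        W (c p.2 + p.1 • V p.2) *ᵥ (deriv c p.2 + p.1 • deriv V p.2) := fun p => by
      rw [flow, deriv_variation dc dV]; rfl
    simp only [h]
    exact ContDiffOn.vec_dotProduct ((hW.comp sp.contDiffOn fun p hp => hp).mulVec sp'.contDiffOn)
      (hξ.smooth.comp contDiff_snd).contDiffOn
  have loc : ContDiffOn ℝ ∞ (fun p : ℝ × ℝ => ξ p.2 ⬝ᵥ J.localPart (c + p.1 • V) ζ p.2) O := by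
    have h : ∀ p ∈ O, ξ p.2 ⬝ᵥ J.localPart (c + p.1 • V) ζ p.2 =
        ξ p.2 ⬝ᵥ (J.metric (c p.2 + p.1 • V p.2))⁻¹ *ᵥ (deriv ζ p.2 -
          (conn J.metric (c p.2 + p.1 • V p.2) (deriv c p.2 + p.1 • deriv V p.2))ᵀ *ᵥ ζ p.2) :=
      fun p hp => by
        rw [J.localPart_eq hJ.isOpen hJ.metric ζ (c := c + p.1 • V) hp,
          deriv_variation dc dV]
        rfl
    refine ContDiffOn.congr ?_ h
    have hm : Set.MapsTo (fun p : ℝ × ℝ => c p.2 + p.1 • V p.2) O U := fun p hp => hp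
    exact ContDiffOn.vec_dotProduct (hξ.smooth.comp contDiff_snd).contDiffOn
      ((hJ.metric.matSmooth_inv.comp sp.contDiffOn hm).mulVec
      ((hζ.smooth_deriv.comp contDiff_snd).contDiffOn.sub
      ((matSmooth_cn (smooth_chr hJ.isOpen hJ.metric) sp.contDiffOn hm
        sp'.contDiffOn).transpose.mulVec (hζ.smooth.comp contDiff_snd).contDiffOn)))
  have dloc : ∀ x, HasDerivAt (fun ε : ℝ => ξ x ⬝ᵥ J.localPart (c + ε • V) ζ x)
      (localVariation J c V ξ ζ x) 0 := by
    intro x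
    have hx := hc.mem x
    have hx' : c x + (0 : ℝ) • V x ∈ U := by simpa using hx
    have hl := hasDerivAt_line (c x) (V x)
    have h1 := (cn_hasMatDerivAt hJ.isOpen (smooth_chr hJ.isOpen hJ.metric) hl hx'
      (hasDerivAt_line (deriv c x) (deriv V x))).transpose.mulVec (hasDerivAt_const 0 (ζ x))
    have h2 := hasDerivAt_dotProduct (hasDerivAt_const 0 (ξ x))
      ((hJ.metric.matSmooth_inv.line hJ.isOpen hx (V x)).mulVec
        ((hasDerivAt_const 0 (deriv ζ x)).sub h1))
    have h3 := h2.congr_of_eventuallyEq (f₁ := fun ε : ℝ => ξ x ⬝ᵥ J.localPart (c + ε • V) ζ x)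
      ((eventually_mem_line hJ.isOpen hx (V x)).mono fun ε hε => by
        change ξ x ⬝ᵥ _ = _
        rw [J.localPart_eq hJ.isOpen hJ.metric ζ (c := c + ε • V) hε,
          deriv_variation dc dV]
        rfl)
    refine h3.congr_deriv ?_
    simp [localVariation, covD, mulVec_neg, sub_eq_add_neg]
  have hflow : ∀ (W : MatField n), MatSmoothOn ∞ W U → ∀ (ξ : ℝ → Fin n → ℝ) x,
      HasDerivAt (fun ε : ℝ => flow W (c + ε • V) x ⬝ᵥ ξ x)
        ((matDeriv W (c x) (V x) *ᵥ deriv c x + W (c x) *ᵥ deriv V x) ⬝ᵥ ξ x) 0 := by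
    intro W hW ξ x
    simpa using hasDerivAt_dotProduct (hasDerivAt_variation_flow hJ.isOpen hc dV hW x)
      (hasDerivAt_const 0 (ξ x))
  have htail : ∀ α, HasDerivAt (fun ε : ℝ => ∫ x, (flow (J.left α) (c + ε • V) x ⬝ᵥ ξ x) *
      antideriv (J.tailDensity (c + ε • V) ζ α) x)
      ((∫ x, flowVariation J c V ξ α x * J.tail c ζ α x) +
          ∫ x, (flow (J.left α) c x ⬝ᵥ ξ x) * antideriv (flowVariation J c V ζ (σ α)) x) 0 := by
    intro α
    have h := hasDerivAt_integral_mul_antideriv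
      (a := fun ε x => flow (J.left α) (c + ε • V) x ⬝ᵥ ξ x)
      (b := fun ε x => J.tailDensity (c + ε • V) ζ α x) hO (fl _ (hJ.smooth α) hξ)
      (fl _ (hJ.smooth_right α) hζ) hC h0 (fun ε x hx => by simp [zξ x hx])
      (fun ε x hx => by simp [tailDensity, zζ x hx]) (a' := flowVariation J c V ξ α)
      (b' := flowVariation J c V ζ (σ α)) (hflow _ (hJ.smooth α) ξ)
      (fun x => by
        have := hflow _ (hJ.smooth (σ α)) ζ x
        simp only [tailDensity, hJ.right_eq]
        exact this)
      (hJ.contDiff_flowVariation hc hV hξ α).continuous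
      (hJ.contDiff_flowVariation hc hV hζ (σ α)).continuous
    simp only [e0] at h
    exact h
  have hlocal : HasDerivAt (fun ε : ℝ => ∫ x, ξ x ⬝ᵥ J.localPart (c + ε • V) ζ x)
      (∫ x, localVariation J c V ξ ζ x) 0 := by
    have h := hasDerivAt_integral_weighted volume
      (f := fun ε x => ξ x ⬝ᵥ J.localPart (c + ε • V) ζ x) hO loc hC h0
      (fun ε x hx => by simp [zξ x hx]) (k := fun _ => 1) measurable_const (by simp)
      (f' := localVariation J c V ξ ζ) (fun x _ => dloc x)
      (fun x hx => by simp [localVariation, zξ x hx])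
    simpa using h
  have hsum := hlocal.add (HasDerivAt.fun_sum (u := Finset.univ) fun α _ => htail α)
  refine hsum.congr_of_eventuallyEq ?_
  have i1 := integrable_slice volume
    (f := fun ε x => ξ x ⬝ᵥ J.localPart (c + ε • V) ζ x) hO loc hC h0 (fun ε x hx => by simp [zξ x hx])
  have i2 : ∀ᶠ ε : ℝ in nhds 0, ∀ α, Integrable fun x => flow (J.left α) (c + ε • V) x ⬝ᵥ ξ x :=
    Filter.eventually_all.2 fun α => integrable_slice volume
      (f := fun ε x => flow (J.left α) (c + ε • V) x ⬝ᵥ ξ x) hO (fl _ (hJ.smooth α) hξ) hC h0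
      (fun ε x hx => by simp [zξ x hx])
  have i3 : ∀ᶠ ε : ℝ in nhds 0, ∀ α, Integrable fun x => J.tailDensity (c + ε • V) ζ α x :=
    Filter.eventually_all.2 fun α => integrable_slice volume
      (f := fun ε x => J.tailDensity (c + ε • V) ζ α x) hO (fl _ (hJ.smooth_right α) hζ) hC h0
      (fun ε x hx => by simp [tailDensity, zζ x hx])
  filter_upwards [i1, i2, i3] with ε h1 h2 h3
  exact bracket_eq J _ ξ ζ h1 fun α => integrable_mul_antideriv (h2 α) (h3 α)

end IsCodazziFamily

end NonlocalOp

end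

/-! ### Integration by parts and the Jacobi identity -/

section

namespace NonlocalOp

variable {n m : ℕ} {U : Set (Fin n → ℝ)} {J : NonlocalOp n m} {σ : Fin m → Fin m}
variable {c ξ η ζ V : ℝ → Fin n → ℝ}

namespace IsCodazziFamily

/-- The derivative of the density of the bracket along `V`, after moving the antiderivatives to
the undifferentiated factors. -/
def bracketVariation (J : NonlocalOp n m) (c V ξ ζ : ℝ → Fin n → ℝ) (x : ℝ) : ℝ :=
  localVariation J c V ξ ζ x + ∑ α, (flowVariation J c V ξ α x * J.tail c ζ α x -
    flowVariation J c V ζ α x * J.tail c ξ α x)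

/-- The function whose derivative is the difference of `bracketVariation` and
`variationDensity`. -/
def variationPotential (J : NonlocalOp n m) (c V ξ ζ : ℝ → Fin n → ℝ) (x : ℝ) : ℝ :=
  -(ξ x ⬝ᵥ (J.metric (c x))⁻¹ *ᵥ (conn J.metric (c x) (V x))ᵀ *ᵥ ζ x) +
    ∑ α, ((J.left α (c x) *ᵥ V x) ⬝ᵥ ξ x * J.tail c ζ α x -
      (J.left α (c x) *ᵥ V x) ⬝ᵥ ζ x * J.tail c ξ α x)

/-- The Gauss equation paired with two covectors, in the form in which it meets the products of
local tail densities. -/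
lemma curv_dot (hJ : J.IsCodazziFamily U σ) {u : Fin n → ℝ} (hu : u ∈ U) (X Y p q : Fin n → ℝ) :
    p ⬝ᵥ (J.metric u)⁻¹ *ᵥ (curv (chr J.metric) u X Y)ᵀ *ᵥ q =
      ∑ α, ((J.left α u *ᵥ X) ⬝ᵥ q * ((J.right α u *ᵥ Y) ⬝ᵥ p) -
        (J.left α u *ᵥ X) ⬝ᵥ p * ((J.right α u *ᵥ Y) ⬝ᵥ q)) := by
  have hl : ∀ a : Fin n → ℝ, (J.metric u *ᵥ a) ⬝ᵥ (J.metric u)⁻¹ *ᵥ p = a ⬝ᵥ p := fun a => by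
    rw [dotProduct_comm, dotProduct_mulVec, ← mulVec_transpose, (hJ.metric.symm u hu).eq,
      mulVec_mulVec, mul_nonsing_inv _ (hJ.metric.isUnit_det hu), one_mulVec, dotProduct_comm]
  rw [hJ.inv_dot_comm hu, mulVec_transpose, ← dotProduct_mulVec, hJ.curv_eq u hu, sum_mulVec,
    dotProduct_sum]
  refine Finset.sum_congr rfl fun α _ => ?_
  rw [wedge_mulVec, hl, hl, dotProduct_sub, dotProduct_smul, dotProduct_smul, smul_eq_mul,
    smul_eq_mul, dotProduct_comm q, dotProduct_comm q]
  ring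

/-- The connection matrix of `V` is differentiated along the curve, while `localVariation` contains
the connection matrix of `u_x` differentiated along `V`. The difference of the two is the curvature.
-/
lemma hasDerivAt_inv_conn_dot (hJ : J.IsCodazziFamily U σ) (hc : IsCurveIn U c)
    (hV : ContDiff ℝ ∞ V) (hξ : IsTest ξ) (hζ : IsTest ζ) (x : ℝ) :
    HasDerivAt (fun x => ξ x ⬝ᵥ (J.metric (c x))⁻¹ *ᵥ (conn J.metric (c x) (V x))ᵀ *ᵥ ζ x)
      (-localVariation J c V ξ ζ x - ξ x ⬝ᵥ conn J.metric (c x) (V x) *ᵥ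
        (J.metric (c x))⁻¹ *ᵥ J.covD c ζ x +
        ζ x ⬝ᵥ conn J.metric (c x) (V x) *ᵥ (J.metric (c x))⁻¹ *ᵥ J.covD c ξ x -
        ξ x ⬝ᵥ (J.metric (c x))⁻¹ *ᵥ (curv (chr J.metric) (c x) (V x) (deriv c x))ᵀ *ᵥ ζ x) x := by
  have hx := hc.mem x
  have hV' : HasDerivAt V (deriv V x) x := (hV.differentiable (by simp) x).hasDerivAt
  have h := hasDerivAt_dotProduct (hξ.hasDerivAt x)
    ((hJ.metric.matSmooth_inv.hasMatDerivAt hJ.isOpen (hc.hasDerivAt x) hx).mulVec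
      ((cn_hasMatDerivAt hJ.isOpen (smooth_chr hJ.isOpen hJ.metric) (hc.hasDerivAt x) hx
        hV').transpose.mulVec (hζ.hasDerivAt x)))
  refine h.congr_deriv ?_
  have flip : ∀ p q, ζ x ⬝ᵥ conn J.metric (c x) p *ᵥ (J.metric (c x))⁻¹ *ᵥ q =
      q ⬝ᵥ (J.metric (c x))⁻¹ *ᵥ (conn J.metric (c x) p)ᵀ *ᵥ ζ x := fun p q => by
    rw [hJ.inv_dot_comm hx q, dotProduct_mulVec (ζ x), mulVec_transpose]
  have e1 : ∀ q, (deriv ξ x) ⬝ᵥ q = J.covD c ξ x ⬝ᵥ q +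
      ξ x ⬝ᵥ conn J.metric (c x) (deriv c x) *ᵥ q := fun q => by
    rw [covD, sub_dotProduct, mulVec_transpose _ (ξ x), ← dotProduct_mulVec]; ring
  have e2 : deriv ζ x = J.covD c ζ x + (conn J.metric (c x) (deriv c x))ᵀ *ᵥ ζ x := by
    rw [covD, sub_add_cancel]
  rw [flip, e1, e2, localVariation, matDeriv_inv hJ.isOpen hJ.metric hx,
    matDeriv_inv hJ.isOpen hJ.metric hx, curv]
  simp only [transpose_sub, transpose_add, transpose_mul, dotProduct_sub,
    dotProduct_add, mulVec_sub, mulVec_add, sub_mulVec, neg_mulVec, add_mulVec, dotProduct_neg,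
    ← mulVec_mulVec]
  ring

/-- The Codazzi identity exchanges the derivative of the tail matrix along the curve for the one
along `V` occurring in `flowVariation`. The last term appears where the derivative falls on the
antiderivative. -/
lemma hasDerivAt_flow_dot_tail (hJ : J.IsCodazziFamily U σ) (hc : IsCurveIn U c)
    (hV : ContDiff ℝ ∞ V) (hξ : IsTest ξ) (hζ : IsTest ζ) (α : Fin m) (x : ℝ) :
    HasDerivAt (fun x => (J.left α (c x) *ᵥ V x) ⬝ᵥ ξ x * J.tail c ζ α x)
      ((flowVariation J c V ξ α x + J.covD c ξ x ⬝ᵥ J.left α (c x) *ᵥ V x +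
        ξ x ⬝ᵥ conn J.metric (c x) (V x) *ᵥ J.left α (c x) *ᵥ deriv c x) * J.tail c ζ α x +
      (J.left α (c x) *ᵥ V x) ⬝ᵥ ξ x * J.tailDensity c ζ α x) x := by
  have hx := hc.mem x
  have hV' : HasDerivAt V (deriv V x) x := (hV.differentiable (by simp) x).hasDerivAt
  have h := (hasDerivAt_dotProduct (((hJ.smooth α).hasMatDerivAt hJ.isOpen (hc.hasDerivAt x)
    hx).mulVec hV') (hξ.hasDerivAt x)).mul (hJ.hasDerivAt_tail hc hζ α x)
  refine h.congr_deriv ?_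
  have e := congrArg (ξ x ⬝ᵥ ·) (hJ.cod α _ hx (V x) (deriv c x))
  simp only [dotProduct_add] at e
  congr 2
  simp only [flowVariation, covD, add_dotProduct, sub_dotProduct]
  rw [mulVec_transpose _ (ξ x), ← dotProduct_mulVec]
  simp only [dotProduct_comm _ (ξ x), dotProduct_comm _ (deriv ξ x)]
  linarith

/-- The local products `(left α V · ξ) tailDensity ζ`, antisymmetrized in `ξ` and `ζ`, cancel the
curvature term by `curv_dot`. This is where the Gauss equation enters. -/
lemma hasDerivAt_variationPotential (hJ : J.IsCodazziFamily U σ) (hc : IsCurveIn U c)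
    (hV : ContDiff ℝ ∞ V) (hξ : IsTest ξ) (hζ : IsTest ζ) (x : ℝ) :
    HasDerivAt (variationPotential J c V ξ ζ)
      (bracketVariation J c V ξ ζ x - variationDensity J c ξ ζ V x) x := by
  have h := (hJ.hasDerivAt_inv_conn_dot hc hV hξ hζ x).neg.add (HasDerivAt.fun_sum
    (u := Finset.univ) fun α _ => (hJ.hasDerivAt_flow_dot_tail hc hV hξ hζ α x).sub
      (hJ.hasDerivAt_flow_dot_tail hc hV hζ hξ α x))
  refine h.congr_deriv ?_
  rw [bracketVariation, variationDensity, hJ.curv_dot (hc.mem x), hJ.apply_eq hc, hJ.apply_eq hc]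
  simp only [mulVec_add, dotProduct_add, mulVec_sum, dotProduct_sum, mulVec_smul, dotProduct_smul,
    smul_eq_mul, flow, tailDensity, Finset.sum_add_distrib, Finset.sum_sub_distrib, add_mul,
    mul_comm (J.tail c _ _ _)]
  ring

lemma contDiff_bracketVariation (hJ : J.IsCodazziFamily U σ) (hc : IsCurveIn U c)
    (hV : ContDiff ℝ ∞ V) (hξ : IsTest ξ) (hζ : IsTest ζ) :
    ContDiff ℝ ∞ (bracketVariation J c V ξ ζ) :=
  (hJ.contDiff_localVariation hc hV hξ hζ).add (ContDiff.sum fun α _ =>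
    ((hJ.contDiff_flowVariation hc hV hξ α).mul (hJ.contDiff_tail hc hζ α)).sub
      ((hJ.contDiff_flowVariation hc hV hζ α).mul (hJ.contDiff_tail hc hξ α)))

lemma contDiff_variationDensity (hJ : J.IsCodazziFamily U σ) (hc : IsCurveIn U c)
    (hV : ContDiff ℝ ∞ V) (hξ : IsTest ξ) (hζ : IsTest ζ) :
    ContDiff ℝ ∞ (variationDensity J c ξ ζ V) := by
  have h : ∀ {ξ ζ : ℝ → Fin n → ℝ}, IsTest ξ → IsTest ζ → ContDiff ℝ ∞ fun x =>
      ξ x ⬝ᵥ conn J.metric (c x) (V x) *ᵥ J.apply c ζ x := fun hξ hζ => contDiff_dotProduct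
    hξ.smooth (contDiff_cn hJ.isOpen hJ.metric hc (hJ.contDiff_apply hc hζ) hV).1
  have h' : ∀ {ξ ζ : ℝ → Fin n → ℝ}, IsTest ξ → IsTest ζ → ∀ α, ContDiff ℝ ∞ fun x =>
      (J.covD c ζ x ⬝ᵥ J.left α (c x) *ᵥ V x) * J.tail c ξ α x := fun hξ hζ α =>
    (contDiff_dotProduct (hJ.contDiff_covD hc hζ) (contDiff_matField (hJ.smooth α) hc hV)).mul
      (hJ.contDiff_tail hc hξ α)
  exact ((h hξ hζ).neg.add (h hζ hξ)).add (ContDiff.sum fun α _ => (h' hξ hζ α).sub (h' hζ hξ α))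

/-- The derivative of the bracket along `V`. -/
lemma hasDerivAt_bracket (hJ : J.IsCodazziFamily U σ) (hc : IsCurveIn U c)
    (hV : ContDiff ℝ ∞ V) (hξ : IsTest ξ) (hζ : IsTest ζ) :
    Integrable (variationDensity J c ξ ζ V) ∧
    HasDerivAt (fun ε : ℝ => J.bracket (c + ε • V) ξ ζ) (∫ x, variationDensity J c ξ ζ V x) 0 := by
  have hC : IsCompact (tsupport ξ ∪ tsupport ζ) := hξ.compact.isCompact.union hζ.compact.isCompact
  have z : ∀ x ∉ tsupport ξ ∪ tsupport ζ, ξ x = 0 ∧ deriv ξ x = 0 ∧ ζ x = 0 ∧ deriv ζ x = 0 :=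
    fun x hx => by
      have h1 := eq_zero_of_notMem_tsupport fun h => hx (Or.inl h)
      have h2 := eq_zero_of_notMem_tsupport fun h => hx (Or.inr h)
      exact ⟨h1.1, h1.2, h2.1, h2.2⟩
  have cB := (hJ.contDiff_bracketVariation hc hV hξ hζ).continuous
  have cD := (hJ.contDiff_variationDensity hc hV hξ hζ).continuous
  have iB : Integrable (bracketVariation J c V ξ ζ) := cB.integrable_of_hasCompactSupport (HasCompactSupport.intro hC fun x hx => by
    obtain ⟨h1, h2, h3, h4⟩ := z x hx
    simp [bracketVariation, localVariation, flowVariation, h1, h3])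
  have iD : Integrable (variationDensity J c ξ ζ V) := cD.integrable_of_hasCompactSupport (HasCompactSupport.intro hC fun x hx => by
    obtain ⟨h1, h2, h3, h4⟩ := z x hx
    simp [variationDensity, covD, h1, h2, h3, h4])
  have h0 := integral_eq_zero_of_hasDerivAt_compact
    (hJ.hasDerivAt_variationPotential hc hV hξ hζ) (cB.sub cD)
    (HasCompactSupport.intro hC fun x hx => by
      obtain ⟨h1, h2, h3, h4⟩ := z x hx
      simp [variationPotential, h1, h3])
  rw [integral_sub iB iD, sub_eq_zero] at h0
  refine ⟨iD, (hJ.hasDerivAt_bracket_raw hc hV hξ hζ).congr_deriv ?_⟩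
  rw [← h0]
  have iF : ∀ {ξ : ℝ → Fin n → ℝ}, IsTest ξ → ∀ α, Integrable (flowVariation J c V ξ α) :=
    fun hξ α => (hJ.contDiff_flowVariation hc hV hξ α).continuous.integrable_of_hasCompactSupport
      (hasCompactSupport_dot hξ)
  have iT : ∀ {ξ ζ : ℝ → Fin n → ℝ}, IsTest ξ → IsTest ζ → ∀ α,
      Integrable fun x => flowVariation J c V ξ α x * J.tail c ζ α x := fun hξ hζ α =>
    integrable_mul_antideriv (iF hξ α) (hJ.integrable_tailDensity hc hζ α)
  have iL : Integrable (localVariation J c V ξ ζ) :=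
    (hJ.contDiff_localVariation hc hV hξ hζ).continuous.integrable_of_hasCompactSupport
      (hasCompactSupport_dot' hξ)
  -- Skewness moves the antiderivative off the varied factor; the left factor with index `α` is the
  -- right one with index `σ α`, so the result is again a `tail`.
  have e : ∀ α, ∫ x, (flow (J.left α) c x ⬝ᵥ ξ x) * antideriv (flowVariation J c V ζ (σ α)) x =
      -∫ x, flowVariation J c V ζ (σ α) x * J.tail c ξ (σ α) x := fun α => by
    rw [integral_mul_antideriv_skew (hJ.integrable_flow_dot hc hξ α) (iF hζ _), tail]
    simp only [hJ.left_eq_right α]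
    rfl
  have iS : ∀ α, Integrable fun x => flowVariation J c V ξ α x * J.tail c ζ α x -
      flowVariation J c V ζ α x * J.tail c ξ α x := fun α => (iT hξ hζ α).sub (iT hζ hξ α)
  simp only [bracketVariation]
  rw [integral_add iL (integrable_finsetSum _ fun α _ => iS α), integral_finsetSum _ fun α _ => iS α]
  congr 1
  simp only [e, integral_sub (iT hξ hζ _) (iT hζ hξ _), Finset.sum_add_distrib,
    Finset.sum_sub_distrib, Finset.sum_neg_distrib]
  rw [hJ.sum_involution fun α => ∫ x, flowVariation J c V ζ α x * J.tail c ξ α x, sub_eq_add_neg]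

/-- An operator whose tails form a commuting family of symmetric Codazzi tensors compatible with
the curvature is Hamiltonian. -/
theorem isHamiltonian (hJ : J.IsCodazziFamily U σ) : J.IsHamiltonian U where
  skew _ _ _ hc hξ hη := hJ.bracket_skew hc hξ hη
  jacobi c ξ η ζ hc hξ hη hζ := by
    obtain ⟨i1, h1⟩ := hJ.hasDerivAt_bracket hc (hJ.contDiff_apply hc hη) hξ hζ
    obtain ⟨i2, h2⟩ := hJ.hasDerivAt_bracket hc (hJ.contDiff_apply hc hζ) hη hξ
    obtain ⟨i3, h3⟩ := hJ.hasDerivAt_bracket hc (hJ.contDiff_apply hc hξ) hζ hη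
    refine ⟨_, _, _, h1, h2, h3, ?_⟩
    rw [← integral_add' i1 i2, ← integral_add' (i1.add i2) i3]
    simp only [Pi.add_apply, hJ.variationDensity_cyclic hc, integral_zero]

end IsCodazziFamily

end NonlocalOp

end

/-! ### Application of the criterion to the transformed operator -/

section main

variable {n : ℕ} {U : Set (Fin n → ℝ)} {g v K L gt lam mu vt : MatField n}
  {B A N M P Q R S : ScalarField n}

lemma NonlocalOp.Generates.congr {m : ℕ} {J : NonlocalOp n m} {H : ScalarField n} {w w' : MatField n}
    (h : J.Generates U H w) (hw : ∀ u ∈ U, w' u = w u) : J.Generates U H w' := by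
  obtain ⟨φ, h1, h2, h3⟩ := h
  refine ⟨φ, h1, h2, fun c hc x => ?_⟩
  rw [← h3 c hc x, flow, flow, hw _ (hc.mem x)]

lemma codazzi_one (hU : IsOpen U) (hg : IsMetricOn U g) {u : Fin n → ℝ} (hu : u ∈ U) :
    Codazzi (conn g u) (1 : MatField n) u := fun X Y => by
  have h : ∀ X, matDeriv (1 : MatField n) u X = 0 := matDeriv_const 1 u
  simp only [h, zero_mulVec, zero_add, Pi.one_apply, one_mulVec, conn_symm hU hg hu X Y]

/-- By `fderiv_gradInner` the differential of `½ (∇F, ∇F)` is `dF ∘ Hess F`. Applied to `B`, `N` and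
`h`. -/
lemma isFlux_half_gradInner (hU : IsOpen U) (hg : IsMetricOn U g) {F E : ScalarField n}
    (hF : ContDiffOn ℝ ∞ F U) (hE : ∀ u, E u = (1 / 2) * gradInner g F F u) :
    ContDiffOn ℝ ∞ E U ∧ IsFlux U (hess g F) F E := by
  have e : E = fun u => (1 / 2) * gradInner g F F u := funext hE
  have hs := smooth_gradInner hU hg hF hF
  subst e
  refine ⟨contDiffOn_const.mul hs, isFlux_of_fderiv fun u hu X => ?_⟩
  rw [fderiv_const_mul ((hs.contDiffAt (hU.mem_nhds hu)).differentiableAt (by simp)),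
    _root_.smul_apply, fderiv_gradInner hU hg hF hF hu, smul_eq_mul]
  ring

/-- The tails of the transformed operator. -/
lemma RecipData.isCodazziFamily (hr : RecipData U g v K L B A N M)
    (hgt : ∀ u ∈ U, gt u = (K u)ᵀ * g u * K u) (hvt : ∀ u ∈ U, K u * vt u = L u)
    (hwB : FlowData U g K L B N (hess g B) Q S) (hwN : FlowData U g K L B N (hess g N) P R)
    (hBN : ∀ u ∈ U, Commute (hess g B u) (hess g N u))
    (hlam : lam = newFlow B N vt (hess g B) Q S) (hmu : mu = newFlow B N vt (hess g N) P R)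
    (hcurv : ∀ u ∈ U, ∀ X Y, curv (chr gt) u X Y =
      wedge (gt u) (lam u *ᵥ X) Y + wedge (gt u) X (lam u *ᵥ Y) +
      wedge (gt u) (mu u *ᵥ X) (vt u *ᵥ Y) + wedge (gt u) (vt u *ᵥ X) (mu u *ᵥ Y)) :
    (fourTailOp gt lam mu vt).IsCodazziFamily U ![1, 0, 3, 2] where
  isOpen := hr.isOpen
  metric := hr.isMetricOn hgt
  invol α := by fin_cases α <;> rfl
  right_eq α := by fin_cases α <;> rfl
  smooth α := by
    subst hlam hmu
    fin_cases α
    · exact smooth_newFlow hr hwB hvt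
    · exact MatSmoothOn.const 1
    · exact smooth_newFlow hr hwN hvt
    · exact hr.smooth_vt hvt
  cod α u hu := by
    subst hlam hmu
    fin_cases α
    · exact codazzi_newFlow hr hwB hgt hvt hu
    · exact codazzi_one hr.isOpen (hr.isMetricOn hgt) hu
    · exact codazzi_newFlow hr hwN hgt hvt hu
    · exact hr.codazzi_vt hgt hvt hu
  adj α u hu := by
    subst hlam hmu
    fin_cases α
    · exact selfAdj_newFlow hr hwB hgt hvt hu
    · exact SelfAdj.one _
    · exact selfAdj_newFlow hr hwN hgt hvt hu
    · exact hr.selfAdj_vt hgt hvt hu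
  comm α β u hu := by
    subst hlam hmu
    have c1 := commute_vt_newFlow hr hwB hvt hu
    have c2 := commute_vt_newFlow hr hwN hvt hu
    have c3 := commute_newFlow hr hwB hwN hvt hu (hBN u hu)
    fin_cases α <;> fin_cases β
    · exact Commute.refl _
    · exact Commute.one_right _
    · exact c3
    · exact c1.symm
    · exact Commute.one_left _
    · exact Commute.one_left _
    · exact Commute.one_left _
    · exact Commute.one_left _
    · exact c3.symm
    · exact Commute.one_right _
    · exact Commute.refl _
    · exact c2.symm
    · exact c1
    · exact Commute.one_right _
    · exact c2
    · exact Commute.refl _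
  curv_eq u hu X Y := by
    refine (hcurv u hu X Y).trans ?_
    rw [Fin.sum_univ_four]
    simp [fourTailOp]

/-- The flow with the density `h` is taken to the zero flow. -/
lemma RecipData.newFlow_self (hr : RecipData U g v K L B A N M)
    (hvt : ∀ u ∈ U, K u * vt u = L u) (hv : FlowData U g K L B N v A M) {u : Fin n → ℝ}
    (hu : u ∈ U) : newFlow B N vt v A M u = 0 := by
  have hK : IsUnit (K u).det := isUnit_iff_ne_zero.2 (hr.detK u hu)
  have h := mul_newFlow hr hv hvt hu
  rw [frameFlow, ← hr.v_eq u hu, add_sub_cancel_left, sub_self] at h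
  rw [← one_mul (newFlow B N vt v A M u), ← nonsing_inv_mul _ hK, mul_assoc, h, mul_zero]

end main

end HydroType

end

theorem theorem3 (n : ℕ) (U : Set (Fin n → ℝ)) (hU : IsOpen U)
    -- the flat metric, and the Hamiltonian system `u_t = v u_x` with the density `h`
    (g : HydroType.MatField n) (hg : HydroType.IsMetricOn U g) (hflat : HydroType.IsFlatOn U g)
    (h : HydroType.ScalarField n) (hh : ContDiffOn ℝ ∞ h U)
    (v : HydroType.MatField n) (hv : v = HydroType.hess g h)
    -- the reciprocal transformation, given by two conservation laws of the system
    (B A N M : HydroType.ScalarField n)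
    (hB : ContDiffOn ℝ ∞ B U) (hA : ContDiffOn ℝ ∞ A U)
    (hN : ContDiffOn ℝ ∞ N U) (hM : ContDiffOn ℝ ∞ M U)
    (hBA : HydroType.IsFlux U v B A) (hNM : HydroType.IsFlux U v N M)
    (hdelta : ∀ u ∈ U, B u * M u - A u * N u ≠ 0)
    (hdet : ∀ u ∈ U, (M u • (1 : Matrix (Fin n) (Fin n) ℝ) - N u • v u).det ≠ 0)
    -- the fluxes of `B` and `N` along the Hamiltonian flows with the densities `N` and `B`
    (P Q R S : HydroType.ScalarField n)
    (hP : ContDiffOn ℝ ∞ P U) (hS : ContDiffOn ℝ ∞ S U)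
    (hBP : HydroType.IsFlux U (HydroType.hess g N) B P)
    (hNS : HydroType.IsFlux U (HydroType.hess g B) N S)
    (hPS : ∀ u ∈ U, P u + S u = HydroType.gradInner g B N u)
    (hQ : ∀ u, Q u = (1 / 2) * HydroType.gradInner g B B u)
    (hR : ∀ u, R u = (1 / 2) * HydroType.gradInner g N N u)
    -- the transformed objects
    (gt vt lam mu : HydroType.MatField n)
    (hgt : gt = HydroType.newMetric B A N M v g)
    (hvt : vt = HydroType.newVelocity B A N M v)
    (hlam : lam = HydroType.newFlow B N vt (HydroType.hess g B) Q S)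
    (hmu : mu = HydroType.newFlow B N vt (HydroType.hess g N) P R) :
    -- `gt` is a metric
    HydroType.IsMetricOn U gt ∧
    -- `vt`, `mu`, `lam` are the matrices of the transformed flows, and the last two commute
    -- with the first one
    HydroType.TransformsFlows U B A P Q N M R S v (HydroType.hess g N) (HydroType.hess g B)
      vt mu lam ∧
    HydroType.FlowsCommute U vt lam ∧ HydroType.FlowsCommute U vt mu ∧
    -- the transformed operator is Hamiltonian
    (HydroType.fourTailOp gt lam mu vt).IsHamiltonian U ∧
    -- the transformed system is Hamiltonian with respect to it
    (HydroType.fourTailOp gt lam mu vt).Generates U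
      (fun u => (h u * M u - (1 / 2) * HydroType.gradInner g h h u * N u) /
        (B u * M u - A u * N u)) vt ∧
    -- more generally, it is the transform of the local operator of `g`: if `u_s = w u_x` is the
    -- flow generated by the local operator and a density `H`, and if `F`, `E`, `G` are the fluxes
    -- of `H` along `v` and of `B`, `N` along `w`, then the transformed flow is generated by the
    -- transformed operator and the transformed density
    (∀ (H F E G : HydroType.ScalarField n) (w : HydroType.MatField n),
      ContDiffOn ℝ ∞ H U → ContDiffOn ℝ ∞ F U → ContDiffOn ℝ ∞ E U → ContDiffOn ℝ ∞ G U →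
      (HydroType.localOp g).Generates U H w → HydroType.IsFlux U v H F →
      HydroType.IsFlux U w B E → HydroType.IsFlux U w N G →
      (HydroType.fourTailOp gt lam mu vt).Generates U
        (fun u => (H u * M u - F u * N u) / (B u * M u - A u * N u))
        (HydroType.newFlow B N vt w E G)) ∧
    -- the expansion of the curvature tensor
    ∀ u ∈ U, ∀ i j k l : Fin n,
      HydroType.curvature gt i j k l u =
        lam u i k * (1 : Matrix (Fin n) (Fin n) ℝ) j l
          + lam u j l * (1 : Matrix (Fin n) (Fin n) ℝ) i k
          - lam u j k * (1 : Matrix (Fin n) (Fin n) ℝ) i l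
          - lam u i l * (1 : Matrix (Fin n) (Fin n) ℝ) j k
          + mu u i k * vt u j l + mu u j l * vt u i k
          - mu u j k * vt u i l - mu u i l * vt u j k := by
  subst hv
  have hr := HydroType.recipData_of_isFlux hU hg hflat hh hB hA hN hM hBA hNM hdelta hdet
  have hvt' : ∀ u ∈ U, ((B u * M u - A u * N u)⁻¹ • (M u • 1 - N u • HydroType.hess g h u)) * vt u =
      (B u * M u - A u * N u)⁻¹ • (B u • HydroType.hess g h u - A u • 1) := fun u hu => by
    have hc : Commute (M u • 1 - N u • HydroType.hess g h u)
        (B u • HydroType.hess g h u - A u • 1) := by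
      refine Commute.sub_left ((Commute.one_left _).smul_left _) (Commute.smul_left ?_ _)
      exact ((Commute.refl _).smul_right _).sub_right ((Commute.one_right _).smul_right _)
    rw [hvt, HydroType.newVelocity, Matrix.smul_mul, ← mul_assoc, hc.eq, mul_assoc,
      Matrix.mul_nonsing_inv _ (isUnit_iff_ne_zero.2 (hdet u hu)), mul_one]
  have hgt' : ∀ u ∈ U, gt u =
      ((B u * M u - A u * N u)⁻¹ • (M u • 1 - N u • HydroType.hess g h u))ᵀ * g u *
      ((B u * M u - A u * N u)⁻¹ • (M u • 1 - N u • HydroType.hess g h u)) := fun u _ => by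
    rw [hgt, HydroType.newMetric, Matrix.transpose_smul, Matrix.smul_mul, Matrix.smul_mul,
      Matrix.mul_smul, smul_smul, sq, mul_inv]
  obtain ⟨sQ, fQ⟩ := HydroType.isFlux_half_gradInner hU hg hB hQ
  obtain ⟨sR, fR⟩ := HydroType.isFlux_half_gradInner hU hg hN hR
  obtain ⟨sh, fh⟩ := HydroType.isFlux_half_gradInner hU hg hh (fun _ => rfl)
  have hwB := hr.flowData_hess hB hA sQ hS hBA fQ hNS
  have hwN := hr.flowData_hess hN hM hP sR hNM hBP fR
  -- The original system seen as one of its own commuting flows: the flux of `h` is `½ (∇h, ∇h)`,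
  -- and those of `B` and `N` are `A` and `M`.
  have hwh := hr.flowData_hess hh sh hA hM fh hBA hNM
  have hm := hr.isMetricOn hgt'
  have kl : ∀ u ∈ U, _ := fun u hu => HydroType.mul_newFlow hr hwB hvt' hu
  have km : ∀ u ∈ U, _ := fun u hu => HydroType.mul_newFlow hr hwN hvt' hu
  rw [← hlam] at kl
  rw [← hmu] at km
  have hcurv := fun u hu => hr.curv_eq hgt' hu (hPS u hu) (hQ u) (hR u) (kl u hu) (km u hu)
    (hvt' u hu)
  -- The existence of the flux `P` of `B` along `Hess N` forces the two Hessians to commute, and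
  -- hence `λ` and `μ`.
  have hBN : ∀ u ∈ U, Commute (HydroType.hess g B u) (HydroType.hess g N u) := fun u hu =>
    hBP.commute_hess hU hg hB hP hwN.smw hu (hwN.cod u hu) (hwN.adj u hu)
  have hJ := hr.isCodazziFamily hgt' hvt' hwB hwN hBN hlam hmu hcurv
  have gen : ∀ {H F E G : HydroType.ScalarField n}, ContDiffOn ℝ ∞ H U → ContDiffOn ℝ ∞ F U →
      HydroType.IsFlux U (HydroType.hess g h) H F →
      HydroType.FlowData U g _ _ B N (HydroType.hess g H) E G →
      (HydroType.fourTailOp gt lam mu vt).Generates U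
        (fun u => (H u * M u - F u * N u) / (B u * M u - A u * N u))
        (HydroType.newFlow B N vt (HydroType.hess g H) E G) := fun hH hF hHF hw =>
    hr.generates_newFlow hgt' hvt' hwB hwN hPS hQ hR hlam hmu hH hF hHF hw fun _ _ => rfl
  refine ⟨hm, ?_, ?_, ?_, hJ.isHamiltonian, ?_, ?_, ?_⟩
  · rw [hmu, hlam]
    exact hr.transformsFlows hvt' _ _ P Q R S
  -- Among the left factors, the indices `0, 2, 3` stand for `λ`, `μ` and the new velocity.
  · exact HydroType.flowsCommute_of_codazzi hU hm (hJ.smooth 3) (hJ.smooth 0) (hJ.cod 3) (hJ.cod 0)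
      (hJ.comm 3 0)
  · exact HydroType.flowsCommute_of_codazzi hU hm (hJ.smooth 3) (hJ.smooth 2) (hJ.cod 3) (hJ.cod 2)
      (hJ.comm 3 2)
  -- The flow of `h`, with the fluxes `A` and `M`, is transformed to zero; the constant `1` added to
  -- the flux along `μ` yields the new velocity.
  · refine HydroType.generates_add_tail (gen hh sh fh hwh) fun u hu => ?_
    rw [hr.newFlow_self hvt' hwh hu, zero_add]
  · intro H F E G w hH hF hE hG hw hHF hBE hNG
    have e : ∀ u ∈ U, w u = HydroType.hess g H u := fun u hu =>
      HydroType.eq_hess_of_generates hU hg hH hw hu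
    refine (gen hH hF hHF (hr.flowData_hess hH hF hE hG hHF (fun u hu => ?_)
      (fun u hu => ?_))).congr fun u hu => ?_
    · rw [← e u hu]; exact hBE u hu
    · rw [← e u hu]; exact hNG u hu
    · rw [HydroType.newFlow, HydroType.newFlow, e u hu]
  · exact fun u hu i j k l => HydroType.curvature_eq_of_curv hm hu (hcurv u hu) i j k l
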